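/- Let $k$ be a field and let $G$, $G'$ be finite groups whose orders are not divisible by the characteristic of $k$. Write $\mathcal K(G)$ for the set of conjugacy classes of $G$ and $Z_g$ for the centralizer of $g\in G$. A \emph{ramification system with irreducible representations} (RSR) $(G,r,\overrightarrow\rho,u)$ consists of a map $u:\mathcal K(G)\to G$ with $u(C)\in C$ and, for each $C\in\mathcal K(G)$, a (possibly empty or infinite) set $I_C$ and a family $(\rho_C^{(i)})_{i\in I_C}$ of irreducible right representations of $Z_{u(C)}$ over $k$ on spaces $X_C^{(i)}$ with bases $(x_C^{(i,j)})_{j\in J_C(i)}$; the ramification is $r_C=\sum_{i\in I_C}|J_C(i)|$ (so $I_C=\emptyset$ if and only if $r_C=0$). Two RSRs $(G,r,\overrightarrow\rho,u)$ and $(G',r',\overrightarrow{\rho'},u')$ are \emph{isomorphic} if there is a group isomorphism $\phi:G\to G'$ and, for every $C\in\mathcal K(G)$, an element $h_C\in G$ with $\phi(h_C^{-1}u(C)h_C)=u'(\phi(C))$ and a bijection $\phi_C:I_C\to I'_{\phi(C)}$ such that $\rho_C^{(i)}\cong\rho'^{(\phi_C(i))}_{\phi(C)}\circ\phi_{h_C}$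 as representations of $Z_{u(C)}$ for all $i\in I_C$, where $\phi_{h_C}(z)=\phi(h_C^{-1}zh_C)$. The Hopf quiver $Q$ of an RSR has vertex set $G$ and, for $x,y\in G$ with $x^{-1}y\in C$, the arrows $a_{y,x}^{(i,j)}:x\to y$ with $i\in I_C$, $j\in J_C(i)$. For each $C$ choose representatives $g_\theta$ ($\theta\in\Theta_C$) of the cosets in $G=\bigcup_\theta Z_{u(C)}g_\theta$, with $1$ representing $Z_{u(C)}$; for $h\in G$ let $g_\theta h=\zeta_\theta(h)g_{\theta'}$ with $\zeta_\theta(h)\in Z_{u(C)}$. Let $(kQ_1^c,G,r,\overrightarrow\rho,u)$ be the $kG$-Hopf bimodule with the arrows as basis, coactions $\delta^-(a)=y\otimes a$, $\delta^+(a)=a\otimes x$ for $a:x\to y$, and actions $$h\cdot a_{y,x}^{(i,j)}=a_{hy,hx}^{(i,j)},\qquad a_{y,x}^{(i,j)}\cdot h=\sum_{s\in J_C(i)}k^{(i,j,s)}_{C,h}\,a_{yh,xh}^{(i,s)},$$ where $x^{-1}y=g_\theta^{-1}u(C)g_\theta$ and $x_C^{(i,j)}\cdot\zeta_\theta(h)=\sum_s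 k_{C,h}^{(i,j,s)}x_C^{(i,s)}$. Let $(kQ_1^a,G,r,\overrightarrow\rho,u)$ be the dual $(kG)^*$-Hopf bimodule with the arrows as basis: $f\cdot a=f(y)a$, $a\cdot f=f(x)a$ for $a:x\to y$, $\delta^-(a)=\sum_{g}p_g\otimes g^{-1}\cdot a$, $\delta^+(a)=\sum_g T_g(a)\otimes p_g$, where $(p_g)$ is the basis of $(kG)^*$ dual to $G$ and $T_g$ is the transpose of $b\mapsto b\cdot g$ in the basis of arrows. For a Hopf bimodule $M$ over a Hopf algebra $B$ let $T_B(M)=\bigoplus_n M^{\otimes_B n}$ be the tensor Hopf algebra, $T_B^c(M)=\bigoplus_n M^{\Box_B n}$ the cotensor Hopf algebra, and $B[M]$ the Hopf subalgebra of $T_B^c(M)$ generated by $B$ and $M$, all graded by $n$. Put $kQ^c=T^c_{kG}(kQ_1^c)$, $kQ^s=T_{kG}(kQ_1^c)$, $kQ^a=T_{(kG)^*}(kQ_1^a)$, $kQ^{sc}=T^c_{(kG)^*}(kQ_1^a)$. For a Hopf algebra isomorphism $\phi:B\to B'$ and a $B'$-Hopf bimodule $M'$, let ${}_\phi^{\phi^{-1}}(M')_\phi^{\phi^{-1}}$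 be the $B$-Hopf bimodule obtained by pulling the actions back along $\phi$ and pushing the coactions out along $\phi^{-1}$. Let $(G,r,\overrightarrow\rho,u)$ and $(G',r',\overrightarrow{\rho'},u')$ be two RSRs over $k$, with Hopf quivers $Q$ and $Q'$, and let the above objects be formed with any choices of coset representatives. Then the following are equivalent: (i) the two RSRs are isomorphic; (ii) there is a Hopf algebra isomorphism $\phi:kG\to kG'$ such that $(kQ_1^c,G,r,\overrightarrow\rho,u)\cong{}_\phi^{\phi^{-1}}\big((kQ_1'^c,G',r',\overrightarrow{\rho'},u')\big)_\phi^{\phi^{-1}}$ as $kG$-Hopf bimodules; (iii) $kQ^c\cong kQ'^c$ as graded Hopf algebras; (iv) $kQ^s\cong kQ'^s$ as graded Hopf algebras; (v) $kG[kQ_1^c]\cong kG'[kQ_1'^c]$ as graded Hopf algebras. If moreover $Q$ is finite, these are also equivalent to each of: (vi) $kQ^a\cong kQ'^a$ as graded Hopf algebras; (vii) $kQ^{sc}\cong kQ'^{sc}$ as graded Hopf algebras; (viii) $(kG)^*[kQ_1^a]\cong(kG')^*[kQ_1'^a]$ as graded Hopf algebras. -/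

import Mathlib

open scoped TensorProduct

namespace QuiverHopf

noncomputable section

/-- A Hopf bimodule over a bialgebra `B`: a `B`-bimodule and `B`-bicomodule `M` whose two coactions
are morphisms of `B`-bimodules for the diagonal actions on `B ⊗ M` and `M ⊗ B`. -/
structure HopfBimodule (k B M : Type*) [Field k] [Ring B] [Bialgebra k B]
    [AddCommGroup M] [Module k M] where
  actL : B →ₗ[k] M →ₗ[k] M
  actR : M →ₗ[k] B →ₗ[k] M
  coactL : M →ₗ[k] B ⊗[k] M
  coactR : M →ₗ[k] M ⊗[k] B
  one_actL : ∀ m, actL 1 m = m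
  mul_actL : ∀ a b m, actL (a * b) m = actL a (actL b m)
  actR_one : ∀ m, actR m 1 = m
  actR_mul : ∀ m a b, actR m (a * b) = actR (actR m a) b
  actL_actR : ∀ a m b, actR (actL a m) b = actL a (actR m b)
  coassocL : ∀ m, TensorProduct.assoc k B B M (Coalgebra.comul.rTensor M (coactL m)) =
    coactL.lTensor B (coactL m)
  counitL : ∀ m, Coalgebra.counit.rTensor M (coactL m) = (1 : k) ⊗ₜ[k] m
  coassocR : ∀ m, TensorProduct.assoc k M B B (coactR.rTensor B (coactR m)) =
    Coalgebra.comul.lTensor M (coactR m)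
  counitR : ∀ m, Coalgebra.counit.lTensor M (coactR m) = m ⊗ₜ[k] (1 : k)
  coactL_coactR : ∀ m, TensorProduct.assoc k B M B (coactL.rTensor B (coactR m)) =
    coactR.lTensor B (coactL m)
  coactL_actL : ∀ b m, coactL (actL b m) =
    TensorProduct.map₂ (LinearMap.mul k B) actL (Coalgebra.comul b) (coactL m)
  coactL_actR : ∀ m b, coactL (actR m b) =
    TensorProduct.map₂ (LinearMap.mul k B) actR (coactL m) (Coalgebra.comul b)
  coactR_actL : ∀ b m, coactR (actL b m) =
    TensorProduct.map₂ actL (LinearMap.mul k B) (Coalgebra.comul b) (coactR m)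
  coactR_actR : ∀ m b, coactR (actR m b) =
    TensorProduct.map₂ actR (LinearMap.mul k B) (coactR m) (Coalgebra.comul b)

section General

variable {k : Type*} [Field k]
variable {B' : Type*} [Ring B'] [Bialgebra k B'] {M' : Type*} [AddCommGroup M'] [Module k M']
variable {B : Type*} [Ring B] [Bialgebra k B] {M : Type*} [AddCommGroup M] [Module k M]

/-- Isomorphism of Hopf bimodules over the same bialgebra. -/
def HopfBimodule.IsIso (h : HopfBimodule k B M) (h' : HopfBimodule k B M') : Prop :=
  ∃ f : M ≃ₗ[k] M',
    (∀ b m, f (h.actL b m) = h'.actL b (f m)) ∧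
    (∀ m b, f (h.actR m b) = h'.actR (f m) b) ∧
    (∀ m, h'.coactL (f m) = f.toLinearMap.lTensor B (h.coactL m)) ∧
    (∀ m, h'.coactR (f m) = f.toLinearMap.rTensor B (h.coactR m))

theorem map₂_naturality {U V U' V' W W' X Y X' Y' Z Z' : Type*}
    [AddCommGroup U] [AddCommGroup V] [AddCommGroup U'] [AddCommGroup V'] [AddCommGroup W]
    [AddCommGroup W'] [AddCommGroup X] [AddCommGroup Y] [AddCommGroup X'] [AddCommGroup Y']
    [AddCommGroup Z] [AddCommGroup Z'] [Module k U] [Module k V] [Module k U'] [Module k V']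
    [Module k W] [Module k W'] [Module k X] [Module k Y] [Module k X'] [Module k Y']
    [Module k Z] [Module k Z']
    {β : U →ₗ[k] U' →ₗ[k] W} {γ : V →ₗ[k] V' →ₗ[k] W'}
    {β' : X →ₗ[k] X' →ₗ[k] Z} {γ' : Y →ₗ[k] Y' →ₗ[k] Z'}
    {p : U →ₗ[k] X} {q : V →ₗ[k] Y} {p' : U' →ₗ[k] X'} {q' : V' →ₗ[k] Y'}
    {r : W →ₗ[k] Z} {s : W' →ₗ[k] Z'}
    (h₁ : ∀ u u', r (β u u') = β' (p u) (p' u')) (h₂ : ∀ v v', s (γ v v') = γ' (q v) (q' v'))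
    (x : U ⊗[k] V) (y : U' ⊗[k] V') :
    TensorProduct.map r s (TensorProduct.map₂ β γ x y) =
      TensorProduct.map₂ β' γ' (TensorProduct.map p q x) (TensorProduct.map p' q' y) := by
  induction x with
  | zero => simp
  | add x x' hx hx' => simp only [map_add, LinearMap.add_apply, hx, hx']
  | tmul u v =>
    induction y with
    | zero => simp
    | add y y' hy hy' => simp only [map_add, hy, hy']
    | tmul u' v' => simp [h₁, h₂]

/-- For an isomorphism `φ : B → B'` and a Hopf bimodule over `B'`, the Hopf bimodule over `B` on the
same space with actions pulled back along `φ` and coactions pushed out along `φ⁻¹`. -/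
def HopfBimodule.pullPush (φ : B ≃ₐc[k] B') (h : HopfBimodule k B' M') : HopfBimodule k B M' where
  actL := h.actL ∘ₗ (φ : B →ₗ[k] B')
  actR := h.actR.compl₂ (φ : B →ₗ[k] B')
  coactL := (φ.symm : B' →ₗ[k] B).rTensor M' ∘ₗ h.coactL
  coactR := (φ.symm : B' →ₗ[k] B).lTensor M' ∘ₗ h.coactR
  one_actL m := by simp [h.one_actL]
  mul_actL a b m := by simp [h.mul_actL]
  actR_one m := by simp [h.actR_one]
  actR_mul m a b := by simp [h.actR_mul]
  actL_actR a m b := by simp [h.actL_actR]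
  coassocL m := by
    have e₁ (z : B' ⊗[k] M') : TensorProduct.assoc k B B M' (Coalgebra.comul.rTensor M'
        ((φ.symm : B' →ₗ[k] B).rTensor M' z)) =
        TensorProduct.map (φ.symm : B' →ₗ[k] B) ((φ.symm : B' →ₗ[k] B).rTensor M')
          (TensorProduct.assoc k B' B' M' (Coalgebra.comul.rTensor M' z)) := by
      induction z with
      | zero => simp
      | add x y hx hy => simp only [map_add, hx, hy]
      | tmul b m =>
        have := CoalgHomClass.map_comp_comul_apply φ.symm b
        simp only [LinearMap.rTensor_tmul]
        erw [← this]
        induction (Coalgebra.comul (R := k) b) with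
        | zero => simp
        | add x y hx hy => simp only [map_add, TensorProduct.add_tmul, hx, hy]
        | tmul b b' => simp
    simp only [LinearMap.comp_apply]
    rw [e₁, h.coassocL]
    induction (h.coactL m) with
    | zero => simp
    | add x y hx hy => simp only [map_add, hx, hy]
    | tmul b b' => simp
  counitL m := by
    rw [← h.counitL, LinearMap.comp_apply, ← LinearMap.rTensor_comp_apply]
    congr 2
    exact CoalgHomClass.counit_comp φ.symm
  coassocR m := by
    have e₁ (z : M' ⊗[k] B') : Coalgebra.comul.lTensor M'
        ((φ.symm : B' →ₗ[k] B).lTensor M' z) =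
        TensorProduct.map .id (TensorProduct.map (φ.symm : B' →ₗ[k] B) (φ.symm : B' →ₗ[k] B))
          (Coalgebra.comul.lTensor M' z) := by
      induction z with
      | zero => simp
      | add x y hx hy => simp only [map_add, hx, hy]
      | tmul m b =>
        have := CoalgHomClass.map_comp_comul_apply φ.symm b
        simp only [LinearMap.lTensor_tmul, TensorProduct.map_tmul]
        erw [← this]
        rfl
    simp only [LinearMap.comp_apply]
    rw [e₁, ← h.coassocR]
    induction (h.coactR m) with
    | zero => simp
    | add x y hx hy => simp only [map_add, hx, hy]
    | tmul m b =>
      simp only [LinearMap.lTensor_tmul, LinearMap.rTensor_tmul, LinearMap.comp_apply]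
      induction (h.coactR m) with
      | zero => simp
      | add x y hx hy => simp only [map_add, TensorProduct.add_tmul, hx, hy]
      | tmul m b => simp
  counitR m := by
    rw [← h.counitR, LinearMap.comp_apply, ← LinearMap.lTensor_comp_apply]
    congr 2
    exact CoalgHomClass.counit_comp φ.symm
  coactL_coactR m := by
    have e₁ (z : M' ⊗[k] B') : TensorProduct.assoc k B M' B
        ((((φ.symm : B' →ₗ[k] B).rTensor M') ∘ₗ h.coactL).rTensor B
          ((φ.symm : B' →ₗ[k] B).lTensor M' z)) =
        TensorProduct.map (φ.symm : B' →ₗ[k] B) ((φ.symm : B' →ₗ[k] B).lTensor M')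
          (TensorProduct.assoc k B' M' B' (h.coactL.rTensor B' z)) := by
      induction z with
      | zero => simp
      | add x y hx hy => simp only [map_add, hx, hy]
      | tmul m b =>
        simp only [LinearMap.lTensor_tmul, LinearMap.rTensor_tmul, LinearMap.comp_apply]
        induction (h.coactL m) with
        | zero => simp
        | add x y hx hy => simp only [map_add, TensorProduct.add_tmul, hx, hy]
        | tmul b b' => simp
    rw [LinearMap.comp_apply, e₁, h.coactL_coactR, LinearMap.comp_apply]
    induction (h.coactL m) with
    | zero => simp
    | add x y hx hy => simp only [map_add, hx, hy]
    | tmul m b => simp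
  coactL_actL b m := by
    have := CoalgHomClass.map_comp_comul_apply φ b
    simp only [LinearMap.comp_apply, h.coactL_actL, LinearMap.rTensor]
    erw [← this]
    rw [map₂_naturality (β' := LinearMap.mul k B) (γ' := h.actL) (p := (φ.symm : B' →ₗ[k] B)) (q := .id) (p' := (φ.symm : B' →ₗ[k] B)) (q' := .id)
      (by simp) (by simp)]
    generalize (Coalgebra.comul (R := k) b) = x
    generalize TensorProduct.map (φ.symm : B' →ₗ[k] B) LinearMap.id (h.coactL m) = y
    induction x with
    | zero => simp
    | add x x' hx hx' => simp only [map_add, LinearMap.add_apply, hx, hx']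
    | tmul u v =>
      simp
  coactL_actR m b := by
    have := CoalgHomClass.map_comp_comul_apply φ b
    simp only [LinearMap.comp_apply, LinearMap.compl₂_apply, h.coactL_actR, LinearMap.rTensor]
    erw [← this]
    rw [map₂_naturality (β' := LinearMap.mul k B) (γ' := h.actR) (p := (φ.symm : B' →ₗ[k] B)) (q := .id) (p' := (φ.symm : B' →ₗ[k] B)) (q' := .id)
      (by simp) (by simp)]
    generalize (Coalgebra.comul (R := k) b) = x
    generalize TensorProduct.map (φ.symm : B' →ₗ[k] B) LinearMap.id (h.coactL m) = y
    induction x with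
    | zero => simp
    | add x x' hx hx' => simp only [map_add, hx, hx']
    | tmul u v =>
      induction y with
      | zero => simp
      | add y y' hy hy' => simp only [map_add, LinearMap.add_apply, hy, hy']
      | tmul y y' => simp
  coactR_actL b m := by
    have := CoalgHomClass.map_comp_comul_apply φ b
    simp only [LinearMap.comp_apply, h.coactR_actL, LinearMap.lTensor]
    erw [← this]
    rw [map₂_naturality (β' := h.actL) (γ' := LinearMap.mul k B) (p := .id) (q := (φ.symm : B' →ₗ[k] B)) (p' := .id) (q' := (φ.symm : B' →ₗ[k] B))
      (by simp) (by simp)]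
    generalize (Coalgebra.comul (R := k) b) = x
    generalize TensorProduct.map LinearMap.id (φ.symm : B' →ₗ[k] B) (h.coactR m) = y
    induction x with
    | zero => simp
    | add x x' hx hx' => simp only [map_add, LinearMap.add_apply, hx, hx']
    | tmul u v =>
      simp
  coactR_actR m b := by
    have := CoalgHomClass.map_comp_comul_apply φ b
    simp only [LinearMap.comp_apply, LinearMap.compl₂_apply, h.coactR_actR, LinearMap.lTensor]
    erw [← this]
    rw [map₂_naturality (β' := h.actR) (γ' := LinearMap.mul k B) (p := .id) (q := (φ.symm : B' →ₗ[k] B)) (p' := .id) (q' := (φ.symm : B' →ₗ[k] B))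
      (by simp) (by simp)]
    generalize (Coalgebra.comul (R := k) b) = x
    generalize TensorProduct.map LinearMap.id (φ.symm : B' →ₗ[k] B) (h.coactR m) = y
    induction x with
    | zero => simp
    | add x x' hx hx' => simp only [map_add, hx, hx']
    | tmul u v =>
      induction y with
      | zero => simp
      | add y y' hy hy' => simp only [map_add, LinearMap.add_apply, hy, hy']
      | tmul y y' => simp

end General

section TensorHopf

variable {k : Type*} [Field k]
variable {B : Type*} [Ring B] [Bialgebra k B] {M : Type*} [AddCommGroup M] [Module k M]

/-- Relations presenting the tensor algebra of the `B`-bimodule `M` as a quotient of the free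
algebra on the vector space `B ⊕ M`. -/
inductive TensorHopf.Rel (h : HopfBimodule k B M) :
    TensorAlgebra k (B × M) → TensorAlgebra k (B × M) → Prop
  | one : Rel h (TensorAlgebra.ι k (1, 0)) 1
  | mul (a b : B) : Rel h (TensorAlgebra.ι k (a, 0) * TensorAlgebra.ι k (b, 0))
      (TensorAlgebra.ι k (a * b, 0))
  | actL (b : B) (m : M) : Rel h (TensorAlgebra.ι k (b, 0) * TensorAlgebra.ι k (0, m))
      (TensorAlgebra.ι k (0, h.actL b m))
  | actR (m : M) (b : B) : Rel h (TensorAlgebra.ι k (0, m) * TensorAlgebra.ι k (b, 0))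
      (TensorAlgebra.ι k (0, h.actR m b))

/-- The tensor algebra `T_B(M) = B ⊕ M ⊕ (M ⊗_B M) ⊕ ⋯` of the bimodule underlying a Hopf
bimodule: the algebra generated by the algebra `B` and the `B`-bimodule `M`. -/
def TensorHopf (h : HopfBimodule k B M) : Type _ := RingQuot (TensorHopf.Rel h)

namespace TensorHopf

variable (h : HopfBimodule k B M)

instance : Ring (TensorHopf h) := inferInstanceAs (Ring (RingQuot (TensorHopf.Rel h)))
instance : Algebra k (TensorHopf h) := inferInstanceAs (Algebra k (RingQuot (TensorHopf.Rel h)))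

/-- The quotient map from the free algebra on `B ⊕ M`. -/
def proj : TensorAlgebra k (B × M) →ₐ[k] TensorHopf h := RingQuot.mkAlgHom k (TensorHopf.Rel h)

theorem proj_rel {x y : TensorAlgebra k (B × M)} (r : Rel h x y) : proj h x = proj h y :=
  RingQuot.mkAlgHom_rel k r

/-- The inclusion of `B` in degree zero. -/
def inB : B →ₐ[k] TensorHopf h :=
  AlgHom.ofLinearMap ((proj h).toLinearMap ∘ₗ TensorAlgebra.ι k ∘ₗ LinearMap.inl k B M)
    (by simpa using proj_rel h .one)
    (fun a b ↦ by simpa using (proj_rel h (.mul a b)).symm)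

/-- The inclusion of `M` in degree one. -/
def inM : M →ₗ[k] TensorHopf h :=
  (proj h).toLinearMap ∘ₗ TensorAlgebra.ι k ∘ₗ LinearMap.inr k B M

theorem inB_mul_inM (b : B) (m : M) : inB h b * inM h m = inM h (h.actL b m) := by
  simpa [inB, inM] using proj_rel h (.actL b m)

theorem inM_mul_inB (m : M) (b : B) : inM h m * inB h b = inM h (h.actR m b) := by
  simpa [inB, inM] using proj_rel h (.actR m b)

variable {h} in
/-- The universal property of the tensor algebra of a bimodule. -/
def lift {D : Type*} [Ring D] [Algebra k D] (f : B →ₐ[k] D) (g : M →ₗ[k] D)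
    (hl : ∀ b m, g (h.actL b m) = f b * g m) (hr : ∀ m b, g (h.actR m b) = g m * f b) :
    TensorHopf h →ₐ[k] D :=
  RingQuot.liftAlgHom k ⟨TensorAlgebra.lift k (f.toLinearMap.coprod g), by
    rintro _ _ (_ | ⟨a, b⟩ | ⟨b, m⟩ | ⟨m, b⟩) <;> simp [hl, hr]⟩

variable {h} in
theorem lift_inB {D : Type*} [Ring D] [Algebra k D] (f : B →ₐ[k] D) (g : M →ₗ[k] D)
    (hl : ∀ b m, g (h.actL b m) = f b * g m) (hr : ∀ m b, g (h.actR m b) = g m * f b) (b : B) :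
    lift f g hl hr (inB h b) = f b := by
  have := RingQuot.liftAlgHom_mkAlgHom_apply k (s := TensorHopf.Rel h)
    (TensorAlgebra.lift k (f.toLinearMap.coprod g)) (by
    rintro _ _ (_ | ⟨a, b⟩ | ⟨b, m⟩ | ⟨m, b⟩) <;> simp [hl, hr]) (TensorAlgebra.ι k (b, 0))
  exact this.trans (by simp)

variable {h} in
theorem lift_inM {D : Type*} [Ring D] [Algebra k D] (f : B →ₐ[k] D) (g : M →ₗ[k] D)
    (hl : ∀ b m, g (h.actL b m) = f b * g m) (hr : ∀ m b, g (h.actR m b) = g m * f b) (m : M) :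
    lift f g hl hr (inM h m) = g m := by
  have := RingQuot.liftAlgHom_mkAlgHom_apply k (s := TensorHopf.Rel h)
    (TensorAlgebra.lift k (f.toLinearMap.coprod g)) (by
    rintro _ _ (_ | ⟨a, b⟩ | ⟨b, m⟩ | ⟨m, b⟩) <;> simp [hl, hr]) (TensorAlgebra.ι k (0, m))
  exact this.trans (by simp)

variable {h} in
theorem algHom_ext {D : Type*} [Ring D] [Algebra k D] {f g : TensorHopf h →ₐ[k] D}
    (hB : ∀ b, f (inB h b) = g (inB h b)) (hM : ∀ m, f (inM h m) = g (inM h m)) : f = g := by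
  apply RingQuot.ringQuot_ext' k
  apply TensorAlgebra.hom_ext
  apply LinearMap.prod_ext
  · ext b; exact hB b
  · ext m; exact hM m

/-- The comultiplication on `M`: the sum of the two coactions. -/
def comulM : M →ₗ[k] TensorHopf h ⊗[k] TensorHopf h :=
  TensorProduct.map (inB h).toLinearMap (inM h) ∘ₗ h.coactL +
    TensorProduct.map (inM h) (inB h).toLinearMap ∘ₗ h.coactR

theorem map₂_mul {A : Type*} [Ring A] [Algebra k A] (x y : A ⊗[k] A) :
    TensorProduct.map₂ (LinearMap.mul k A) (LinearMap.mul k A) x y = x * y := by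
  induction x with
  | zero => simp
  | add x x' hx hx' => simp only [map_add, LinearMap.add_apply, hx, hx', add_mul]
  | tmul u v =>
    induction y with
    | zero => simp
    | add y y' hy hy' => simp only [map_add, hy, hy', mul_add]
    | tmul u' v' => simp

/-- The comultiplication of `T_B(M)`: the algebra map which is `Δ_B` on `B` and `δ⁻ + δ⁺` on `M`. -/
def comulHom : TensorHopf h →ₐ[k] TensorHopf h ⊗[k] TensorHopf h :=
  lift ((Algebra.TensorProduct.map (inB h) (inB h)).comp (Bialgebra.comulAlgHom k B)) (comulM h)
    (fun b m ↦ by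
      simp only [comulM, LinearMap.add_apply, LinearMap.comp_apply, h.coactL_actL, h.coactR_actL,
        AlgHom.comp_apply, Bialgebra.comulAlgHom_apply, mul_add, ← map₂_mul]
      congr 1
      · exact map₂_naturality (by simp) (by simp [inB_mul_inM]) _ _
      · exact map₂_naturality (by simp [inB_mul_inM]) (by simp) _ _)
    (fun m b ↦ by
      simp only [comulM, LinearMap.add_apply, LinearMap.comp_apply, h.coactL_actR, h.coactR_actR,
        AlgHom.comp_apply, Bialgebra.comulAlgHom_apply, add_mul, ← map₂_mul]
      congr 1
      · exact map₂_naturality (by simp) (by simp [inM_mul_inB]) _ _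
      · exact map₂_naturality (by simp [inM_mul_inB]) (by simp) _ _)

/-- The counit of `T_B(M)`: it is `ε_B` on `B` and vanishes on `M`. -/
def counitHom : TensorHopf h →ₐ[k] k :=
  lift (Bialgebra.counitAlgHom k B) 0 (by simp) (by simp)

theorem comulHom_inB (b : B) : comulHom h (inB h b) =
    TensorProduct.map (inB h).toLinearMap (inB h).toLinearMap (Coalgebra.comul b) :=
  lift_inB _ _ _ _ b

theorem comulHom_inM (m : M) : comulHom h (inM h m) =
    TensorProduct.map (inB h).toLinearMap (inM h) (h.coactL m) +
    TensorProduct.map (inM h) (inB h).toLinearMap (h.coactR m) :=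
  lift_inM _ _ _ _ m

theorem counitHom_inB (b : B) : counitHom h (inB h b) = Coalgebra.counit b := lift_inB _ _ _ _ b
theorem counitHom_inM (m : M) : counitHom h (inM h m) = 0 := lift_inM _ _ _ _ m

theorem comul_rTensor_inB {X : Type*} [AddCommGroup X] [Module k X] (q : X →ₗ[k] TensorHopf h)
    (z : B ⊗[k] X) :
    TensorProduct.assoc k _ _ _ ((comulHom h).toLinearMap.rTensor _
      (TensorProduct.map (inB h).toLinearMap q z)) =
    TensorProduct.map (inB h).toLinearMap (TensorProduct.map (inB h).toLinearMap q)
      (TensorProduct.assoc k _ _ _ (Coalgebra.comul.rTensor X z)) := by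
  induction z with
  | zero => simp
  | add x y hx hy => simp only [map_add, hx, hy]
  | tmul b x =>
    simp only [TensorProduct.map_tmul, LinearMap.rTensor_tmul, AlgHom.toLinearMap_apply,
      comulHom_inB]
    induction (Coalgebra.comul (R := k) b) with
    | zero => simp
    | add x y hx hy => simp only [map_add, TensorProduct.add_tmul, hx, hy]
    | tmul b b' => simp

theorem comul_rTensor_inM {X : Type*} [AddCommGroup X] [Module k X] (q : X →ₗ[k] TensorHopf h)
    (z : M ⊗[k] X) :
    TensorProduct.assoc k _ _ _ ((comulHom h).toLinearMap.rTensor _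
      (TensorProduct.map (inM h) q z)) =
    TensorProduct.map (inB h).toLinearMap (TensorProduct.map (inM h) q)
      (TensorProduct.assoc k _ _ _ (h.coactL.rTensor X z)) +
    TensorProduct.map (inM h) (TensorProduct.map (inB h).toLinearMap q)
      (TensorProduct.assoc k _ _ _ (h.coactR.rTensor X z)) := by
  induction z with
  | zero => simp
  | add x y hx hy => simp only [map_add, hx, hy]; abel
  | tmul m x =>
    simp only [TensorProduct.map_tmul, LinearMap.rTensor_tmul, AlgHom.toLinearMap_apply,
      comulHom_inM, map_add, TensorProduct.add_tmul]
    congr 1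
    · induction (h.coactL m) with
      | zero => simp
      | add x y hx hy => simp only [map_add, TensorProduct.add_tmul, hx, hy]
      | tmul b b' => simp
    · induction (h.coactR m) with
      | zero => simp
      | add x y hx hy => simp only [map_add, TensorProduct.add_tmul, hx, hy]
      | tmul b b' => simp

theorem comul_lTensor_inB {X : Type*} [AddCommGroup X] [Module k X] (q : X →ₗ[k] TensorHopf h)
    (z : X ⊗[k] B) :
    (comulHom h).toLinearMap.lTensor _ (TensorProduct.map q (inB h).toLinearMap z) =
    TensorProduct.map q (TensorProduct.map (inB h).toLinearMap (inB h).toLinearMap)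
      (Coalgebra.comul.lTensor X z) := by
  induction z with
  | zero => simp
  | add x y hx hy => simp only [map_add, hx, hy]
  | tmul x b => simp [comulHom_inB]

theorem comul_lTensor_inM {X : Type*} [AddCommGroup X] [Module k X] (q : X →ₗ[k] TensorHopf h)
    (z : X ⊗[k] M) :
    (comulHom h).toLinearMap.lTensor _ (TensorProduct.map q (inM h) z) =
    TensorProduct.map q (TensorProduct.map (inB h).toLinearMap (inM h)) (h.coactL.lTensor X z) +
    TensorProduct.map q (TensorProduct.map (inM h) (inB h).toLinearMap)
      (h.coactR.lTensor X z) := by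
  induction z with
  | zero => simp
  | add x y hx hy => simp only [map_add, hx, hy]; abel
  | tmul x m => simp [comulHom_inM, TensorProduct.tmul_add]

/-- The bialgebra structure of `T_B(M)`. -/
instance : Bialgebra k (TensorHopf h) :=
  Bialgebra.ofAlgHom (comulHom h) (counitHom h)
    (by
      apply algHom_ext
      · intro b
        change TensorProduct.assoc k _ _ _ ((comulHom h).toLinearMap.rTensor _
          (comulHom h (inB h b))) = (comulHom h).toLinearMap.lTensor _ (comulHom h (inB h b))
        rw [comulHom_inB, comul_rTensor_inB, comul_lTensor_inB, Coalgebra.coassoc_apply]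
      · intro m
        change TensorProduct.assoc k _ _ _ ((comulHom h).toLinearMap.rTensor _
          (comulHom h (inM h m))) = (comulHom h).toLinearMap.lTensor _ (comulHom h (inM h m))
        rw [comulHom_inM, map_add, map_add, map_add, comul_rTensor_inB, comul_rTensor_inM,
          comul_lTensor_inB, comul_lTensor_inM, h.coassocL, h.coassocR, h.coactL_coactR, add_assoc])
    (by
      apply algHom_ext
      · intro b
        change TensorProduct.map (counitHom h).toLinearMap .id (comulHom h (inB h b)) =
          (1 : k) ⊗ₜ[k] inB h b
        rw [comulHom_inB, TensorProduct.map_map]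
        have := congrArg (TensorProduct.map .id (inB h).toLinearMap)
          (Coalgebra.rTensor_counit_comul (R := k) b)
        rw [LinearMap.rTensor, TensorProduct.map_map, TensorProduct.map_tmul] at this
        have e₁ : (counitHom h).toLinearMap ∘ₗ (inB h).toLinearMap = .id ∘ₗ Coalgebra.counit := by
          ext; simp [counitHom_inB]
        rw [e₁]
        exact this
      · intro m
        change TensorProduct.map (counitHom h).toLinearMap .id (comulHom h (inM h m)) =
          (1 : k) ⊗ₜ[k] inM h m
        rw [comulHom_inM, map_add, TensorProduct.map_map, TensorProduct.map_map]
        have := congrArg (TensorProduct.map .id (inM h)) (h.counitL m)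
        rw [LinearMap.rTensor, TensorProduct.map_map, TensorProduct.map_tmul] at this
        have e₁ : (counitHom h).toLinearMap ∘ₗ (inB h).toLinearMap = .id ∘ₗ Coalgebra.counit := by
          ext; simp [counitHom_inB]
        have e₂ : (counitHom h).toLinearMap ∘ₗ (inM h) = 0 := by ext; simp [counitHom_inM]
        rw [e₁, e₂]
        simpa using this)
    (by
      apply algHom_ext
      · intro b
        change TensorProduct.map .id (counitHom h).toLinearMap (comulHom h (inB h b)) =
          inB h b ⊗ₜ[k] (1 : k)
        rw [comulHom_inB, TensorProduct.map_map]
        have := congrArg (TensorProduct.map (inB h).toLinearMap .id)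
          (Coalgebra.lTensor_counit_comul (R := k) b)
        rw [LinearMap.lTensor, TensorProduct.map_map, TensorProduct.map_tmul] at this
        have e₁ : (counitHom h).toLinearMap ∘ₗ (inB h).toLinearMap = .id ∘ₗ Coalgebra.counit := by
          ext; simp [counitHom_inB]
        rw [e₁]
        exact this
      · intro m
        change TensorProduct.map .id (counitHom h).toLinearMap (comulHom h (inM h m)) =
          inM h m ⊗ₜ[k] (1 : k)
        rw [comulHom_inM, map_add, TensorProduct.map_map, TensorProduct.map_map]
        have := congrArg (TensorProduct.map (inM h) .id) (h.counitR m)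
        rw [LinearMap.lTensor, TensorProduct.map_map, TensorProduct.map_tmul] at this
        have e₁ : (counitHom h).toLinearMap ∘ₗ (inB h).toLinearMap = .id ∘ₗ Coalgebra.counit := by
          ext; simp [counitHom_inB]
        have e₂ : (counitHom h).toLinearMap ∘ₗ (inM h) = 0 := by ext; simp [counitHom_inM]
        rw [e₁, e₂]
        simpa using this)

/-- The component of degree `n`, spanned by the products `b m₁ ⋯ mₙ`. -/
def degree (n : ℕ) : Submodule k (TensorHopf h) :=
  LinearMap.range (inB h).toLinearMap * LinearMap.range (inM h) ^ n

end TensorHopf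
end TensorHopf

section Words

variable {k : Type*} [Field k]
variable {B : Type*} [Ring B] [Bialgebra k B] {M : Type*} [AddCommGroup M] [Module k M]

/-- The space `⨁ₙ M^{⊗ n} ⊗ B`, in which the cotensor coalgebra of `M` over `B` will be embedded:
the `n`-th cotensor power is `M □ ⋯ □ M = M □ ⋯ □ M □ B ⊆ M ⊗ ⋯ ⊗ M ⊗ B`. -/
def Words (_h : HopfBimodule k B M) : Type _ := TensorAlgebra k M ⊗[k] B

namespace Words

instance (h : HopfBimodule k B M) : AddCommGroup (Words h) :=
  inferInstanceAs (AddCommGroup (TensorAlgebra k M ⊗[k] B))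
instance (h : HopfBimodule k B M) : Module k (Words h) :=
  inferInstanceAs (Module k (TensorAlgebra k M ⊗[k] B))

variable (h : HopfBimodule k B M)

/-- The inclusion of `B` in degree zero. -/
def inB : B →ₗ[k] Words h := TensorProduct.mk k (TensorAlgebra k M) B 1

/-- `cons m (m₁ ⊗ ⋯ ⊗ mₙ ⊗ b) = m ⊗ m₁ ⊗ ⋯ ⊗ mₙ ⊗ b`. -/
def cons : M →ₗ[k] Words h →ₗ[k] Words h :=
  LinearMap.rTensorHom (R := k) B ∘ₗ LinearMap.mul k (TensorAlgebra k M) ∘ₗ TensorAlgebra.ι k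

/-- The component `M^{⊗ n} ⊗ B`. -/
def degree : ℕ → Submodule k (Words h)
  | 0 => LinearMap.range (inB h)
  | n + 1 => Submodule.map₂ (cons h) ⊤ (degree n)

variable {h}

theorem cons_tmul (m : M) (t : TensorAlgebra k M) (b : B) :
    cons h m (t ⊗ₜ[k] b : TensorAlgebra k M ⊗[k] B) =
      ((TensorAlgebra.ι k m * t) ⊗ₜ[k] b : TensorAlgebra k M ⊗[k] B) := rfl

theorem eq_top_of_cons (N : Submodule k (Words h)) (h₀ : ∀ b, inB h b ∈ N)
    (h₁ : ∀ m w, w ∈ N → cons h m w ∈ N) : N = ⊤ := by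
  have key : ∀ t : TensorAlgebra k M, ∀ w ∈ N,
      (LinearMap.rTensor B (LinearMap.mulLeft k t) : Words h →ₗ[k] Words h) w ∈ N := by
    intro t
    induction t using TensorAlgebra.induction with
    | algebraMap r =>
      intro w hw
      have : LinearMap.mulLeft k (algebraMap k (TensorAlgebra k M) r) = r • LinearMap.id := by
        ext x; simp [Algebra.smul_def]
      rw [this, LinearMap.rTensor_smul, LinearMap.rTensor_id]
      exact N.smul_mem r hw
    | ι m => exact fun w hw ↦ h₁ m w hw
    | mul a b ha hb =>
      intro w hw
      rw [LinearMap.mulLeft_mul, LinearMap.rTensor_comp]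
      exact ha _ (hb _ hw)
    | add a b ha hb =>
      intro w hw
      have : LinearMap.mulLeft k (a + b) = LinearMap.mulLeft k a + LinearMap.mulLeft k b := by
        ext x; simp [add_mul]
      rw [this, LinearMap.rTensor_add]
      exact N.add_mem (ha w hw) (hb w hw)
  rw [eq_top_iff]
  rintro w -
  change TensorAlgebra k M ⊗[k] B at w
  induction w with
  | zero => exact N.zero_mem
  | add x y hx hy => exact N.add_mem hx hy
  | tmul t b =>
    have := key t _ (h₀ b)
    erw [LinearMap.rTensor_tmul, LinearMap.mulLeft_apply, mul_one] at this
    exact this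

theorem hom_ext {Z : Type*} [AddCommGroup Z] [Module k Z] {f g : Words h →ₗ[k] Z}
    (h₀ : ∀ b, f (inB h b) = g (inB h b))
    (h₁ : ∀ m w, f w = g w → f (cons h m w) = g (cons h m w)) : f = g := by
  have := eq_top_of_cons (LinearMap.eqLocus f g) h₀ h₁
  ext w
  have hw : w ∈ LinearMap.eqLocus f g := this ▸ Submodule.mem_top
  exact hw

section rec

variable {Z : Type*} [AddCommGroup Z] [Module k Z]

/-- Auxiliary step of the recursion. -/
def recStep (g : M →ₗ[k] (Words h × Z) →ₗ[k] Z) : M →ₗ[k] Module.End k (Words h × Z) :=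
  LinearMap.mk₂ k (fun m x ↦ (cons h m x.1, g m x))
    (by intros; simp) (by intros; simp) (by intros; simp) (by intros; simp)

/-- Auxiliary map of the recursion. -/
def recFull (f : B →ₗ[k] Z) (g : M →ₗ[k] (Words h × Z) →ₗ[k] Z) : Words h →ₗ[k] Words h × Z :=
  TensorProduct.lift ((LinearMap.lcomp k _ ((inB h).prod f)) ∘ₗ
    (TensorAlgebra.lift k (recStep g)).toLinearMap)

theorem recFull_tmul (f : B →ₗ[k] Z) (g : M →ₗ[k] (Words h × Z) →ₗ[k] Z)
    (t : TensorAlgebra k M) (b : B) :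
    recFull f g (t ⊗ₜ[k] b : TensorAlgebra k M ⊗[k] B) =
      TensorAlgebra.lift k (recStep g) t (inB h b, f b) := rfl

theorem recFull_inB (f : B →ₗ[k] Z) (g : M →ₗ[k] (Words h × Z) →ₗ[k] Z) (b : B) :
    recFull f g (inB h b) = (inB h b, f b) := by
  simp only [recFull]
  erw [TensorProduct.lift.tmul]
  simp

theorem recFull_cons (f : B →ₗ[k] Z) (g : M →ₗ[k] (Words h × Z) →ₗ[k] Z) (m : M) (w : Words h) :
    recFull f g (cons h m w) = (cons h m (recFull f g w).1, g m (recFull f g w)) := by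
  change TensorAlgebra k M ⊗[k] B at w
  induction w with
  | zero =>
    have : recFull f g (0 : TensorAlgebra k M ⊗[k] B) = 0 := map_zero _
    have h₂ : cons h m (0 : TensorAlgebra k M ⊗[k] B) = 0 := map_zero _
    rw [h₂, map_zero, this]; simp; rfl
  | add x y hx hy =>
    have : recFull f g (x + y : TensorAlgebra k M ⊗[k] B) = recFull f g x + recFull f g y :=
      map_add _ _ _
    have h₂ : cons h m (x + y : TensorAlgebra k M ⊗[k] B) = cons h m x + cons h m y :=
      map_add _ _ _
    rw [h₂, map_add, this, hx, hy]
    simp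
  | tmul t b =>
    rw [cons_tmul, recFull_tmul, recFull_tmul]
    simp [recStep]

theorem recFull_fst (f : B →ₗ[k] Z) (g : M →ₗ[k] (Words h × Z) →ₗ[k] Z) (w : Words h) :
    (recFull f g w).1 = w := by
  have : LinearMap.fst k _ _ ∘ₗ recFull f g = LinearMap.id := by
    apply hom_ext
    · intro b; simp [recFull_inB]
    · intro m w hw
      simp only [LinearMap.comp_apply, LinearMap.fst_apply, LinearMap.id_apply] at hw ⊢
      rw [recFull_cons, hw]
  exact LinearMap.congr_fun this w

/-- Linear maps out of `⨁ₙ M^{⊗ n} ⊗ B` defined by recursion on the number of letters. -/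
def recL (f : B →ₗ[k] Z) (g : M →ₗ[k] (Words h × Z) →ₗ[k] Z) : Words h →ₗ[k] Z :=
  LinearMap.snd k _ _ ∘ₗ recFull f g

theorem recL_inB (f : B →ₗ[k] Z) (g : M →ₗ[k] (Words h × Z) →ₗ[k] Z) (b : B) :
    recL f g (inB h b) = f b := by simp [recL, recFull_inB]

theorem recL_cons (f : B →ₗ[k] Z) (g : M →ₗ[k] (Words h × Z) →ₗ[k] Z) (m : M) (w : Words h) :
    recL f g (cons h m w) = g m (w, recL f g w) := by
  simp only [recL, LinearMap.comp_apply, LinearMap.snd_apply, recFull_cons]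
  congr 1
  exact Prod.ext (recFull_fst f g w) rfl

end rec

variable (h)

/-- The projection onto the component `B` of degree zero. -/
def toB : Words h →ₗ[k] B := recL LinearMap.id 0

/-- The map removing the first letter: `m₁ ⊗ ⋯ ⊗ mₙ ⊗ b ↦ m₁ ⊗ (m₂ ⊗ ⋯ ⊗ mₙ ⊗ b)`, zero on `B`. -/
def uncons : Words h →ₗ[k] M ⊗[k] Words h :=
  recL 0 (LinearMap.mk₂ k (fun m x ↦ m ⊗ₜ[k] x.1)
    (by intros; simp [TensorProduct.add_tmul]) (by intros; simp [TensorProduct.smul_tmul'])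
    (by intros; simp [TensorProduct.tmul_add]) (by intros; simp))

/-- Deconcatenation: the word `m₁ ⊗ ⋯ ⊗ mₙ ⊗ b` is cut at each of the places `0, …, n`, and `B` acts
by the left coaction of the letter to the right of the cut (by `Δ_B` on `b` at the last place):
`Δ (m ⊗ w) = m₍₋₁₎ ⊗ (m₍₀₎ ⊗ w) + (m ⊗ w₍₁₎) ⊗ w₍₂₎`. -/
def comul : Words h →ₗ[k] Words h ⊗[k] Words h :=
  recL (TensorProduct.map (inB h) (inB h) ∘ₗ Coalgebra.comul)
    (LinearMap.mk₂ k (fun m x ↦ TensorProduct.map (inB h) ((cons h).flip x.1) (h.coactL m) +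
        (cons h m).rTensor _ x.2)
      (by intros; simp [LinearMap.rTensor_add]; abel) (by intros; simp [LinearMap.rTensor_smul])
      (by intros; simp [TensorProduct.map_add_right]; abel)
      (by intros; simp [TensorProduct.map_smul_right]))

/-- The inclusion of `M` in degree one, as `M = M □ B ⊆ M ⊗ B` through the right coaction. -/
def inM : M →ₗ[k] Words h :=
  TensorProduct.lift (cons h) ∘ₗ (inB h).lTensor M ∘ₗ h.coactR

/-- The word `m₁ ⊗ ⋯ ⊗ mₙ ⊗ b` is cut at each of the places `1, …, n`, and `B` acts by the right
coaction of the letter to the left of the cut: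
`Δʳ (m ⊗ w) = (m₍₀₎ ⊗ m₍₁₎) ⊗ w + (m ⊗ ·) Δʳ w`. -/
def comulR : Words h →ₗ[k] Words h ⊗[k] Words h :=
  recL 0
    (LinearMap.mk₂ k (fun m x ↦ inM h m ⊗ₜ[k] x.1 + (cons h m).rTensor _ x.2)
      (by intros; simp [LinearMap.rTensor_add, TensorProduct.add_tmul]; abel)
      (by intros; simp [LinearMap.rTensor_smul, TensorProduct.smul_tmul'])
      (by intros; simp [TensorProduct.tmul_add]; abel)
      (by intros; simp))

/-- The part of `comul` which cuts at the places `1, …, n`. -/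
def comulL : Words h →ₗ[k] Words h ⊗[k] Words h :=
  (LinearMap.id - inB h ∘ₗ toB h).rTensor _ ∘ₗ comul h

@[simp] theorem toB_inB (b : B) : toB h (inB h b) = b := recL_inB _ _ _
@[simp] theorem toB_cons (m : M) (w : Words h) : toB h (cons h m w) = 0 := recL_cons _ _ _ _
@[simp] theorem uncons_inB (b : B) : uncons h (inB h b) = 0 := recL_inB _ _ _
@[simp] theorem uncons_cons (m : M) (w : Words h) : uncons h (cons h m w) = m ⊗ₜ[k] w :=
  recL_cons _ _ _ _
theorem comul_inB (b : B) :
    comul h (inB h b) = TensorProduct.map (inB h) (inB h) (Coalgebra.comul b) := recL_inB _ _ _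
theorem comul_cons (m : M) (w : Words h) : comul h (cons h m w) =
    TensorProduct.map (inB h) ((cons h).flip w) (h.coactL m) + (cons h m).rTensor _ (comul h w) :=
  recL_cons _ _ _ _
theorem comulR_inB (b : B) : comulR h (inB h b) = 0 := recL_inB _ _ _
theorem comulR_cons (m : M) (w : Words h) : comulR h (cons h m w) =
    inM h m ⊗ₜ[k] w + (cons h m).rTensor _ (comulR h w) :=
  recL_cons _ _ _ _

theorem toB_comp_inB : toB h ∘ₗ inB h = LinearMap.id := by ext; simp

theorem comulL_inB (b : B) : comulL h (inB h b) = 0 := by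
  simp only [comulL, LinearMap.comp_apply, comul_inB, LinearMap.rTensor_map]
  have : (LinearMap.id - inB h ∘ₗ toB h) ∘ₗ inB h = 0 := by ext; simp
  rw [this]; simp

theorem comulL_cons (m : M) (w : Words h) :
    comulL h (cons h m w) = (cons h m).rTensor _ (comul h w) := by
  simp only [comulL, LinearMap.comp_apply, comul_cons, map_add, LinearMap.rTensor_map]
  have : (LinearMap.id - inB h ∘ₗ toB h) ∘ₗ inB h = 0 := by ext; simp
  have h₂ : (LinearMap.id - inB h ∘ₗ toB h) ∘ₗ cons h m = cons h m := by ext; simp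
  rw [this, ← LinearMap.rTensor_comp_apply, h₂]; simp

instance : Coalgebra k (Words h) where
  comul := comul h
  counit := Coalgebra.counit ∘ₗ toB h
  coassoc := by
    have e₁ (w : Words h) (z : B ⊗[k] M) : TensorProduct.assoc k _ _ _ ((comul h).rTensor _
        (TensorProduct.map (inB h) ((cons h).flip w) z)) =
        TensorProduct.map (inB h) (TensorProduct.map (inB h) ((cons h).flip w))
          (TensorProduct.assoc k _ _ _ (Coalgebra.comul.rTensor M z)) := by
      induction z with
      | zero => simp
      | add x y hx hy => simp only [map_add, hx, hy]
      | tmul b m =>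
        simp only [TensorProduct.map_tmul, LinearMap.rTensor_tmul, comul_inB]
        induction (Coalgebra.comul (R := k) b) with
        | zero => simp
        | add x y hx hy => simp only [map_add, TensorProduct.add_tmul, hx, hy]
        | tmul b b' => simp
    have e₂ (m : M) (y : Words h ⊗[k] Words h) : TensorProduct.assoc k _ _ _ ((comul h).rTensor _
        ((cons h m).rTensor _ y)) =
        TensorProduct.map (inB h) ((LinearMap.rTensorHom _ ∘ₗ cons h).flip y) (h.coactL m) +
        (cons h m).rTensor _ (TensorProduct.assoc k _ _ _ ((comul h).rTensor _ y)) := by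
      induction y with
      | zero => simp
      | add x y hx hy => 
        simp only [map_add, hx, hy, TensorProduct.map_add_right, LinearMap.add_apply]; abel
      | tmul a c =>
        simp only [LinearMap.rTensor_tmul, comul_cons, TensorProduct.add_tmul, map_add]
        congr 1
        · induction (h.coactL m) with
          | zero => simp
          | add x y hx hy => simp only [map_add, TensorProduct.add_tmul, hx, hy]
          | tmul b b' => simp
        · induction (comul h a) with
          | zero => simp
          | add x y hx hy => simp only [map_add, TensorProduct.add_tmul, hx, hy]
          | tmul b b' => simp
    have e₃ (w : Words h) (z : B ⊗[k] M) : (comul h).lTensor _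
        (TensorProduct.map (inB h) ((cons h).flip w) z) =
        TensorProduct.map (inB h) (TensorProduct.map (inB h) ((cons h).flip w))
          (h.coactL.lTensor B z) +
        TensorProduct.map (inB h) ((LinearMap.rTensorHom _ ∘ₗ cons h).flip (comul h w)) z := by
      induction z with
      | zero => simp
      | add x y hx hy => simp only [map_add, hx, hy]; abel
      | tmul b m => simp [comul_cons, TensorProduct.tmul_add]
    have e₄ (m : M) (y : Words h ⊗[k] Words h) : (comul h).lTensor _ ((cons h m).rTensor _ y) =
        (cons h m).rTensor _ ((comul h).lTensor _ y) := by
      induction y with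
      | zero => simp
      | add x y hx hy => simp only [map_add, hx, hy]
      | tmul b m => simp
    apply hom_ext
    · intro b
      have := congrArg (TensorProduct.map (inB h) (TensorProduct.map (inB h) (inB h)))
        (Coalgebra.coassoc_apply (R := k) b)
      simp only [LinearMap.comp_apply, comul_inB]
      convert this using 1
      · induction (Coalgebra.comul (R := k) b) with
        | zero => simp
        | add x y hx hy => simp only [map_add, hx, hy]
        | tmul b b' =>
          simp only [TensorProduct.map_tmul, LinearMap.rTensor_tmul, comul_inB]
          induction (Coalgebra.comul (R := k) b) with
          | zero => simp
          | add x y hx hy => simp only [map_add, TensorProduct.add_tmul, hx, hy]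
          | tmul b b' => simp
      · induction (Coalgebra.comul (R := k) b) with
        | zero => simp
        | add x y hx hy => simp only [map_add, hx, hy]
        | tmul b b' => simp [comul_inB]
    · intro m w hw
      simp only [LinearMap.comp_apply, LinearEquiv.coe_coe] at hw ⊢
      rw [comul_cons, map_add, map_add, map_add, e₁, e₂, e₃, e₄, hw, h.coassocL, add_assoc]
  rTensor_counit_comp_comul := by
    apply hom_ext
    · intro b
      have := congrArg (TensorProduct.map .id (inB h)) (Coalgebra.rTensor_counit_comul (R := k) b)
      rw [LinearMap.rTensor, TensorProduct.map_map, TensorProduct.map_tmul] at this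
      simp only [LinearMap.comp_apply, comul_inB, LinearMap.rTensor_map, LinearMap.comp_assoc,
        toB_comp_inB]
      exact this
    · intro m w hw
      have := congrArg (TensorProduct.map .id ((cons h).flip w)) (h.counitL m)
      rw [LinearMap.rTensor, TensorProduct.map_map, TensorProduct.map_tmul] at this
      have h₂ : (Coalgebra.counit (R := k) ∘ₗ toB h) ∘ₗ cons h m = 0 := by ext; simp
      simp only [LinearMap.comp_apply, comul_cons, map_add, LinearMap.rTensor_map,
        LinearMap.comp_assoc, toB_comp_inB]
      rw [← LinearMap.rTensor_comp_apply, h₂, LinearMap.rTensor_zero, LinearMap.zero_apply, add_zero]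
      exact this
  lTensor_counit_comp_comul := by
    apply hom_ext
    · intro b
      have := congrArg (TensorProduct.map (inB h) .id) (Coalgebra.lTensor_counit_comul (R := k) b)
      rw [LinearMap.lTensor, TensorProduct.map_map, TensorProduct.map_tmul] at this
      simp only [LinearMap.comp_apply, comul_inB, LinearMap.lTensor_map, LinearMap.comp_assoc,
        toB_comp_inB]
      exact this
    · intro m w hw
      have h₂ : (Coalgebra.counit (R := k) ∘ₗ toB h) ∘ₗ (cons h).flip w = 0 := by ext; simp
      simp only [LinearMap.comp_apply, comul_cons, map_add, LinearMap.lTensor_map, h₂] at hw ⊢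
      have h₃ (y : Words h ⊗[k] Words h) : (Coalgebra.counit (R := k) ∘ₗ toB h).lTensor _
          ((cons h m).rTensor _ y) =
          (cons h m).rTensor _ ((Coalgebra.counit (R := k) ∘ₗ toB h).lTensor _ y) := by
        rw [← LinearMap.comp_apply, LinearMap.lTensor_comp_rTensor,
          ← LinearMap.rTensor_comp_lTensor, LinearMap.comp_apply]
      rw [h₃, hw]
      simp

end Words
end Words

section WordsAlgebra

variable {k : Type*} [Field k]
variable {B : Type*} [Ring B] [Bialgebra k B] {M : Type*} [AddCommGroup M] [Module k M]

namespace Words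

variable (h : HopfBimodule k B M)

theorem map_sub_right {U V W X : Type*} [AddCommGroup U] [AddCommGroup V] [AddCommGroup W]
    [AddCommGroup X] [Module k U] [Module k V] [Module k W] [Module k X]
    (f : U →ₗ[k] V) (g g' : W →ₗ[k] X) :
    TensorProduct.map f (g - g') = TensorProduct.map f g - TensorProduct.map f g' := by
  ext; simp [TensorProduct.tmul_sub]

theorem comul_eq : (Coalgebra.comul : Words h →ₗ[k] _) = comul h := rfl
theorem counit_eq : (Coalgebra.counit : Words h →ₗ[k] _) = Coalgebra.counit ∘ₗ toB h := rfl

/-- The projection onto `M^{⊗ n} ⊗ B`. -/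
def proj : ℕ → (Words h →ₗ[k] Words h)
  | 0 => inB h ∘ₗ toB h
  | n + 1 => TensorProduct.lift (cons h) ∘ₗ (proj n).lTensor M ∘ₗ uncons h

/-- `cons` on the left factor of a tensor product. -/
def consT (Y : Type*) [AddCommGroup Y] [Module k Y] :
    M ⊗[k] (Words h ⊗[k] Y) →ₗ[k] Words h ⊗[k] Y :=
  TensorProduct.lift (LinearMap.rTensorHom Y ∘ₗ cons h)

theorem consT_tmul {Y : Type*} [AddCommGroup Y] [Module k Y] (m : M) (z : Words h ⊗[k] Y) :
    consT h Y (m ⊗ₜ z) = (cons h m).rTensor Y z := rfl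

theorem sum_proj (w : Words h) :
    ∀ᶠ N in Filter.atTop, ∑ n ∈ Finset.range N, proj h n w = w := by
  have : (⊤ : Submodule k (Words h)) ≤
      { carrier := {w | ∀ᶠ N in Filter.atTop, ∑ n ∈ Finset.range N, proj h n w = w}
        add_mem' := fun {a b} ha hb ↦ by
          filter_upwards [ha, hb] with N h₁ h₂
          simp [Finset.sum_add_distrib, h₁, h₂]
        zero_mem' := by simp
        smul_mem' := fun c a ha ↦ by
          filter_upwards [ha] with N h₁
          simp [← Finset.smul_sum, h₁] } := by
    refine (eq_top_of_cons _ ?_ ?_).ge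
    · intro b
      filter_upwards [Filter.eventually_ge_atTop 1] with N hN
      obtain ⟨N, rfl⟩ := Nat.exists_eq_add_of_le' hN
      rw [Finset.sum_range_succ']
      simp [proj]
    · intro m w hw
      refine (Filter.tendsto_sub_atTop_nat 1).eventually hw |>.and
        (Filter.eventually_ge_atTop 1) |>.mono ?_
      rintro N ⟨h₁, hN⟩
      obtain ⟨N, rfl⟩ := Nat.exists_eq_add_of_le' hN
      rw [Finset.sum_range_succ']
      simp only [Nat.add_sub_cancel] at h₁
      simp [proj, ← map_sum, h₁]
  exact this (Submodule.mem_top (x := w))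

section universal

variable {D : Type*} [AddCommGroup D] [Module k D] [Coalgebra k D]

theorem eq_zero_of_recursion {Y : Type*} [AddCommGroup Y] [Module k Y]
    (f : D →ₗ[k] M) (H : D →ₗ[k] Words h ⊗[k] Y)
    (hH : ∀ d, H d = consT h Y (TensorProduct.map f H (Coalgebra.comul d))) : H = 0 := by
  have h₀ : ∀ n, (proj h n).rTensor Y ∘ₗ H = 0 := by
    intro n
    induction n with
    | zero =>
      ext d
      rw [LinearMap.comp_apply, hH]
      induction (Coalgebra.comul (R := k) d) with
      | zero => simp
      | add x y hx hy => simp only [map_add, hx, hy]; simp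
      | tmul a b =>
        have : (proj h 0) ∘ₗ cons h (f a) = 0 := by ext; simp [proj]
        simp [consT_tmul, ← LinearMap.rTensor_comp_apply, this]
    | succ n ih =>
      ext d
      rw [LinearMap.comp_apply, hH]
      induction (Coalgebra.comul (R := k) d) with
      | zero => simp
      | add x y hx hy => simp only [map_add, hx, hy]; simp
      | tmul a b =>
        have : (proj h (n + 1)) ∘ₗ cons h (f a) = cons h (f a) ∘ₗ proj h n := by ext; simp [proj]
        simp only [TensorProduct.map_tmul, consT_tmul, ← LinearMap.rTensor_comp_apply, this]
        rw [LinearMap.rTensor_comp_apply, ← LinearMap.comp_apply _ H, ih]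
        simp
  have h₁ : ∀ z : Words h ⊗[k] Y, ∀ᶠ N in Filter.atTop,
      ∑ n ∈ Finset.range N, (proj h n).rTensor Y z = z := by
    intro z
    induction z with
    | zero => simp
    | add x y hx hy =>
      filter_upwards [hx, hy] with N h₁ h₂
      simp only [map_add, Finset.sum_add_distrib, h₁, h₂]
    | tmul w y =>
      filter_upwards [sum_proj h w] with N h₁
      simp [← TensorProduct.sum_tmul, h₁]
  ext d
  obtain ⟨N, hN⟩ := (h₁ (H d)).exists
  rw [← hN]
  exact Finset.sum_eq_zero fun n _ ↦ LinearMap.congr_fun (h₀ n) d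

theorem eq_zero_of_recursion' (f : D →ₗ[k] M) (H : D →ₗ[k] Words h)
    (hH : ∀ d, H d = TensorProduct.lift (cons h) (TensorProduct.map f H (Coalgebra.comul d))) :
    H = 0 := by
  have := eq_zero_of_recursion h f ((TensorProduct.rid k _).symm.toLinearMap ∘ₗ H) (by
    intro d
    rw [LinearMap.comp_apply, hH]
    induction (Coalgebra.comul (R := k) d) with
    | zero => simp
    | add x y hx hy => simp only [map_add, hx, hy]
    | tmul a b => simp [consT_tmul])
  ext d
  simpa using congrArg (TensorProduct.rid k _) (LinearMap.congr_fun this d)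

/-- Removing everything but the first letter of the words of length one:
`m ⊗ b ↦ ε(b) m`. -/
def toM : Words h →ₗ[k] M :=
  TensorProduct.rid k M ∘ₗ (Coalgebra.counit ∘ₗ toB h).lTensor M ∘ₗ uncons h

@[simp] theorem toM_inB (b : B) : toM h (inB h b) = 0 := by simp [toM]
@[simp] theorem toM_cons (m : M) (w : Words h) :
    toM h (cons h m w) = Coalgebra.counit (R := k) (toB h w) • m := by simp [toM]

theorem map_toB_toB (w : Words h) :
    TensorProduct.map (toB h) (toB h) (Coalgebra.comul w) = Coalgebra.comul (toB h w) := by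
  rw [comul_eq]
  revert w
  apply LinearMap.congr_fun (f := TensorProduct.map (toB h) (toB h) ∘ₗ comul h)
    (g := Coalgebra.comul ∘ₗ toB h)
  apply hom_ext
  · intro b
    simp [comul_inB, TensorProduct.map_map, toB_comp_inB]
  · intro m w _
    have h₁ : toB h ∘ₗ (cons h).flip w = 0 := by ext; simp
    have h₂ : toB h ∘ₗ cons h m = 0 := by ext; simp
    simp [comul_cons, TensorProduct.map_map, LinearMap.rTensor, h₁, h₂]

theorem map_toB_toM (w : Words h) :
    TensorProduct.map (toB h) (toM h) (Coalgebra.comul w) = h.coactL (toM h w) := by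
  rw [comul_eq]
  revert w
  apply LinearMap.congr_fun (f := TensorProduct.map (toB h) (toM h) ∘ₗ comul h)
    (g := h.coactL ∘ₗ toM h)
  apply hom_ext
  · intro b
    have h₁ : toM h ∘ₗ inB h = 0 := by ext; simp
    simp [comul_inB, TensorProduct.map_map, h₁]
  · intro m w _
    have h₁ : toM h ∘ₗ (cons h).flip w = Coalgebra.counit (R := k) (toB h w) • .id := by ext; simp
    have h₂ : toB h ∘ₗ cons h m = 0 := by ext; simp
    simp [comul_cons, TensorProduct.map_map, LinearMap.rTensor, h₁, h₂, toB_comp_inB,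
      TensorProduct.map_smul_right]

theorem map_toM_id (w : Words h) :
    TensorProduct.map (toM h) .id (Coalgebra.comul w) = uncons h w := by
  rw [comul_eq]
  revert w
  apply LinearMap.congr_fun (f := TensorProduct.map (toM h) .id ∘ₗ comul h) (g := uncons h)
  apply hom_ext
  · intro b
    have h₁ : toM h ∘ₗ inB h = 0 := by ext; simp
    simp [comul_inB, TensorProduct.map_map, h₁]
  · intro m w _
    have h₁ : toM h ∘ₗ inB h = 0 := by ext; simp
    have h₂ : toM h ∘ₗ cons h m =
        LinearMap.toSpanSingleton k M m ∘ₗ Coalgebra.counit (R := k) ∘ₗ toB h := by ext; simp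
    have h₃ := congrArg ((LinearMap.toSpanSingleton k M m).rTensor _)
      (Coalgebra.rTensor_counit_comul (R := k) w)
    rw [counit_eq, comul_eq, ← LinearMap.rTensor_comp_apply, LinearMap.rTensor_tmul] at h₃
    simp only [LinearMap.comp_apply, comul_cons, map_add, TensorProduct.map_map, h₁,
      LinearMap.rTensor, h₂, LinearMap.id_comp, uncons_cons]
    simpa [LinearMap.rTensor] using h₃

theorem reconstruct (w : Words h) :
    w = inB h (toB h w) + TensorProduct.lift (cons h) (uncons h w) := by
  revert w
  apply LinearMap.congr_fun (f := LinearMap.id)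
    (g := inB h ∘ₗ toB h + TensorProduct.lift (cons h) ∘ₗ uncons h)
  apply hom_ext
  · intro b; simp
  · intro m w _; simp

variable {h} in
theorem coalgHom_eq (F : D →ₗc[k] Words h) (d : D) :
    F d = inB h (toB h (F d)) + TensorProduct.lift (cons h)
      (TensorProduct.map (toM h ∘ₗ F.toLinearMap) F.toLinearMap (Coalgebra.comul d)) := by
  conv_lhs => rw [reconstruct h (F d), ← map_toM_id, ← CoalgHomClass.map_comp_comul_apply]
  congr 2
  exact TensorProduct.map_map _ _ _ _ _

variable {h} in
theorem coalgHom_ext {F F' : D →ₗc[k] Words h} (h₀ : ∀ d, toB h (F d) = toB h (F' d))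
    (h₁ : ∀ d, toM h (F d) = toM h (F' d)) : F = F' := by
  have e : toM h ∘ₗ F.toLinearMap = toM h ∘ₗ F'.toLinearMap := LinearMap.ext h₁
  have := eq_zero_of_recursion' h (toM h ∘ₗ F.toLinearMap) (F.toLinearMap - F'.toLinearMap) (by
    intro d
    have e₁ := coalgHom_eq F d
    have e₂ := coalgHom_eq F' d
    rw [← e, ← h₀] at e₂
    simp only [map_sub_right, LinearMap.sub_apply, map_sub]
    change F d - F' d = _
    rw [e₁, e₂]
    abel)
  ext d
  exact sub_eq_zero.mp (LinearMap.congr_fun this d)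

theorem coassoc_map {U V W : Type*} [AddCommGroup U] [AddCommGroup V] [AddCommGroup W]
    [Module k U] [Module k V] [Module k W] (f : D →ₗ[k] U) (g : D →ₗ[k] V) (l : D →ₗ[k] W)
    (d : D) :
    TensorProduct.assoc k U V W
      (TensorProduct.map (TensorProduct.map f g ∘ₗ Coalgebra.comul) l (Coalgebra.comul d)) =
    TensorProduct.map f (TensorProduct.map g l ∘ₗ Coalgebra.comul) (Coalgebra.comul d) := by
  have := congrArg (TensorProduct.map f (TensorProduct.map g l)) (Coalgebra.coassoc_apply (R := k) d)
  rw [LinearMap.lTensor, TensorProduct.map_map, LinearMap.comp_id] at this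
  rw [← this]
  induction (Coalgebra.comul (R := k) d) with
  | zero => simp
  | add x y hx hy => simp only [map_add, hx, hy]
  | tmul a b =>
    simp only [TensorProduct.map_tmul, LinearMap.rTensor_tmul, LinearMap.comp_apply]
    induction (Coalgebra.comul (R := k) a) with
    | zero => simp
    | add x y hx hy => simp only [map_add, TensorProduct.add_tmul, hx, hy]
    | tmul b b' => simp

/-- `F` is the map to words with letters given by `f₁` and last entry given by `f₀`. -/
def IsExtension (f₀ : D →ₗ[k] B) (f₁ : D →ₗ[k] M) (F : D →ₗ[k] Words h) : Prop :=
  ∀ d, F d = inB h (f₀ d) +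
    TensorProduct.lift (cons h) (TensorProduct.map f₁ F (Coalgebra.comul d))

variable {h} in
theorem comul_lift_cons (z : M ⊗[k] Words h) : comul h (TensorProduct.lift (cons h) z) =
    TensorProduct.map (inB h) (TensorProduct.lift (cons h))
      (TensorProduct.assoc k _ _ _ (h.coactL.rTensor _ z)) +
    consT h _ ((comul h).lTensor M z) := by
  induction z with
  | zero => simp
  | add x y hx hy => simp only [map_add, hx, hy]; abel
  | tmul m w =>
    simp only [TensorProduct.lift.tmul, comul_cons, LinearMap.lTensor_tmul, consT_tmul,
      LinearMap.rTensor_tmul]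
    congr 1
    induction (h.coactL m) with
    | zero => simp
    | add x y hx hy => simp only [map_add, TensorProduct.add_tmul, hx, hy]
    | tmul b b' => simp

variable {h} in
theorem IsExtension.map_comp_comul {f₀ : D →ₗ[k] B} {f₁ : D →ₗ[k] M} {F : D →ₗ[k] Words h}
    (hF : IsExtension h f₀ f₁ F)
    (h₀ : ∀ d, TensorProduct.map f₀ f₀ (Coalgebra.comul d) = Coalgebra.comul (f₀ d))
    (h₁ : ∀ d, TensorProduct.map f₀ f₁ (Coalgebra.comul d) = h.coactL (f₁ d)) :
    TensorProduct.map F F ∘ₗ Coalgebra.comul = Coalgebra.comul ∘ₗ F := by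
  have eF : F = inB h ∘ₗ f₀ + TensorProduct.lift (cons h) ∘ₗ TensorProduct.map f₁ F ∘ₗ
      Coalgebra.comul := LinearMap.ext hF
  have h₁' : h.coactL ∘ₗ f₁ = TensorProduct.map f₀ f₁ ∘ₗ Coalgebra.comul :=
    LinearMap.ext fun d ↦ (h₁ d).symm
  have key := eq_zero_of_recursion h f₁
    (TensorProduct.map F F ∘ₗ Coalgebra.comul - comul h ∘ₗ F) (by
    intro d
    have a₁ : comul h (F d) = TensorProduct.map (inB h ∘ₗ f₀) F (Coalgebra.comul d) +
        consT h _ (TensorProduct.map f₁ (comul h ∘ₗ F) (Coalgebra.comul d)) := by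
      conv_lhs => rw [hF d]
      rw [map_add, comul_inB, ← h₀, TensorProduct.map_map, comul_lift_cons, LinearMap.rTensor,
        TensorProduct.map_map, LinearMap.lTensor, TensorProduct.map_map, h₁', LinearMap.id_comp,
        coassoc_map, TensorProduct.map_map, ← add_assoc, LinearMap.id_comp]
      congr 1
      conv_rhs => rw [eF]
      rw [TensorProduct.map_add_right, LinearMap.add_apply]
    have a₂ : TensorProduct.map F F (Coalgebra.comul d) =
        TensorProduct.map (inB h ∘ₗ f₀) F (Coalgebra.comul d) +
        consT h _ (TensorProduct.map f₁ (TensorProduct.map F F ∘ₗ Coalgebra.comul)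
          (Coalgebra.comul d)) := by
      have e := congrArg (fun f ↦ TensorProduct.map f F (Coalgebra.comul d)) eF
      simp only [TensorProduct.map_add_left, LinearMap.add_apply] at e
      rw [e, ← coassoc_map]
      congr 1
      generalize (Coalgebra.comul (R := k) d) = z
      induction z with
      | zero => simp
      | add x y hx hy => simp only [map_add, hx, hy]
      | tmul a b =>
        simp only [TensorProduct.map_tmul, LinearMap.comp_apply]
        induction (TensorProduct.map f₁ F (Coalgebra.comul (R := k) a)) with
        | zero => simp
        | add x y hx hy => simp only [map_add, TensorProduct.add_tmul, hx, hy]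
        | tmul b b' => simp [consT_tmul]
    rw [LinearMap.sub_apply, LinearMap.comp_apply, LinearMap.comp_apply, a₁, a₂,
      map_sub_right, LinearMap.sub_apply, map_sub]
    abel)
  exact sub_eq_zero.mp key

theorem IsExtension.counit_comp {f₀ : D →ₗ[k] B} {f₁ : D →ₗ[k] M} {F : D →ₗ[k] Words h}
    (hF : IsExtension h f₀ f₁ F) (h₀ : ∀ d, Coalgebra.counit (R := k) (f₀ d) = Coalgebra.counit d) :
    Coalgebra.counit ∘ₗ F = (Coalgebra.counit : D →ₗ[k] k) := by
  ext d
  have : toB h ∘ₗ TensorProduct.lift (cons h) = 0 := by ext; simp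
  have := LinearMap.congr_fun this (TensorProduct.map f₁ F (Coalgebra.comul d))
  rw [LinearMap.comp_apply, hF, counit_eq]
  simp only [LinearMap.comp_apply, LinearMap.zero_apply] at this
  simp [this, h₀]

end universal

end Words
end WordsAlgebra

section WordsAlgebra

variable {k : Type*} [Field k]
variable {B : Type*} [Ring B] [Bialgebra k B] {M : Type*} [AddCommGroup M] [Module k M]

namespace Words

variable (h : HopfBimodule k B M)

/-- The degree zero component of the multiplication. -/
def mulB : Words h ⊗[k] Words h →ₗ[k] B :=
  LinearMap.mul' k B ∘ₗ TensorProduct.map (toB h) (toB h)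

/-- The degree one component of the multiplication: the two actions of `B` on `M`. -/
def mulM : Words h ⊗[k] Words h →ₗ[k] M :=
  TensorProduct.lift h.actL ∘ₗ TensorProduct.map (toB h) (toM h) +
    TensorProduct.lift h.actR ∘ₗ TensorProduct.map (toM h) (toB h)

@[simp] theorem mulB_tmul (x y : Words h) : mulB h (x ⊗ₜ y) = toB h x * toB h y := by simp [mulB]
@[simp] theorem mulM_tmul (x y : Words h) : mulM h (x ⊗ₜ y) =
    h.actL (toB h x) (toM h y) + h.actR (toM h x) (toB h y) := by simp [mulM]

/-- The component of degree `n` of the multiplication. -/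
def mulN : ℕ → (Words h ⊗[k] Words h →ₗ[k] Words h)
  | 0 => inB h ∘ₗ mulB h
  | n + 1 => TensorProduct.lift (cons h) ∘ₗ TensorProduct.map (mulM h) (mulN n) ∘ₗ Coalgebra.comul

/-- Tensors of total degree `n`. -/
def degree₂ (n : ℕ) : Submodule k (Words h ⊗[k] Words h) :=
  Submodule.span k {z | ∃ i j, i + j = n ∧ ∃ a ∈ degree h i, ∃ c ∈ degree h j, z = a ⊗ₜ[k] c}

variable {h}

theorem toB_degree {n : ℕ} (hn : n ≠ 0) {x : Words h} (hx : x ∈ degree h n) : toB h x = 0 := by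
  obtain ⟨n, rfl⟩ := Nat.exists_eq_succ_of_ne_zero hn
  have : degree h (n + 1) ≤ LinearMap.ker (toB h) :=
    Submodule.map₂_le.mpr fun m _ w _ ↦ by simp
  exact this hx

theorem toM_degree {n : ℕ} (hn : n ≠ 1) {x : Words h} (hx : x ∈ degree h n) : toM h x = 0 := by
  match n, hn, hx with
  | 0, _, ⟨b, hb⟩ => rw [← hb]; simp
  | n + 2, _, hx =>
    have : degree h (n + 2) ≤ LinearMap.ker (toM h) :=
      Submodule.map₂_le.mpr fun m _ w hw ↦ by
        simp [toB_degree (Nat.succ_ne_zero n) hw]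
    exact this hx

theorem comul_degree {n : ℕ} {x : Words h} (hx : x ∈ degree h n) :
    comul h x ∈ degree₂ h n := by
  induction n generalizing x with
  | zero =>
    obtain ⟨b, rfl⟩ := hx
    rw [comul_inB]
    induction (Coalgebra.comul (R := k) b) with
    | zero => simp
    | add x y hx hy => rw [map_add]; exact add_mem hx hy
    | tmul a c => exact Submodule.subset_span ⟨0, 0, rfl, _, ⟨a, rfl⟩, _, ⟨c, rfl⟩, by simp⟩
  | succ n ih =>
    have : degree h (n + 1) ≤ (degree₂ h (n + 1)).comap (comul h) := by
      refine Submodule.map₂_le.mpr fun m _ w hw ↦ ?_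
      rw [Submodule.mem_comap, comul_cons]
      refine add_mem ?_ ?_
      · induction (h.coactL m) with
        | zero => simp
        | add x y hx hy => rw [map_add]; exact add_mem hx hy
        | tmul a c =>
          exact Submodule.subset_span ⟨0, n + 1, by simp, _, ⟨a, rfl⟩, cons h c w,
            Submodule.apply_mem_map₂ _ trivial hw, by simp⟩
      · have : degree₂ h n ≤ (degree₂ h (n + 1)).comap ((cons h m).rTensor _) := by
          refine Submodule.span_le.mpr ?_
          rintro _ ⟨i, j, rfl, a, ha, c, hc, rfl⟩
          exact Submodule.subset_span ⟨i + 1, j, by ring, cons h m a,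
            Submodule.apply_mem_map₂ _ trivial ha, c, hc, by simp⟩
        exact this (ih hw)
    exact this hx

theorem iSup_degree : ⨆ n, degree h n = ⊤ := by
  apply eq_top_of_cons
  · intro b
    exact Submodule.mem_iSup_of_mem 0 ⟨b, rfl⟩
  · intro m w hw
    have : ⨆ n, degree h n ≤ (⨆ n, degree h n).comap (cons h m) := by
      refine iSup_le fun n w hw ↦ ?_
      exact Submodule.mem_iSup_of_mem (n + 1) (Submodule.apply_mem_map₂ _ trivial hw)
    exact this hw

theorem mulN_eq_zero {n p q : ℕ} (hn : n ≠ p + q) {x y : Words h} (hx : x ∈ degree h p)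
    (hy : y ∈ degree h q) : mulN h n (x ⊗ₜ y) = 0 := by
  induction n generalizing p q x y with
  | zero =>
    simp only [mulN, LinearMap.comp_apply, mulB_tmul]
    rcases Nat.eq_zero_or_pos p with rfl | hp
    · rw [toB_degree (x := y) (by omega) hy]; simp
    · rw [toB_degree (x := x) (by omega) hx]; simp
  | succ n ih =>
    simp only [mulN, LinearMap.comp_apply, TensorProduct.comul_tmul, comul_eq]
    have key : ∀ u ∈ degree₂ h p, ∀ v ∈ degree₂ h q, TensorProduct.lift (cons h)
        (TensorProduct.map (mulM h) (mulN h n)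
          (TensorProduct.AlgebraTensorModule.tensorTensorTensorComm k k k k _ _ _ _ (u ⊗ₜ v))) = 0 := by
      intro u hu v hv
      induction hu using Submodule.span_induction with
      | zero => simp
      | add x y _ _ hx hy => simp only [TensorProduct.add_tmul, map_add, hx, hy, add_zero]
      | smul c x _ hx => simp only [← TensorProduct.smul_tmul', map_smul, hx, smul_zero]
      | mem u hu =>
        induction hv using Submodule.span_induction with
        | zero => simp
        | add x y _ _ hx hy => simp only [TensorProduct.tmul_add, map_add, hx, hy, add_zero]
        | smul c x _ hx => simp only [TensorProduct.tmul_smul, map_smul, hx, smul_zero]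
        | mem v hv =>
          obtain ⟨i, j, rfl, a, ha, c, hc, rfl⟩ := hu
          obtain ⟨i', j', rfl, a', ha', c', hc', rfl⟩ := hv
          simp only [TensorProduct.AlgebraTensorModule.tensorTensorTensorComm_tmul,
            TensorProduct.map_tmul, TensorProduct.lift.tmul, mulM_tmul]
          by_cases hij : n = j + j'
          · have h₁ : h.actL (toB h a) (toM h a') = 0 := by
              by_cases hi : i = 0
              · rw [toM_degree (by omega) ha']; simp
              · rw [toB_degree hi ha]; simp
            have h₂ : h.actR (toM h a) (toB h a') = 0 := by
              by_cases hi : i' = 0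
              · rw [toM_degree (by omega) ha]; simp
              · rw [toB_degree hi ha']; simp
            simp [h₁, h₂]
          · rw [ih hij hc hc']; simp
    exact key _ (comul_degree hx) _ (comul_degree hy)

theorem mulN_eventually (d : Words h ⊗[k] Words h) :
    ∀ᶠ n in Filter.atTop, mulN h n d = 0 := by
  induction d with
  | zero => simp
  | add x y hx hy =>
    filter_upwards [hx, hy] with n h₁ h₂
    rw [map_add, h₁, h₂, add_zero]
  | tmul x y =>
    have hx : x ∈ ⨆ n, degree h n := iSup_degree (h := h) ▸ Submodule.mem_top
    have hy : y ∈ ⨆ n, degree h n := iSup_degree (h := h) ▸ Submodule.mem_top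
    induction hx using Submodule.iSup_induction' with
    | zero => simp
    | add x y _ _ hx hy =>
      filter_upwards [hx, hy] with n h₁ h₂
      rw [TensorProduct.add_tmul, map_add, h₁, h₂, add_zero]
    | mem p x hx =>
      induction hy using Submodule.iSup_induction' with
      | zero => simp
      | add x y _ _ hx hy =>
        filter_upwards [hx, hy] with n h₁ h₂
        rw [TensorProduct.tmul_add, map_add, h₁, h₂, add_zero]
      | mem q y hy =>
        filter_upwards [Filter.eventually_gt_atTop (p + q)] with n hn
        exact mulN_eq_zero hn.ne' hx hy

theorem exists_mul_eventually (d : Words h ⊗[k] Words h) :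
    ∃ w, ∀ᶠ N in Filter.atTop, ∑ n ∈ Finset.range N, mulN h n d = w := by
  obtain ⟨N₀, hN₀⟩ := Filter.eventually_atTop.mp (mulN_eventually d)
  refine ⟨∑ n ∈ Finset.range N₀, mulN h n d, ?_⟩
  filter_upwards [Filter.eventually_ge_atTop N₀] with N hN
  refine (Finset.sum_subset (Finset.range_mono hN) fun n _ hn ↦ hN₀ n ?_).symm
  simpa using hn

variable (h) in
/-- The multiplication: the sum `∑ₙ mulN n`, of which only finitely many terms are non-zero on each
element. It is the coalgebra map with components `mulB` and `mulM` in degrees zero and one. -/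
def mulL : Words h ⊗[k] Words h →ₗ[k] Words h where
  toFun d := (exists_mul_eventually d).choose
  map_add' x y := by
    obtain ⟨N, h₁, h₂, h₃⟩ := ((exists_mul_eventually (x + y)).choose_spec.and
      ((exists_mul_eventually x).choose_spec.and (exists_mul_eventually y).choose_spec)).exists
    rw [← h₁, ← h₂, ← h₃]
    simp [Finset.sum_add_distrib]
  map_smul' c x := by
    obtain ⟨N, h₁, h₂⟩ := ((exists_mul_eventually (c • x)).choose_spec.and
      (exists_mul_eventually x).choose_spec).exists
    rw [← h₁, ← h₂]
    simp [Finset.smul_sum]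

theorem mulL_eventually (d : Words h ⊗[k] Words h) :
    ∀ᶠ N in Filter.atTop, ∑ n ∈ Finset.range N, mulN h n d = mulL h d :=
  (exists_mul_eventually d).choose_spec

theorem mulL_isExtension : IsExtension h (mulB h) (mulM h) (mulL h) := by
  intro d
  have h₁ : ∀ z : (Words h ⊗[k] Words h) ⊗[k] (Words h ⊗[k] Words h), ∀ᶠ N in Filter.atTop,
      ∑ n ∈ Finset.range N, TensorProduct.map (mulM h) (mulN h n) z =
        TensorProduct.map (mulM h) (mulL h) z := by
    intro z
    induction z with
    | zero => simp
    | add x y hx hy =>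
      filter_upwards [hx, hy] with N h₁ h₂
      simp only [map_add, Finset.sum_add_distrib, h₁, h₂]
    | tmul x y =>
      filter_upwards [mulL_eventually y] with N h₁
      simp [← TensorProduct.tmul_sum, h₁]
  obtain ⟨N, hN₁, hN₂⟩ := ((h₁ (Coalgebra.comul d)).and
    ((Filter.tendsto_add_atTop_nat 1).eventually (mulL_eventually d))).exists
  rw [← hN₂, ← hN₁, Finset.sum_range_succ', add_comm, map_sum]
  rfl

theorem mulB_map_comul (d : Words h ⊗[k] Words h) :
    TensorProduct.map (mulB h) (mulB h) (Coalgebra.comul d) = Coalgebra.comul (mulB h d) := by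
  induction d with
  | zero => simp
  | add x y hx hy => simp only [map_add, hx, hy]
  | tmul x y =>
    rw [mulB_tmul, Bialgebra.comul_mul, ← map_toB_toB, ← map_toB_toB, TensorProduct.comul_tmul]
    generalize Coalgebra.comul (R := k) x = u
    generalize Coalgebra.comul (R := k) y = v
    induction u with
    | zero => simp
    | add x y hx hy => simp only [map_add, TensorProduct.add_tmul, hx, hy, add_mul]
    | tmul a b =>
      induction v with
      | zero => simp
      | add x y hx hy => simp only [map_add, TensorProduct.tmul_add, hx, hy, mul_add]
      | tmul c d => simp

theorem mulM_map_comul (d : Words h ⊗[k] Words h) :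
    TensorProduct.map (mulB h) (mulM h) (Coalgebra.comul d) = h.coactL (mulM h d) := by
  induction d with
  | zero => simp
  | add x y hx hy => simp only [map_add, hx, hy]
  | tmul x y =>
    rw [mulM_tmul, map_add, h.coactL_actL, h.coactL_actR, ← map_toB_toB, ← map_toB_toM,
      ← map_toB_toB, ← map_toB_toM, TensorProduct.comul_tmul]
    generalize Coalgebra.comul (R := k) x = u
    generalize Coalgebra.comul (R := k) y = v
    induction u with
    | zero => simp
    | add x y hx hy =>
      simp only [map_add, TensorProduct.add_tmul, hx, hy, LinearMap.add_apply]; abel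
    | tmul a b =>
      induction v with
      | zero => simp
      | add x y hx hy => simp only [map_add, TensorProduct.tmul_add, hx, hy]; abel
      | tmul c d => simp [TensorProduct.tmul_add]

variable (h) in
/-- The multiplication as a morphism of coalgebras. -/
def mulHom : Words h ⊗[k] Words h →ₗc[k] Words h where
  toLinearMap := mulL h
  counit_comp := mulL_isExtension.counit_comp h (by
    intro d
    induction d with
    | zero => simp
    | add x y hx hy => simp only [map_add, hx, hy]
    | tmul x y =>
      simp [TensorProduct.counit_tmul, counit_eq, mul_comm])
  map_comp_comul := mulL_isExtension.map_comp_comul mulB_map_comul mulM_map_comul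

theorem lift_cons_toB (z : M ⊗[k] Words h) : toB h (TensorProduct.lift (cons h) z) = 0 := by
  have : toB h ∘ₗ TensorProduct.lift (cons h) = 0 := by ext; simp
  exact LinearMap.congr_fun this z

theorem toB_mulL (d : Words h ⊗[k] Words h) : toB h (mulL h d) = mulB h d := by
  rw [mulL_isExtension d, map_add, lift_cons_toB]; simp

theorem toM_mulL (d : Words h ⊗[k] Words h) : toM h (mulL h d) = mulM h d := by
  have e : toM h ∘ₗ TensorProduct.lift (cons h) = TensorProduct.rid k M ∘ₗ
      (Coalgebra.counit ∘ₗ toB h).lTensor M := by ext; simp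
  have e' := LinearMap.congr_fun e (TensorProduct.map (mulM h) (mulL h) (Coalgebra.comul d))
  rw [LinearMap.comp_apply] at e'
  have e₂ : (Coalgebra.counit (R := k) ∘ₗ toB h) ∘ₗ mulL h = Coalgebra.counit :=
    (mulHom h).counit_comp
  rw [mulL_isExtension d, map_add, e']
  simp only [toM_inB, zero_add, LinearMap.comp_apply, LinearMap.lTensor_map, e₂]
  have e₃ := congrArg (TensorProduct.map (mulM h) .id) (Coalgebra.lTensor_counit_comul (R := k) d)
  rw [LinearMap.lTensor, TensorProduct.map_map] at e₃
  simpa using congrArg (TensorProduct.rid k M) e₃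

/-- The unit as a morphism of coalgebras. -/
def oneHom : k →ₗc[k] Words h where
  toLinearMap := LinearMap.toSpanSingleton k _ (inB h 1)
  counit_comp := by ext; simp [counit_eq]
  map_comp_comul := by
    ext
    simp [comul_eq, comul_inB, Algebra.TensorProduct.one_def]
end Words
end WordsAlgebra

section Sub

variable {k : Type*} [Field k]

section coalgebra

variable {A : Type*} [AddCommGroup A] [Module k A] [Coalgebra k A]
variable {S : Type*} [AddCommGroup S] [Module k S]

/-- The comultiplication of a coalgebra restricted to a subspace `i : S → A` with
`Δ(S) ⊆ S ⊗ S`. -/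
def subComul (i : S →ₗ[k] A) (hi : Function.Injective i)
    (hr : ∀ s, Coalgebra.comul (i s) ∈ LinearMap.range (TensorProduct.map i i)) :
    S →ₗ[k] S ⊗[k] S :=
  (LinearEquiv.ofInjective (TensorProduct.map i i)
    (TensorProduct.map_injective_of_flat_flat i i hi hi)).symm.toLinearMap ∘ₗ
      LinearMap.codRestrict _ (Coalgebra.comul ∘ₗ i) hr

theorem map_subComul (i : S →ₗ[k] A) (hi : Function.Injective i)
    (hr : ∀ s, Coalgebra.comul (i s) ∈ LinearMap.range (TensorProduct.map i i)) (s : S) :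
    TensorProduct.map i i (subComul i hi hr s) = Coalgebra.comul (i s) := by
  have := LinearEquiv.apply_symm_apply (LinearEquiv.ofInjective (TensorProduct.map i i)
    (TensorProduct.map_injective_of_flat_flat i i hi hi)) ⟨Coalgebra.comul (i s), hr s⟩
  exact congrArg Subtype.val this

/-- The coalgebra structure on a subspace `i : S → A` with `Δ(S) ⊆ S ⊗ S`. -/
@[reducible]
def subCoalgebra (i : S →ₗ[k] A) (hi : Function.Injective i)
    (hr : ∀ s, Coalgebra.comul (i s) ∈ LinearMap.range (TensorProduct.map i i)) :
    Coalgebra k S where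
  comul := subComul i hi hr
  counit := Coalgebra.counit ∘ₗ i
  coassoc := by
    ext s
    have inj : Function.Injective (TensorProduct.map i (TensorProduct.map i i)) :=
      TensorProduct.map_injective_of_flat_flat _ _ hi
        (TensorProduct.map_injective_of_flat_flat i i hi hi)
    apply inj
    have e : Coalgebra.comul ∘ₗ i = TensorProduct.map i i ∘ₗ subComul i hi hr :=
      LinearMap.ext fun s ↦ (map_subComul i hi hr s).symm
    have := Coalgebra.coassoc_apply (R := k) (i s)
    rw [← map_subComul i hi hr s, LinearMap.rTensor_map, LinearMap.lTensor_map, e] at this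
    simp only [LinearMap.comp_apply, LinearEquiv.coe_coe]
    convert this using 1
    · generalize subComul i hi hr s = z
      induction z with
      | zero => simp
      | add x y hx hy => simp only [map_add, hx, hy]
      | tmul a b =>
        simp only [TensorProduct.map_tmul, LinearMap.rTensor_tmul, LinearMap.comp_apply]
        generalize subComul i hi hr a = z
        induction z with
        | zero => simp
        | add x y hx hy => simp only [map_add, TensorProduct.add_tmul, hx, hy]
        | tmul a b => simp
    · rw [LinearMap.lTensor, TensorProduct.map_map, LinearMap.comp_id]
  rTensor_counit_comp_comul := by
    ext s
    have inj : Function.Injective (TensorProduct.map (LinearMap.id : k →ₗ[k] k) i) :=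
      TensorProduct.map_injective_of_flat_flat _ _ Function.injective_id hi
    apply inj
    have := Coalgebra.rTensor_counit_comul (R := k) (i s)
    rw [← map_subComul i hi hr s, LinearMap.rTensor_map] at this
    simp only [LinearMap.comp_apply, LinearMap.rTensor, TensorProduct.map_map, LinearMap.id_comp,
      LinearMap.comp_id, this]
    simp
  lTensor_counit_comp_comul := by
    ext s
    have inj : Function.Injective (TensorProduct.map i (LinearMap.id : k →ₗ[k] k)) :=
      TensorProduct.map_injective_of_flat_flat _ _ hi Function.injective_id
    apply inj
    have := Coalgebra.lTensor_counit_comul (R := k) (i s)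
    rw [← map_subComul i hi hr s, LinearMap.lTensor_map] at this
    simp only [LinearMap.comp_apply, LinearMap.lTensor, TensorProduct.map_map, LinearMap.id_comp,
      LinearMap.comp_id, this]
    simp

end coalgebra

/-- The bialgebra structure on a subalgebra `S` with `Δ(S) ⊆ S ⊗ S`. -/
@[reducible]
def subBialgebra {A : Type*} [Ring A] [Bialgebra k A] (S : Subalgebra k A)
    (hr : ∀ s : S, Coalgebra.comul (s : A) ∈
      LinearMap.range (TensorProduct.map S.val.toLinearMap S.val.toLinearMap)) :
    Bialgebra k S :=
  letI : Coalgebra k S := subCoalgebra S.val.toLinearMap Subtype.val_injective hr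
  have inj : Function.Injective (Algebra.TensorProduct.map S.val S.val) :=
    TensorProduct.map_injective_of_flat_flat _ _ Subtype.val_injective Subtype.val_injective
  have e (s : S) : Algebra.TensorProduct.map S.val S.val (Coalgebra.comul s) =
      Coalgebra.comul (s : A) := map_subComul S.val.toLinearMap Subtype.val_injective hr s
  Bialgebra.mk' k S (Bialgebra.counit_one (R := k) (A := A))
    (fun {a b} ↦ Bialgebra.counit_mul (R := k) (a : A) (b : A))
    (inj (by rw [e, map_one]; exact Bialgebra.comul_one (R := k) (A := A)))
    (fun {a b} ↦ inj (by rw [e, map_mul, e, e]; exact Bialgebra.comul_mul (R := k) (a : A) (b : A)))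

end Sub

section Cotensor

variable {k : Type*} [Field k]
variable {B : Type*} [Ring B] [Bialgebra k B] {M : Type*} [AddCommGroup M] [Module k M]

namespace Words

variable (h : HopfBimodule k B M)

/-- The subspace `⨁ₙ M □ ⋯ □ M □ B` of `⨁ₙ M^{⊗ n} ⊗ B`: at each of the places `1, …, n` of a word,
the right coaction of the letter to the left of it agrees with the left coaction of the letter to
the right of it (with `Δ_B` at the last place). -/
def cotensor : Submodule k (Words h) := LinearMap.eqLocus (comulL h) (comulR h)

variable {h}

theorem mem_cotensor {x : Words h} : x ∈ cotensor h ↔ comulL h x = comulR h x := Iff.rfl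

theorem comulL_assoc (w : Words h) :
    TensorProduct.assoc k _ _ _ ((comulL h).rTensor _ (comul h w)) =
      (comul h).lTensor _ (comulL h w) := by
  have e₁ (q : Words h →ₗ[k] Words h) (z : (Words h ⊗[k] Words h) ⊗[k] Words h) :
      TensorProduct.assoc k _ _ _ ((q.rTensor _).rTensor _ z) =
        q.rTensor _ (TensorProduct.assoc k _ _ _ z) := by
    induction z with
    | zero => simp
    | add x y hx hy => simp only [map_add, hx, hy]
    | tmul a b =>
      induction a with
      | zero => simp
      | add x y hx hy => simp only [map_add, TensorProduct.add_tmul, hx, hy]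
      | tmul a b => simp
  have e₂ (q : Words h →ₗ[k] Words h) (z : Words h ⊗[k] Words h) :
      (comul h).lTensor _ (q.rTensor _ z) = q.rTensor _ ((comul h).lTensor _ z) := by
    rw [← LinearMap.comp_apply, LinearMap.lTensor_comp_rTensor, ← LinearMap.rTensor_comp_lTensor,
      LinearMap.comp_apply]
  have := Coalgebra.coassoc_apply (R := k) w
  rw [comul_eq] at this
  rw [comulL, LinearMap.rTensor_comp_apply, e₁, this, LinearMap.comp_apply, e₂]

theorem comulR_assoc (w : Words h) :
    TensorProduct.assoc k _ _ _ ((comulR h).rTensor _ (comul h w)) =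
      (comul h).lTensor _ (comulR h w) := by
  have e₁ (m : M) (y : Words h ⊗[k] Words h) : TensorProduct.assoc k _ _ _ ((comulR h).rTensor _
      ((cons h m).rTensor _ y)) =
      inM h m ⊗ₜ y +
      (cons h m).rTensor _ (TensorProduct.assoc k _ _ _ ((comulR h).rTensor _ y)) := by
    induction y with
    | zero => simp
    | add x y hx hy => simp only [map_add, hx, hy, TensorProduct.tmul_add]; abel
    | tmul a c =>
      simp only [LinearMap.rTensor_tmul, comulR_cons, TensorProduct.add_tmul, map_add]
      congr 1
      induction (comulR h a) with
      | zero => simp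
      | add x y hx hy => simp only [map_add, TensorProduct.add_tmul, hx, hy]
      | tmul b b' => simp
  have e₂ (q : Words h →ₗ[k] Words h) (z : Words h ⊗[k] Words h) :
      (comul h).lTensor _ (q.rTensor _ z) = q.rTensor _ ((comul h).lTensor _ z) := by
    rw [← LinearMap.comp_apply, LinearMap.lTensor_comp_rTensor, ← LinearMap.rTensor_comp_lTensor,
      LinearMap.comp_apply]
  have e₃ : comulR h ∘ₗ inB h = 0 := LinearMap.ext fun b ↦ comulR_inB h b
  revert w
  apply LinearMap.congr_fun (f := (TensorProduct.assoc k _ _ _).toLinearMap ∘ₗ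
    (comulR h).rTensor _ ∘ₗ comul h) (g := (comul h).lTensor _ ∘ₗ comulR h)
  apply hom_ext
  · intro b
    simp [comul_inB, comulR_inB, LinearMap.rTensor_map, e₃]
  · intro m w hw
    simp only [LinearMap.comp_apply, LinearEquiv.coe_coe] at hw ⊢
    rw [comul_cons, map_add, map_add, LinearMap.rTensor_map, e₃, e₁, hw, comulR_cons, map_add, e₂]
    simp

/-- The projection onto the words of positive length. -/
abbrev pos (h : HopfBimodule k B M) : Words h →ₗ[k] Words h := LinearMap.id - inB h ∘ₗ toB h

theorem pos_inB (b : B) : pos h (inB h b) = 0 := by simp [pos]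
theorem pos_cons (m : M) (w : Words h) : pos h (cons h m w) = cons h m w := by simp [pos]

theorem comul_rTensor_cons (m : M) (y : Words h ⊗[k] Words h) :
    TensorProduct.assoc k _ _ _ ((comul h).rTensor _ ((cons h m).rTensor _ y)) =
      TensorProduct.map (inB h) ((LinearMap.rTensorHom _ ∘ₗ cons h).flip y) (h.coactL m) +
      (cons h m).rTensor _ (TensorProduct.assoc k _ _ _ ((comul h).rTensor _ y)) := by
  induction y with
  | zero => simp
  | add x y hx hy =>
    simp only [map_add, hx, hy, TensorProduct.map_add_right, LinearMap.add_apply]; abel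
  | tmul a c =>
    simp only [LinearMap.rTensor_tmul, comul_cons, TensorProduct.add_tmul, map_add]
    congr 1
    · induction (h.coactL m) with
      | zero => simp
      | add x y hx hy => simp only [map_add, TensorProduct.add_tmul, hx, hy]
      | tmul b b' => simp
    · induction (comul h a) with
      | zero => simp
      | add x y hx hy => simp only [map_add, TensorProduct.add_tmul, hx, hy]
      | tmul b b' => simp

theorem comulL_lTensor (w : Words h) :
    (comulL h).lTensor _ (comul h w) = ((pos h).rTensor _).lTensor _
      (TensorProduct.assoc k _ _ _ ((comul h).rTensor _ (comulL h w))) := by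
  have e₁ (z : Words h ⊗[k] Words h) : ((pos h).rTensor _).lTensor _ (TensorProduct.assoc k _ _ _
      ((comul h).rTensor _ ((inB h ∘ₗ toB h).rTensor _ z))) = 0 := by
    induction z with
    | zero => simp
    | add x y hx hy => simp only [map_add, hx, hy, add_zero]
    | tmul a b =>
      simp only [LinearMap.rTensor_tmul, LinearMap.comp_apply, comul_inB]
      induction Coalgebra.comul (R := k) (toB h a) with
      | zero => simp
      | add x y hx hy => simp only [map_add, TensorProduct.add_tmul, hx, hy, add_zero]
      | tmul a b => simp
  have := Coalgebra.coassoc_apply (R := k) w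
  rw [comul_eq] at this
  have e₂ : comulL h w = comul h w - (inB h ∘ₗ toB h).rTensor _ (comul h w) := by
    simp [comulL, LinearMap.rTensor_sub]
  rw [e₂, map_sub, map_sub, map_sub, e₁, sub_zero, this, ← LinearMap.lTensor_comp_apply]
  rfl

theorem pos_comul_inM (m : M) :
    (pos h).lTensor _ (comul h (inM h m)) = TensorProduct.map (inB h) (inM h) (h.coactL m) := by
  have e (z : M ⊗[k] B) : (pos h).lTensor _ (comul h (TensorProduct.lift (cons h)
      ((inB h).lTensor M z))) =
      TensorProduct.map (inB h) (TensorProduct.lift (cons h) ∘ₗ (inB h).lTensor M)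
        (TensorProduct.assoc k _ _ _ (h.coactL.rTensor _ z)) := by
    induction z with
    | zero => simp
    | add x y hx hy => simp only [map_add, hx, hy]
    | tmul m b =>
      simp only [LinearMap.lTensor_tmul, TensorProduct.lift.tmul, comul_cons, map_add,
        LinearMap.rTensor_tmul, comul_inB]
      have z₁ : (pos h).lTensor _ ((cons h m).rTensor _ (TensorProduct.map (inB h) (inB h)
          (Coalgebra.comul b))) = 0 := by
        induction Coalgebra.comul (R := k) b with
        | zero => simp
        | add x y hx hy => simp only [map_add, hx, hy, add_zero]
        | tmul a b => simp
      rw [z₁, add_zero]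
      induction h.coactL m with
      | zero => simp
      | add x y hx hy => simp only [map_add, TensorProduct.add_tmul, hx, hy]
      | tmul a b => simp
  rw [inM, LinearMap.comp_apply, LinearMap.comp_apply, e, h.coactL_coactR,
    LinearMap.map_lTensor]
  rfl

theorem lTensor_rTensor_cons {Y Z : Type*} [AddCommGroup Y] [Module k Y] [AddCommGroup Z]
    [Module k Z] (f : Y →ₗ[k] Z) (m : M) (z : Words h ⊗[k] Y) :
    f.lTensor _ ((cons h m).rTensor _ z) = (cons h m).rTensor _ (f.lTensor _ z) := by
  rw [← LinearMap.comp_apply, LinearMap.lTensor_comp_rTensor, ← LinearMap.rTensor_comp_lTensor,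
    LinearMap.comp_apply]

theorem comulR_lTensor (w : Words h) :
    (comulR h).lTensor _ (comul h w) = ((pos h).rTensor _).lTensor _
      (TensorProduct.assoc k _ _ _ ((comul h).rTensor _ (comulR h w))) := by
  have e₃ : comulR h ∘ₗ inB h = 0 := LinearMap.ext fun b ↦ comulR_inB h b
  have c₂ (z : Words h ⊗[k] Words h) (w : Words h) : ((pos h).rTensor _).lTensor _
      (TensorProduct.assoc k _ _ _ (z ⊗ₜ w)) =
      TensorProduct.assoc k _ _ _ (((pos h).lTensor _ z) ⊗ₜ w) := by
    induction z with
    | zero => simp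
    | add x y hx hy => simp only [map_add, TensorProduct.add_tmul, hx, hy]
    | tmul a b =>
      simp only [LinearMap.lTensor_tmul, TensorProduct.assoc_tmul, LinearMap.rTensor_tmul]
  have c₃ (z : B ⊗[k] M) (w : Words h) (y : Words h ⊗[k] Words h) (hy : comulR h w = y) :
      (comulR h).lTensor _ (TensorProduct.map (inB h) ((cons h).flip w) z) =
      TensorProduct.assoc k _ _ _ ((TensorProduct.map (inB h) (inM h) z) ⊗ₜ w) +
      ((pos h).rTensor _).lTensor _
        (TensorProduct.map (inB h) ((LinearMap.rTensorHom _ ∘ₗ cons h).flip y) z) := by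
    induction z with
    | zero => simp
    | add x y hx hy => simp only [map_add, TensorProduct.add_tmul, hx, hy]; abel
    | tmul b m =>
      have : pos h ∘ₗ cons h m = cons h m := LinearMap.ext fun w ↦ pos_cons m w
      simp only [TensorProduct.map_tmul, LinearMap.lTensor_tmul, LinearMap.flip_apply, comulR_cons,
        hy, TensorProduct.tmul_add, TensorProduct.assoc_tmul, LinearMap.comp_apply,
        LinearMap.coe_rTensorHom, ← LinearMap.rTensor_comp_apply, this]
  revert w
  apply LinearMap.congr_fun (f := (comulR h).lTensor _ ∘ₗ comul h)
    (g := ((pos h).rTensor _).lTensor _ ∘ₗ (TensorProduct.assoc k _ _ _).toLinearMap ∘ₗ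
      (comul h).rTensor _ ∘ₗ comulR h)
  apply hom_ext
  · intro b
    simp [comul_inB, comulR_inB, LinearMap.lTensor_map, e₃]
  · intro m w hw
    simp only [LinearMap.comp_apply, LinearEquiv.coe_coe] at hw ⊢
    rw [comul_cons, map_add, lTensor_rTensor_cons, hw, comulR_cons, map_add, map_add, map_add,
      LinearMap.rTensor_tmul, c₂, pos_comul_inM, comul_rTensor_cons, map_add, lTensor_rTensor_cons,
      c₃ _ _ _ rfl, add_assoc]

theorem comul_mem_cotensor (x : cotensor h) : Coalgebra.comul (x : Words h) ∈
    LinearMap.range (TensorProduct.map (cotensor h).subtype (cotensor h).subtype) := by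
  set κ := comulL h - comulR h with hκ
  have hker : LinearMap.ker κ = cotensor h := by
    ext x; simp [hκ, sub_eq_zero, mem_cotensor]
  have hx : comulL h x = comulR h x := x.2
  have h₁ : κ.rTensor _ (comul h x) = 0 := by
    apply (TensorProduct.assoc k _ _ _).injective
    rw [hκ, LinearMap.rTensor_sub, LinearMap.sub_apply, map_sub, comulL_assoc, comulR_assoc, hx,
      sub_self, map_zero]
  have h₂ : κ.lTensor _ (comul h x) = 0 := by
    rw [hκ, LinearMap.lTensor_sub, LinearMap.sub_apply, comulL_lTensor, comulR_lTensor, hx, sub_self]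
  have ex : Function.Exact (cotensor h).subtype κ := by
    rw [← hker]; exact LinearMap.exact_subtype_ker_map κ
  obtain ⟨z, hz⟩ := (Module.Flat.rTensor_exact (Words h) ex (comul h x)).mp h₁
  have h₃ : κ.lTensor _ z = 0 := by
    have inj : Function.Injective ((cotensor h).subtype.rTensor (Words h ⊗[k] Words h)) :=
      Module.Flat.rTensor_preserves_injective_linearMap _ (cotensor h).injective_subtype
    apply inj
    rw [← LinearMap.comp_apply, LinearMap.rTensor_comp_lTensor, ← LinearMap.lTensor_comp_rTensor,
      LinearMap.comp_apply, hz, h₂, map_zero]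
  obtain ⟨y, hy⟩ := (Module.Flat.lTensor_exact (cotensor h) ex z).mp h₃
  refine ⟨y, ?_⟩
  rw [comul_eq, ← hz, ← hy, ← LinearMap.comp_apply, LinearMap.rTensor_comp_lTensor]

instance : Coalgebra k (cotensor h) :=
  subCoalgebra (cotensor h).subtype (cotensor h).injective_subtype comul_mem_cotensor

/-- The inclusion of the cotensor coalgebra as a morphism of coalgebras. -/
def cotensorIncl : cotensor h →ₗc[k] Words h where
  toLinearMap := (cotensor h).subtype
  counit_comp := rfl
  map_comp_comul := LinearMap.ext fun x ↦
    map_subComul (cotensor h).subtype (cotensor h).injective_subtype comul_mem_cotensor x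

theorem comulR_lift_cons (z : M ⊗[k] Words h) : comulR h (TensorProduct.lift (cons h) z) =
    (inM h).rTensor _ z + consT h _ ((comulR h).lTensor M z) := by
  induction z with
  | zero => simp
  | add x y hx hy => simp only [map_add, hx, hy]; abel
  | tmul m w => simp [comulR_cons, consT_tmul]

theorem comulL_lift_cons (z : M ⊗[k] Words h) : comulL h (TensorProduct.lift (cons h) z) =
    consT h _ ((comul h).lTensor M z) := by
  induction z with
  | zero => simp
  | add x y hx hy => simp only [map_add, hx, hy]
  | tmul m w => simp [comulL_cons, consT_tmul]

theorem mem_cotensor_of_coalgHom {D : Type*} [AddCommGroup D] [Module k D] [Coalgebra k D]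
    (F : D →ₗc[k] Words h)
    (hF : ∀ d, TensorProduct.map (toM h ∘ₗ F.toLinearMap) (toB h ∘ₗ F.toLinearMap)
      (Coalgebra.comul d) = h.coactR (toM h (F d))) (d : D) : F d ∈ cotensor h := by
  set f₁ := toM h ∘ₗ F.toLinearMap with hf₁
  set f₀ := toB h ∘ₗ F.toLinearMap with hf₀
  have e₁ : inM h ∘ₗ f₁ = TensorProduct.lift (cons h) ∘ₗ TensorProduct.map f₁ (inB h ∘ₗ f₀) ∘ₗ
      Coalgebra.comul := by
    ext d
    have := hF d
    simp only [inM, LinearMap.comp_apply]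
    change _ = h.coactR (f₁ d) at this
    rw [← this, LinearMap.lTensor_map]
  have e₂ : comul h ∘ₗ F.toLinearMap = TensorProduct.map (inB h ∘ₗ f₀) F.toLinearMap ∘ₗ
      Coalgebra.comul + comulL h ∘ₗ F.toLinearMap := by
    have a₁ : comul h = (inB h ∘ₗ toB h).rTensor _ ∘ₗ comul h + comulL h := by
      rw [comulL, ← LinearMap.add_comp, ← LinearMap.rTensor_add]
      simp
    have a₂ : comul h ∘ₗ F.toLinearMap = _ := F.map_comp_comul.symm
    conv_lhs => rw [a₁]
    rw [LinearMap.add_comp, LinearMap.comp_assoc, a₂, ← LinearMap.comp_assoc,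
      LinearMap.rTensor_comp_map, LinearMap.comp_assoc]
  have key := eq_zero_of_recursion h f₁ (comulL h ∘ₗ F.toLinearMap - comulR h ∘ₗ F.toLinearMap) (by
    intro d
    have b₁ : comulL h (F d) = consT h _ (TensorProduct.map f₁ (comul h ∘ₗ F.toLinearMap)
        (Coalgebra.comul d)) := by
      rw [coalgHom_eq F d, map_add, comulL_inB, zero_add, comulL_lift_cons, LinearMap.lTensor_map]
    have b₂ : comulR h (F d) = consT h _ (TensorProduct.map f₁
        (TensorProduct.map (inB h ∘ₗ f₀) F.toLinearMap ∘ₗ Coalgebra.comul) (Coalgebra.comul d)) +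
        consT h _ (TensorProduct.map f₁ (comulR h ∘ₗ F.toLinearMap) (Coalgebra.comul d)) := by
      rw [coalgHom_eq F d, map_add, comulR_inB, zero_add, comulR_lift_cons, LinearMap.lTensor_map,
        LinearMap.rTensor_map, e₁, ← coassoc_map]
      congr 1
      generalize Coalgebra.comul (R := k) d = z
      induction z with
      | zero => simp
      | add x y hx hy => simp only [map_add, hx, hy]
      | tmul a b =>
        simp only [TensorProduct.map_tmul, LinearMap.comp_apply]
        induction (TensorProduct.map f₁ (inB h ∘ₗ f₀) (Coalgebra.comul (R := k) a)) with
        | zero => simp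
        | add x y hx hy => simp only [map_add, TensorProduct.add_tmul, hx, hy]
        | tmul b b' => simp [consT_tmul]
    change comulL h (F d) - comulR h (F d) = _
    rw [b₁, b₂, e₂, map_sub_right, LinearMap.sub_apply, map_sub, TensorProduct.map_add_right,
      LinearMap.add_apply, map_add]
    abel)
  exact sub_eq_zero.mp (LinearMap.congr_fun key d)

theorem toB_inM (m : M) : toB h (inM h m) = 0 := lift_cons_toB _

theorem uncons_inM (m : M) : (toB h).lTensor M (uncons h (inM h m)) = h.coactR m := by
  have e : (toB h).lTensor M ∘ₗ uncons h ∘ₗ TensorProduct.lift (cons h) ∘ₗ (inB h).lTensor M =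
      LinearMap.id := by ext; simp
  exact LinearMap.congr_fun e (h.coactR m)

theorem toB_comulR (w : Words h) : (toB h).rTensor _ (comulR h w) = 0 := by
  revert w
  apply LinearMap.congr_fun (f := (toB h).rTensor _ ∘ₗ comulR h) (g := 0)
  apply hom_ext
  · intro b; simp [comulR_inB]
  · intro m w _
    have : toB h ∘ₗ cons h m = 0 := by ext; simp
    simp [comulR_cons, toB_inM, ← LinearMap.rTensor_comp_apply, this]

theorem map_toM_toB (x : cotensor h) :
    TensorProduct.map (toM h) (toB h) (Coalgebra.comul (x : Words h)) = h.coactR (toM h x) := by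
  set Ψ : Words h ⊗[k] Words h →ₗ[k] M ⊗[k] B := (TensorProduct.rid k _).toLinearMap ∘ₗ
    TensorProduct.map ((toB h).lTensor M ∘ₗ uncons h) (Coalgebra.counit (R := k)) with hΨ
  have h₁ : Ψ (comulL h x) = (toB h).lTensor M (uncons h x) := by
    have e : ((toB h).lTensor M ∘ₗ uncons h) ∘ₗ (LinearMap.id - inB h ∘ₗ toB h) =
        (toB h).lTensor M ∘ₗ uncons h := by ext; simp
    have := congrArg (TensorProduct.map ((toB h).lTensor M ∘ₗ uncons h) .id)
      (Coalgebra.lTensor_counit_comul (R := k) (x : Words h))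
    rw [LinearMap.map_lTensor, LinearMap.id_comp] at this
    rw [hΨ, comulL, LinearMap.comp_apply, LinearMap.comp_apply, LinearMap.map_rTensor, e]
    erw [this]
    simp
  have h₂ : Ψ (comulR h x) = h.coactR (toM h x) := by
    generalize (x : Words h) = w
    revert w
    apply LinearMap.congr_fun (f := Ψ ∘ₗ comulR h) (g := h.coactR ∘ₗ toM h)
    apply hom_ext
    · intro b; simp [comulR_inB]
    · intro m w _
      have z (y : Words h ⊗[k] Words h) : Ψ ((cons h m).rTensor _ y) =
          (TensorProduct.rid k _) (TensorProduct.map (TensorProduct.mk k M B m)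
            (Coalgebra.counit (R := k)) ((toB h).rTensor _ y)) := by
        induction y with
        | zero => simp
        | add x y hx hy => simp only [map_add, hx, hy]
        | tmul a b => simp [hΨ]
      simp only [LinearMap.comp_apply, comulR_cons, map_add, z, toB_comulR, map_zero, add_zero,
        toM_cons, map_smul]
      simp [hΨ, uncons_inM, counit_eq]
  have hx : comulL h x = comulR h x := x.2
  have := map_toM_id h (x : Words h)
  rw [← h₂, ← hx, h₁, ← this, LinearMap.lTensor_map, LinearMap.comp_id]

theorem mulM_map_comulR (d : cotensor h ⊗[k] cotensor h) :
    TensorProduct.map (mulM h) (mulB h) (Coalgebra.comul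
      (TensorProduct.map (cotensor h).subtype (cotensor h).subtype d)) =
    h.coactR (mulM h (TensorProduct.map (cotensor h).subtype (cotensor h).subtype d)) := by
  induction d with
  | zero => simp
  | add x y hx hy => simp only [map_add, hx, hy]
  | tmul x y =>
    rw [TensorProduct.map_tmul, mulM_tmul, map_add, h.coactR_actL, h.coactR_actR, ← map_toB_toB,
      ← map_toB_toB]
    simp only [Submodule.subtype_apply]
    rw [← map_toM_toB, ← map_toM_toB, TensorProduct.comul_tmul]
    generalize Coalgebra.comul (R := k) (x : Words h) = u
    generalize Coalgebra.comul (R := k) (y : Words h) = v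
    induction u with
    | zero => simp
    | add x y hx hy =>
      simp only [map_add, TensorProduct.add_tmul, hx, hy, LinearMap.add_apply]; abel
    | tmul a b =>
      induction v with
      | zero => simp
      | add x y hx hy => simp only [map_add, TensorProduct.tmul_add, hx, hy]; abel
      | tmul c d => simp [TensorProduct.add_tmul]

theorem mul_mem_cotensor {x y : Words h} (hx : x ∈ cotensor h) (hy : y ∈ cotensor h) :
    mulL h (x ⊗ₜ y) ∈ cotensor h := by
  refine mem_cotensor_of_coalgHom
    ((mulHom h).comp (Coalgebra.TensorProduct.map (cotensorIncl (h := h)) cotensorIncl)) ?_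
    ((⟨x, hx⟩ : cotensor h) ⊗ₜ (⟨y, hy⟩ : cotensor h))
  intro d
  have e₁ : toM h ∘ₗ mulL h = mulM h := LinearMap.ext toM_mulL
  have e₂ : toB h ∘ₗ mulL h = mulB h := LinearMap.ext toB_mulL
  have e₃ := CoalgHomClass.map_comp_comul_apply
    (Coalgebra.TensorProduct.map (cotensorIncl (h := h)) (cotensorIncl (h := h))) d
  have e₄ := mulM_map_comulR d
  rw [← toM_mulL] at e₄
  refine Eq.trans ?_ e₄
  have e₅ : Coalgebra.comul (TensorProduct.map (cotensor h).subtype (cotensor h).subtype d) = _ :=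
    e₃.symm
  rw [e₅, TensorProduct.map_map, ← e₁, ← e₂]
  rfl

theorem inB_mem (b : B) : inB h b ∈ cotensor h := by
  rw [mem_cotensor, comulL_inB, comulR_inB]

theorem inM_mem (m : M) : inM h m ∈ cotensor h := by
  rw [mem_cotensor, inM, LinearMap.comp_apply, LinearMap.comp_apply, comulL_lift_cons,
    comulR_lift_cons]
  have z : comulR h ∘ₗ inB h = 0 := LinearMap.ext fun b ↦ comulR_inB h b
  have e : comul h ∘ₗ inB h = TensorProduct.map (inB h) (inB h) ∘ₗ Coalgebra.comul :=
    LinearMap.ext fun b ↦ comul_inB h b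
  rw [← LinearMap.lTensor_comp_apply, ← LinearMap.lTensor_comp_apply, z, LinearMap.lTensor_zero,
    LinearMap.zero_apply, map_zero, add_zero, e, LinearMap.lTensor_comp_apply, ← h.coassocR]
  generalize h.coactR m = z
  induction z with
  | zero => simp
  | add x y hx hy => simp only [map_add, hx, hy]
  | tmul m b =>
    simp only [LinearMap.rTensor_tmul, LinearMap.lTensor_tmul, inM, LinearMap.comp_apply]
    induction h.coactR m with
    | zero => simp
    | add x y hx hy => simp only [map_add, TensorProduct.add_tmul, hx, hy]
    | tmul a b => simp [consT_tmul]

end Words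
end Cotensor

section WordsAlgebra

variable {k : Type*} [Field k]
variable {B : Type*} [Ring B] [Bialgebra k B] {M : Type*} [AddCommGroup M] [Module k M]

namespace Words

variable {h : HopfBimodule k B M}

instance : Mul (Words h) := ⟨fun x y ↦ mulL h (x ⊗ₜ y)⟩
instance : One (Words h) := ⟨inB h 1⟩

theorem mul_def (x y : Words h) : x * y = mulL h (x ⊗ₜ y) := rfl
theorem one_def : (1 : Words h) = inB h 1 := rfl

theorem toB_mul (x y : Words h) : toB h (x * y) = toB h x * toB h y := by
  rw [mul_def, toB_mulL, mulB_tmul]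

theorem toM_mul (x y : Words h) :
    toM h (x * y) = h.actL (toB h x) (toM h y) + h.actR (toM h x) (toB h y) := by
  rw [mul_def, toM_mulL, mulM_tmul]

theorem mul_assoc' (x y z : Words h) : x * y * z = x * (y * z) := by
  have : (mulHom h).comp (Coalgebra.TensorProduct.map (mulHom h) (.id k (Words h))) =
      ((mulHom h).comp (Coalgebra.TensorProduct.map (.id k (Words h)) (mulHom h))).comp
        (Coalgebra.TensorProduct.assoc k k _ _ _).toCoalgHom := by
    apply coalgHom_ext
    · intro d
      induction d with
      | zero => simp
      | add x y hx hy => simp only [map_add, hx, hy]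
      | tmul d z =>
        induction d with
        | zero => simp
        | add x y hx hy => simp only [map_add, TensorProduct.add_tmul, hx, hy]
        | tmul x y =>
          change toB h (x * y * z) = toB h (x * (y * z))
          simp only [toB_mul, mul_assoc]
    · intro d
      induction d with
      | zero => simp
      | add x y hx hy => simp only [map_add, hx, hy]
      | tmul d z =>
        induction d with
        | zero => simp
        | add x y hx hy => simp only [map_add, TensorProduct.add_tmul, hx, hy]
        | tmul x y =>
          change toM h (x * y * z) = toM h (x * (y * z))
          simp only [toB_mul, toM_mul, h.mul_actL, h.actR_mul, map_add, LinearMap.add_apply,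
            h.actL_actR, add_assoc]
  exact DFunLike.congr_fun this ((x ⊗ₜ y) ⊗ₜ z)

theorem one_mul' (x : Words h) : 1 * x = x := by
  have : ((mulHom h).comp (Coalgebra.TensorProduct.map (oneHom (h := h)) (.id k (Words h)))).comp
      (Coalgebra.TensorProduct.lid k _).symm.toCoalgHom = .id k (Words h) := by
    apply coalgHom_ext
    · intro x
      change toB h ((1 : k) • inB h 1 * x) = toB h x
      simp [toB_mul]
    · intro x
      change toM h ((1 : k) • inB h 1 * x) = toM h x
      simp [toM_mul, h.one_actL]
  have := DFunLike.congr_fun this x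
  change (1 : k) • inB h 1 * x = x at this
  rwa [one_smul] at this

theorem mul_one' (x : Words h) : x * 1 = x := by
  have : ((mulHom h).comp (Coalgebra.TensorProduct.map (.id k (Words h)) (oneHom (h := h)))).comp
      (Coalgebra.TensorProduct.rid k k _).symm.toCoalgHom = .id k (Words h) := by
    apply coalgHom_ext
    · intro x
      change toB h (x * (1 : k) • inB h 1) = toB h x
      simp [toB_mul]
    · intro x
      change toM h (x * (1 : k) • inB h 1) = toM h x
      simp [toM_mul, h.actR_one]
  have := DFunLike.congr_fun this x
  change x * (1 : k) • inB h 1 = x at this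
  rwa [one_smul] at this

theorem comul_mulL (a b : Words h) : Coalgebra.comul (mulL h (a ⊗ₜ[k] b)) =
    TensorProduct.map₂ (TensorProduct.curry (mulL h)) (TensorProduct.curry (mulL h))
      (Coalgebra.comul a) (Coalgebra.comul b) := by
  have := CoalgHomClass.map_comp_comul_apply (mulHom h) (a ⊗ₜ[k] b)
  rw [TensorProduct.comul_tmul] at this
  refine this.symm.trans ?_
  generalize Coalgebra.comul (R := k) a = u
  generalize Coalgebra.comul (R := k) b = v
  induction u with
  | zero => simp
  | add x y hx hy => simp only [map_add, TensorProduct.add_tmul, hx, hy, LinearMap.add_apply]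
  | tmul a b =>
    induction v with
    | zero => simp
    | add x y hx hy => simp only [map_add, TensorProduct.tmul_add, hx, hy]
    | tmul c d => rfl

instance : Ring (Words h) where
  __ := (inferInstance : AddCommGroup (Words h))
  left_distrib x y z := by simp only [mul_def, TensorProduct.tmul_add, map_add]
  right_distrib x y z := by simp only [mul_def, TensorProduct.add_tmul, map_add]
  zero_mul x := by simp only [mul_def, TensorProduct.zero_tmul, map_zero]
  mul_zero x := by simp only [mul_def, TensorProduct.tmul_zero, map_zero]
  mul_assoc := mul_assoc'
  one_mul := one_mul'
  mul_one := mul_one'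

instance : Algebra k (Words h) := Algebra.ofModule
  (fun c x y ↦ by simp only [mul_def, ← TensorProduct.smul_tmul', map_smul])
  (fun c x y ↦ by simp only [mul_def, TensorProduct.tmul_smul, map_smul])

instance : Bialgebra k (Words h) := Bialgebra.mk' k (Words h)
  (by simp [one_def, counit_eq])
  (fun {a b} ↦ by simp [counit_eq, toB_mul])
  (by simp [one_def, comul_eq, comul_inB, Algebra.TensorProduct.one_def])
  (fun {a b} ↦ by
    rw [← TensorHopf.map₂_mul]
    exact comul_mulL a b)


variable (h) in
/-- The cotensor coalgebra as a subalgebra. -/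
def cotensorSubalgebra : Subalgebra k (Words h) where
  carrier := cotensor h
  mul_mem' := mul_mem_cotensor
  add_mem' := add_mem
  algebraMap_mem' c := by
    rw [Algebra.algebraMap_eq_smul_one]
    exact (cotensor h).smul_mem c (inB_mem 1)

end Words

/-- The cotensor coalgebra `T^c_B(M) = B ⊕ M ⊕ (M □ M) ⊕ ⋯` of a Hopf bimodule. -/
def CotensorHopf (h : HopfBimodule k B M) : Type _ := Words.cotensorSubalgebra h

namespace CotensorHopf

variable (h : HopfBimodule k B M)

instance : Ring (CotensorHopf h) := inferInstanceAs (Ring (Words.cotensorSubalgebra h))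
/-- The bialgebra structure of `T^c_B(M)`: its comultiplication is deconcatenation, and its
multiplication is the coalgebra map extending the multiplication of `B` and the actions of `B` on
`M`. -/
instance : Bialgebra k (CotensorHopf h) :=
  subBialgebra (Words.cotensorSubalgebra h) Words.comul_mem_cotensor

/-- The inclusion of `T^c_B(M)` in the space of words. -/
def val : CotensorHopf h →ₗ[k] Words h := (Words.cotensorSubalgebra h).val.toLinearMap

/-- The inclusion of `B` in degree zero. -/
def inB : B →ₗ[k] CotensorHopf h := (Words.inB h).codRestrict (Words.cotensor h) Words.inB_mem

/-- The inclusion of `M` in degree one. -/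
def inM : M →ₗ[k] CotensorHopf h := (Words.inM h).codRestrict (Words.cotensor h) Words.inM_mem

/-- The component of degree `n`: the `n`-th cotensor power. -/
def degree (n : ℕ) : Submodule k (CotensorHopf h) := (Words.degree h n).comap (val h)

end CotensorHopf

end WordsAlgebra

section OneType

variable {k : Type*} [Field k]
variable {B : Type*} [Ring B] [Bialgebra k B] {M : Type*} [AddCommGroup M] [Module k M]

namespace CotensorHopf

variable {h : HopfBimodule k B M}

theorem val_injective : Function.Injective (val h) := Subtype.val_injective

theorem map_val_injective : Function.Injective (TensorProduct.map (val h) (val h)) :=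
  TensorProduct.map_injective_of_flat_flat _ _ val_injective val_injective

theorem map_val_comul (x : CotensorHopf h) :
    TensorProduct.map (val h) (val h) (Coalgebra.comul x) = Words.comul h (val h x) :=
  map_subComul (Words.cotensorSubalgebra h).val.toLinearMap Subtype.val_injective
    Words.comul_mem_cotensor x

theorem comul_inB (b : B) : Coalgebra.comul (inB h b) =
    TensorProduct.map (inB h) (inB h) (Coalgebra.comul b) := by
  apply map_val_injective
  rw [map_val_comul, TensorProduct.map_map]
  exact Words.comul_inB h b

theorem words_comul_inM (m : M) : Words.comul h (Words.inM h m) =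
    TensorProduct.map (Words.inB h) (Words.inM h) (h.coactL m) +
      TensorProduct.map (Words.inM h) (Words.inB h) (h.coactR m) := by
  have e₂ : Words.comul h (Words.inM h m) =
      (Words.inB h ∘ₗ Words.toB h).lTensor _ (Words.comul h (Words.inM h m)) +
      (Words.pos h).lTensor _ (Words.comul h (Words.inM h m)) := by
    simp [LinearMap.lTensor_sub]
  have e₃ (z : M ⊗[k] B) : (Words.inB h ∘ₗ Words.toB h).lTensor _ (Words.comul h
      (TensorProduct.lift (Words.cons h) ((Words.inB h).lTensor M z))) =
      TensorProduct.map (TensorProduct.lift (Words.cons h) ∘ₗ (Words.inB h).lTensor M)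
        (Words.inB h) ((TensorProduct.assoc k _ _ _).symm (Coalgebra.comul.lTensor M z)) := by
    induction z with
    | zero => simp
    | add x y hx hy => simp only [map_add, hx, hy]
    | tmul m b =>
      simp only [LinearMap.lTensor_tmul, TensorProduct.lift.tmul, Words.comul_cons, map_add,
        Words.comul_inB]
      have z₁ (y : B ⊗[k] M) : (Words.inB h ∘ₗ Words.toB h).lTensor (Words h)
          (TensorProduct.map (Words.inB h) ((Words.cons h).flip (Words.inB h b)) y) = 0 := by
        induction y with
        | zero => simp
        | add x y hx hy => simp only [map_add, hx, hy, add_zero]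
        | tmul a b => simp
      rw [z₁, zero_add]
      induction Coalgebra.comul (R := k) b with
      | zero => simp
      | add x y hx hy => simp only [map_add, TensorProduct.tmul_add, hx, hy]
      | tmul a b => simp
  rw [e₂, Words.pos_comul_inM, add_comm]
  congr 1
  rw [Words.inM, LinearMap.comp_apply, LinearMap.comp_apply, e₃, ← h.coassocR,
    LinearEquiv.symm_apply_apply, LinearMap.map_rTensor]
  rfl

theorem comul_inM (m : M) : Coalgebra.comul (inM h m) =
    TensorProduct.map (inB h) (inM h) (h.coactL m) +
      TensorProduct.map (inM h) (inB h) (h.coactR m) := by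
  apply map_val_injective
  rw [map_val_comul, map_add, TensorProduct.map_map, TensorProduct.map_map]
  exact words_comul_inM m

variable (h) in
/-- The subalgebra of `T^c_B(M)` generated by `B` and `M`. -/
def oneType : Subalgebra k (CotensorHopf h) :=
  Algebra.adjoin k (Set.range (inB h) ∪ Set.range (inM h))

theorem comul_mem_oneType (s : oneType h) : Coalgebra.comul (s : CotensorHopf h) ∈
    LinearMap.range (TensorProduct.map (oneType h).val.toLinearMap
      (oneType h).val.toLinearMap) := by
  have hB (b : B) : inB h b ∈ oneType h := Algebra.subset_adjoin (Or.inl ⟨b, rfl⟩)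
  have hM (m : M) : inM h m ∈ oneType h := Algebra.subset_adjoin (Or.inr ⟨m, rfl⟩)
  set T := (Algebra.TensorProduct.map (oneType h).val (oneType h).val).range with hT
  have mem (a b : CotensorHopf h) (ha : a ∈ oneType h) (hb : b ∈ oneType h) : a ⊗ₜ[k] b ∈ T :=
    ⟨⟨a, ha⟩ ⊗ₜ ⟨b, hb⟩, by simp⟩
  have le : oneType h ≤ T.comap (Bialgebra.comulAlgHom k (CotensorHopf h)) := by
    refine Algebra.adjoin_le ?_
    rintro _ (⟨b, rfl⟩ | ⟨m, rfl⟩)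
    · change Coalgebra.comul (inB h b) ∈ T
      rw [comul_inB]
      induction Coalgebra.comul (R := k) b with
      | zero => simp
      | add x y hx hy => rw [map_add]; exact add_mem hx hy
      | tmul a b => exact mem _ _ (hB a) (hB b)
    · change Coalgebra.comul (inM h m) ∈ T
      rw [comul_inM]
      refine add_mem ?_ ?_
      · induction h.coactL m with
        | zero => simp
        | add x y hx hy => rw [map_add]; exact add_mem hx hy
        | tmul a b => exact mem _ _ (hB a) (hM b)
      · induction h.coactR m with
        | zero => simp
        | add x y hx hy => rw [map_add]; exact add_mem hx hy
        | tmul a b => exact mem _ _ (hM a) (hB b)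
  obtain ⟨z, hz⟩ := le s.2
  exact ⟨z, hz⟩

end CotensorHopf

/-- The one-type Hopf algebra `B[M]`: the subalgebra of `T^c_B(M)` generated by `B` and `M`. -/
def OneTypeHopf (h : HopfBimodule k B M) : Type _ := CotensorHopf.oneType h

namespace OneTypeHopf

variable (h : HopfBimodule k B M)

instance : Ring (OneTypeHopf h) := inferInstanceAs (Ring (CotensorHopf.oneType h))

/-- The bialgebra structure inherited from `T^c_B(M)`. -/
instance : Bialgebra k (OneTypeHopf h) :=
  subBialgebra (CotensorHopf.oneType h) CotensorHopf.comul_mem_oneType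

/-- The component of degree `n`. -/
def degree (n : ℕ) : Submodule k (OneTypeHopf h) :=
  (CotensorHopf.degree h n).comap (CotensorHopf.oneType h).val.toLinearMap

end OneTypeHopf

/-- Existence of an isomorphism of bialgebras that preserves the given gradings. -/
def GradedIso {H H' : Type*} [Ring H] [Bialgebra k H] [Ring H'] [Bialgebra k H']
    (𝒜 : ℕ → Submodule k H) (𝒜' : ℕ → Submodule k H') : Prop :=
  ∃ f : H ≃ₐc[k] H', ∀ n, (𝒜 n).map (f : H →ₗ[k] H') = 𝒜' n

end OneType

section GroupFun

set_option linter.unusedSectionVars false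

/-- The dual `(kG)^*` of the group algebra of a finite group: the functions `G → k` with pointwise
multiplication. -/
def GroupFun (k G : Type*) : Type _ := G → k

namespace GroupFun

variable {k G : Type*} [Field k] [Group G]

instance : CommRing (GroupFun k G) := inferInstanceAs (CommRing (G → k))
instance : Algebra k (GroupFun k G) := inferInstanceAs (Algebra k (G → k))

/-- Left translation: `(shift x f) y = f (x * y)`. -/
def shift (x : G) : GroupFun k G →ₐ[k] GroupFun k G where
  toFun f y := f (x * y)
  map_one' := rfl
  map_mul' _ _ := rfl
  map_zero' := rfl
  map_add' _ _ := rfl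
  commutes' _ := rfl

variable [DecidableEq G]

/-- The basis of `(kG)^*` dual to the basis `G` of `kG`. -/
def delta (g : G) : GroupFun k G := Pi.single g 1

theorem shift_delta (x g : G) : shift x (delta g : GroupFun k G) = delta (x⁻¹ * g) := by
  funext y
  change (Pi.single g 1 : G → k) (x * y) = (Pi.single (x⁻¹ * g) 1 : G → k) y
  simp only [Pi.single_apply, eq_inv_mul_iff_mul_eq]

theorem delta_mul_self (x : G) : (delta x * delta x : GroupFun k G) = delta x := by
  change ((Pi.single x 1 : G → k) * (Pi.single x 1 : G → k) : G → k) = Pi.single x 1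
  rw [← Pi.single_mul, mul_one]

theorem delta_mul_of_ne {x y : G} (h : x ≠ y) : (delta x * delta y : GroupFun k G) = 0 := by
  funext z
  change (Pi.single x 1 : G → k) z * (Pi.single y 1 : G → k) z = 0
  by_cases hx : z = x
  · subst hx; simp [h]
  · simp [hx]

variable [Fintype G]

theorem eq_sum (f : GroupFun k G) : f = ∑ x, f x • (delta x : GroupFun k G) := by
  have (f : G → k) : f = ∑ x, f x • (Pi.single x 1 : G → k) := by
    ext y
    simp [Finset.sum_apply, Pi.single_apply]
  exact this f

theorem sum_delta : ∑ x, (delta x : GroupFun k G) = 1 := by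
  rw [eq_sum (1 : GroupFun k G)]
  exact Finset.sum_congr rfl fun x _ ↦ (one_smul k _).symm

theorem hom_ext {V : Type*} [AddCommGroup V] [Module k V] {f g : GroupFun k G →ₗ[k] V}
    (h : ∀ x, f (delta x) = g (delta x)) : f = g := by
  refine LinearMap.ext fun a ↦ ?_
  rw [eq_sum a, map_sum, map_sum]
  exact Finset.sum_congr rfl fun x _ ↦ by rw [map_smul, map_smul, h]

/-- The comultiplication dual to the multiplication of `G`:
`Δ(f) = ∑ₓ δₓ ⊗ f(x ·)`, so that `Δ(δ_g) = ∑_{xy = g} δₓ ⊗ δ_y`. -/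
def comul : GroupFun k G →ₗ[k] GroupFun k G ⊗[k] GroupFun k G :=
  ∑ x, TensorProduct.mk k _ _ (delta x) ∘ₗ (shift x).toLinearMap

/-- Evaluation at the identity. -/
def counit : GroupFun k G →ₗ[k] k := (Pi.evalAlgHom k (fun _ : G ↦ k) 1).toLinearMap

theorem comul_apply (f : GroupFun k G) : comul f = ∑ x, delta x ⊗ₜ[k] shift x f := by
  simp [comul]

theorem counit_apply (f : GroupFun k G) : counit f = f 1 := rfl

theorem comul_delta (g : G) : comul (delta g : GroupFun k G) =
    ∑ x, (delta x : GroupFun k G) ⊗ₜ[k] (delta (x⁻¹ * g) : GroupFun k G) := by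
  simp only [comul_apply, shift_delta]

theorem counit_delta (g : G) : counit (delta g : GroupFun k G) = if g = 1 then 1 else 0 := by
  change (Pi.single g 1 : G → k) 1 = _
  simp only [Pi.single_apply, eq_comm]

instance : Coalgebra k (GroupFun k G) where
  comul := comul
  counit := counit
  coassoc := hom_ext fun g ↦ by
    simp only [LinearMap.comp_apply, comul_delta, map_sum, LinearMap.rTensor_tmul,
      LinearMap.lTensor_tmul, TensorProduct.sum_tmul, TensorProduct.tmul_sum, LinearEquiv.coe_coe,
      TensorProduct.assoc_tmul]
    rw [Finset.sum_comm]
    refine Finset.sum_congr rfl fun x _ ↦ ?_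
    refine Fintype.sum_equiv (Equiv.mulLeft x⁻¹) _ _ fun y ↦ ?_
    simp [mul_assoc]
  rTensor_counit_comp_comul := hom_ext fun g ↦ by
    simp only [LinearMap.comp_apply, comul_delta, map_sum, LinearMap.rTensor_tmul, counit_delta]
    rw [Finset.sum_eq_single 1 (fun b _ hb ↦ by simp [hb]) (by simp)]
    simp
  lTensor_counit_comp_comul := hom_ext fun g ↦ by
    simp only [LinearMap.comp_apply, comul_delta, map_sum, LinearMap.lTensor_tmul, counit_delta]
    rw [Finset.sum_eq_single g (fun b _ hb ↦ by simp [inv_mul_eq_one, hb]) (by simp)]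
    simp

theorem comul_def (f : GroupFun k G) : Coalgebra.comul (R := k) f =
    ∑ x, delta x ⊗ₜ[k] shift x f := comul_apply f

instance : Bialgebra k (GroupFun k G) := Bialgebra.mk' k (GroupFun k G)
  rfl (fun {_ _} ↦ rfl)
  (by
    simp only [comul_def, map_one]
    rw [← TensorProduct.sum_tmul, sum_delta, Algebra.TensorProduct.one_def])
  (fun {a b} ↦ by
    simp only [comul_def, map_mul, Finset.sum_mul, Finset.mul_sum,
      Algebra.TensorProduct.tmul_mul_tmul]
    refine Finset.sum_congr rfl fun x _ ↦ ?_
    rw [Finset.sum_eq_single x (fun y _ hy ↦ by rw [delta_mul_of_ne hy, TensorProduct.zero_tmul])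
      (by simp), delta_mul_self])

end GroupFun
end GroupFun

section RSR

/-- A ramification system with irreducible representations of a group `G`. For each conjugacy class
`C`, the representations `ρ C i` for `i : I C` are irreducible right representations of the
centralizer of `u C`, on a space with basis indexed by `J C i`. The ramification is
`r_C = ∑ i, |J C i|`, and `I C` is empty when `r_C = 0`. -/
structure RSR (k G : Type*) [Field k] [Group G] where
  u : ConjClasses G → G
  mk_u : ∀ C, ConjClasses.mk (u C) = C
  I : ConjClasses G → Type*
  J : ∀ C, I C → Type*
  finite_J : ∀ C i, Finite (J C i)
  ρ : ∀ C i, Representation k (Subgroup.centralizer {u C})ᵐᵒᵖ (J C i →₀ k)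
  irreducible : ∀ C i, (ρ C i).IsIrreducible

variable {k : Type*} [Field k] {G' G : Type*} [Group G'] [Group G]

/-- The map `z ↦ φ (c⁻¹ z c)` between the centralizers of `u` and of `u' = φ (c⁻¹ u c)`. -/
def centralizerHom (φ : G ≃* G') (c u : G) (u' : G') (hu : φ (c⁻¹ * u * c) = u') :
    Subgroup.centralizer {u} →* Subgroup.centralizer {u'} where
  toFun z := ⟨φ (c⁻¹ * z * c), by
    have hz : u * z = z * u := Subgroup.mem_centralizer_singleton_iff.mp z.2 |>.symm
    rw [Subgroup.mem_centralizer_singleton_iff, ← hu, ← map_mul, ← map_mul]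
    congr 1
    calc c⁻¹ * z * c * (c⁻¹ * u * c) = c⁻¹ * (z * u) * c := by group
      _ = c⁻¹ * (u * z) * c := by rw [hz]
      _ = c⁻¹ * u * c * (c⁻¹ * z * c) := by group⟩
  map_one' := by ext; simp
  map_mul' a b := by
    ext
    simp only [Subgroup.coe_mul, ← map_mul]
    congr 1
    group

/-- Isomorphism of ramification systems with irreducible representations. -/
def RSR.IsIso (R : RSR k G) (R' : RSR k G') : Prop :=
  ∃ φ : G ≃* G', ∀ C : ConjClasses G,
    ∃ (c : G) (hc : φ (c⁻¹ * R.u C * c) = R'.u (C.map φ.toMonoidHom)),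
      ∃ e : R.I C ≃ R'.I (C.map φ.toMonoidHom), ∀ i : R.I C,
        Nonempty ((R.ρ C i).Equiv
          ((R'.ρ (C.map φ.toMonoidHom) (e i)).comp (centralizerHom φ c _ _ hc).op))

/-- A choice of representatives of the cosets `Z_{u(C)} g`. As these correspond to the elements
`d = g⁻¹ u(C) g` of `C`, a representative `g` is chosen for each element `d` of `G`. -/
structure RSR.CosetReps (R : RSR k G) where
  rep : G → G
  rep_spec : ∀ d, (rep d)⁻¹ * R.u (ConjClasses.mk d) * rep d = d
  rep_u : ∀ C, rep (R.u C) = 1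

namespace RSR

variable {R : RSR k G}

/-- The element `ζ` of the centralizer of `u C` with `g h = ζ g'`, where `g` and `g'` are the
representatives that belong to the elements `d` and `h⁻¹ d h` of `C`. -/
def CosetReps.zeta (t : R.CosetReps) (C : ConjClasses G) (d : G) (hd : ConjClasses.mk d = C)
    (h : G) : Subgroup.centralizer {R.u C} :=
  ⟨t.rep d * h * (t.rep (h⁻¹ * d * h))⁻¹, by
    have hd' : ConjClasses.mk (h⁻¹ * d * h) = C := by
      rw [← hd, ConjClasses.mk_eq_mk_iff_isConj, isConj_comm, isConj_iff]
      exact ⟨h⁻¹, by simp⟩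
    have h₁ := t.rep_spec d
    have h₂ := t.rep_spec (h⁻¹ * d * h)
    rw [hd] at h₁
    rw [hd'] at h₂
    rw [Subgroup.mem_centralizer_singleton_iff]
    generalize t.rep (h⁻¹ * d * h) = g' at *
    generalize t.rep d = g at *
    generalize R.u C = u at *
    subst h₁
    have h₃ : u = g' * (h⁻¹ * (g⁻¹ * u * g) * h) * g'⁻¹ := by rw [← h₂]; group
    calc g * h * g'⁻¹ * u = g * h * g'⁻¹ * (g' * (h⁻¹ * (g⁻¹ * u * g) * h) * g'⁻¹) := by rw [← h₃]
      _ = u * (g * h * g'⁻¹) := by group⟩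

theorem CosetReps.zeta_one (t : R.CosetReps) (C : ConjClasses G) (d : G)
    (hd : ConjClasses.mk d = C) : t.zeta C d hd 1 = 1 := by
  ext; simp [zeta]

theorem CosetReps.zeta_mul (t : R.CosetReps) (C : ConjClasses G) (d d' : G)
    (hd : ConjClasses.mk d = C) (hd' : ConjClasses.mk d' = C) (h h' : G) (e : d' = h⁻¹ * d * h) :
    t.zeta C d hd (h * h') = t.zeta C d hd h * t.zeta C d' hd' h' := by
  subst e
  ext; simp [zeta, mul_assoc]

variable (R) in
/-- The arrows of the Hopf quiver: the arrows from `x` to `y` are indexed by the pairs `(i, j)`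
with `i : I C` and `j : J C i`, where `C` is the class of `x⁻¹ y`. -/
structure Arrow where
  src : G
  tgt : G
  cls : ConjClasses G
  mk_eq : ConjClasses.mk (src⁻¹ * tgt) = cls
  i : R.I cls
  j : R.J cls i

/-- The linear map that sends the basis vector `j` to the arrow `(i, j)` from `x` to `y`. -/
def emb (x y : G) (C : ConjClasses G) (hC : ConjClasses.mk (x⁻¹ * y) = C) (i : R.I C) :
    (R.J C i →₀ k) →ₗ[k] (R.Arrow →₀ k) :=
  Finsupp.lmapDomain k k fun j ↦ ⟨x, y, C, hC, i, j⟩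

theorem emb_congr {x x' y y' : G} {C : ConjClasses G} {hC : ConjClasses.mk (x⁻¹ * y) = C}
    {hC' : ConjClasses.mk (x'⁻¹ * y') = C} {i : R.I C} {v v' : R.J C i →₀ k}
    (hx : x = x') (hy : y = y') (hv : v = v') : emb x y C hC i v = emb x' y' C hC' i v' := by
  subst hx hy hv; rfl

@[simp] theorem emb_single (x y : G) (C : ConjClasses G) (hC : ConjClasses.mk (x⁻¹ * y) = C)
    (i : R.I C) (j : R.J C i) (c : k) :
    emb x y C hC i (Finsupp.single j c) = Finsupp.single ⟨x, y, C, hC, i, j⟩ c := by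
  simp [emb]

theorem emb_ext {V : Type*} [AddCommMonoid V] [Module k V] {f g : (R.Arrow →₀ k) →ₗ[k] V}
    (h : ∀ x y C hC i v, f (emb x y C hC i v) = g (emb x y C hC i v)) : f = g := by
  refine Finsupp.lhom_ext fun a c ↦ ?_
  have := h a.src a.tgt a.cls a.mk_eq a.i (Finsupp.single a.j c)
  rwa [emb_single] at this

/-- A map on the span of the arrows that is given on the arrows from `x` to `y` of class `C` with
index `i` by a linear map on the space of `ρ C i`. -/
def blockMap (p q : G → G) (hpq : ∀ x y, ConjClasses.mk ((p x)⁻¹ * q y) = ConjClasses.mk (x⁻¹ * y))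
    (F : ∀ (x y : G) (C : ConjClasses G) (_ : ConjClasses.mk (x⁻¹ * y) = C) (i : R.I C),
      (R.J C i →₀ k) →ₗ[k] (R.J C i →₀ k)) : (R.Arrow →₀ k) →ₗ[k] (R.Arrow →₀ k) :=
  Finsupp.linearCombination k fun a ↦ emb (p a.src) (q a.tgt) a.cls ((hpq _ _).trans a.mk_eq) a.i
    (F a.src a.tgt a.cls a.mk_eq a.i (Finsupp.single a.j 1))

theorem blockMap_emb (p q : G → G)
    (hpq : ∀ x y, ConjClasses.mk ((p x)⁻¹ * q y) = ConjClasses.mk (x⁻¹ * y))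
    (F : ∀ (x y : G) (C : ConjClasses G) (_ : ConjClasses.mk (x⁻¹ * y) = C) (i : R.I C),
      (R.J C i →₀ k) →ₗ[k] (R.J C i →₀ k)) (x y C hC) (i : R.I C) (v) :
    blockMap p q hpq F (emb x y C hC i v) =
      emb (p x) (q y) C ((hpq _ _).trans hC) i (F x y C hC i v) := by
  refine LinearMap.congr_fun (f := blockMap p q hpq F ∘ₗ emb x y C hC i)
    (g := emb (p x) (q y) C ((hpq _ _).trans hC) i ∘ₗ F x y C hC i) ?_ v
  refine Finsupp.lhom_ext fun j c ↦ ?_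
  simp only [LinearMap.comp_apply, emb_single, blockMap, Finsupp.linearCombination_single]
  rw [← map_smul, ← map_smul, Finsupp.smul_single, smul_eq_mul, mul_one]

theorem mk_mulLeft (g x y : G) :
    ConjClasses.mk ((g * x)⁻¹ * (g * y)) = ConjClasses.mk (x⁻¹ * y) := by
  congr 1; group

theorem mk_mulRight (g x y : G) :
    ConjClasses.mk ((x * g)⁻¹ * (y * g)) = ConjClasses.mk (x⁻¹ * y) := by
  rw [ConjClasses.mk_eq_mk_iff_isConj, isConj_iff]
  exact ⟨g, by group⟩

/-- The left translation by `g` on arrows. -/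
def mulL (g : G) : Module.End k (R.Arrow →₀ k) :=
  blockMap (g * ·) (g * ·) (mk_mulLeft g) fun _ _ _ _ _ ↦ LinearMap.id

/-- The right translation by `g` on arrows, twisted by the representations `ρ`. -/
def mulR (t : R.CosetReps) (g : G) : Module.End k (R.Arrow →₀ k) :=
  blockMap (· * g) (· * g) (mk_mulRight g) fun x y C hC i ↦
    R.ρ C i (MulOpposite.op (t.zeta C (x⁻¹ * y) hC g))

theorem mulL_emb (g x y : G) (C hC) (i : R.I C) (v) : mulL g (emb x y C hC i v) =
    emb (g * x) (g * y) C ((mk_mulLeft g x y).trans hC) i v := blockMap_emb ..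

theorem mulR_emb (t : R.CosetReps) (g x y : G) (C hC) (i : R.I C) (v) :
    mulR t g (emb x y C hC i v) = emb (x * g) (y * g) C ((mk_mulRight g x y).trans hC) i
      (R.ρ C i (MulOpposite.op (t.zeta C (x⁻¹ * y) hC g)) v) := blockMap_emb ..

variable (R) in
/-- The left action of `G` on the span of the arrows. -/
def leftHom : G →* Module.End k (R.Arrow →₀ k) where
  toFun := mulL
  map_one' := emb_ext fun x y C hC i v ↦ by
    rw [mulL_emb]; exact emb_congr (one_mul x) (one_mul y) rfl
  map_mul' g g' := emb_ext fun x y C hC i v ↦ by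
    rw [Module.End.mul_apply, mulL_emb, mulL_emb, mulL_emb]
    exact emb_congr (mul_assoc ..) (mul_assoc ..) rfl

/-- The right action of `G` on the span of the arrows. -/
def rightHom (t : R.CosetReps) : G →* (Module.End k (R.Arrow →₀ k))ᵐᵒᵖ where
  toFun g := MulOpposite.op (mulR t g)
  map_one' := MulOpposite.unop_injective <| emb_ext fun x y C hC i v ↦ by
    rw [MulOpposite.unop_op, mulR_emb, t.zeta_one]
    exact emb_congr (mul_one x) (mul_one y) (by simp)
  map_mul' g g' := MulOpposite.unop_injective <| emb_ext fun x y C hC i v ↦ by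
    rw [MulOpposite.unop_mul, Module.End.mul_apply, MulOpposite.unop_op, MulOpposite.unop_op,
      MulOpposite.unop_op, mulR_emb, mulR_emb, mulR_emb]
    refine emb_congr (mul_assoc ..).symm (mul_assoc ..).symm ?_
    rw [t.zeta_mul C _ ((x * g)⁻¹ * (y * g)) hC ((mk_mulRight g x y).trans hC) _ _ (by group),
      MulOpposite.op_mul, map_mul, Module.End.mul_apply]

variable (R) in
/-- The left coaction `a ↦ t(a) ⊗ a` of `kG`. -/
def coactTgt : (R.Arrow →₀ k) →ₗ[k] MonoidAlgebra k G ⊗[k] (R.Arrow →₀ k) :=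
  Finsupp.linearCombination k fun a ↦ MonoidAlgebra.single a.tgt 1 ⊗ₜ Finsupp.single a 1

variable (R) in
/-- The right coaction `a ↦ a ⊗ s(a)` of `kG`. -/
def coactSrc : (R.Arrow →₀ k) →ₗ[k] (R.Arrow →₀ k) ⊗[k] MonoidAlgebra k G :=
  Finsupp.linearCombination k fun a ↦ Finsupp.single a 1 ⊗ₜ MonoidAlgebra.single a.src 1

theorem coactTgt_emb (x y : G) (C hC) (i : R.I C) (v) : R.coactTgt (emb x y C hC i v) =
    MonoidAlgebra.single y 1 ⊗ₜ emb x y C hC i v := by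
  refine LinearMap.congr_fun (f := R.coactTgt ∘ₗ emb x y C hC i)
    (g := TensorProduct.mk k _ _ (MonoidAlgebra.single y 1) ∘ₗ emb x y C hC i) ?_ v
  refine Finsupp.lhom_ext fun j c ↦ ?_
  simp only [LinearMap.comp_apply, emb_single, coactTgt, Finsupp.linearCombination_single,
    TensorProduct.mk_apply]
  rw [← TensorProduct.tmul_smul, Finsupp.smul_single, smul_eq_mul, mul_one]

theorem coactSrc_emb (x y : G) (C hC) (i : R.I C) (v) : R.coactSrc (emb x y C hC i v) =
    emb x y C hC i v ⊗ₜ MonoidAlgebra.single x 1 := by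
  refine LinearMap.congr_fun (f := R.coactSrc ∘ₗ emb x y C hC i)
    (g := (TensorProduct.mk k _ _).flip (MonoidAlgebra.single x 1) ∘ₗ emb x y C hC i) ?_ v
  refine Finsupp.lhom_ext fun j c ↦ ?_
  simp only [LinearMap.comp_apply, emb_single, coactSrc, Finsupp.linearCombination_single,
    LinearMap.flip_apply, TensorProduct.mk_apply]
  rw [TensorProduct.smul_tmul', Finsupp.smul_single, smul_eq_mul, mul_one]

theorem bilin_ext {V : Type*} [AddCommMonoid V] [Module k V]
    {f g : MonoidAlgebra k G →ₗ[k] (R.Arrow →₀ k) →ₗ[k] V}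
    (h : ∀ z x y C hC i v, f (MonoidAlgebra.single z 1) (emb x y C hC i v) =
      g (MonoidAlgebra.single z 1) (emb x y C hC i v)) (b m) : f b m = g b m := by
  have : f = g := MonoidAlgebra.lhom_ext' fun z ↦ LinearMap.ext_ring <| emb_ext fun x y C hC i v ↦
    h z x y C hC i v
  rw [this]

/-- The left action of `kG`. -/
def actL (R : RSR k G) : MonoidAlgebra k G →ₗ[k] Module.End k (R.Arrow →₀ k) :=
  (MonoidAlgebra.lift k _ G R.leftHom).toLinearMap

/-- The right action of `kG`. -/
def actR (t : R.CosetReps) : MonoidAlgebra k G →ₗ[k] Module.End k (R.Arrow →₀ k) :=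
  (MulOpposite.opLinearEquiv k).symm.toLinearMap ∘ₗ
    (MonoidAlgebra.lift k _ G (rightHom t)).toLinearMap

@[simp] theorem actL_single (z : G) (m) : R.actL (MonoidAlgebra.single z 1) m = mulL z m := by
  simp [actL, leftHom]

@[simp] theorem actR_single (t : R.CosetReps) (z : G) (m) :
    actR t (MonoidAlgebra.single z 1) m = mulR t z m := by
  simp [actR, rightHom]

theorem mulL_mulR (t : R.CosetReps) (g g' : G) (m : R.Arrow →₀ k) :
    mulR t g' (mulL g m) = mulL g (mulR t g' m) := by
  refine LinearMap.congr_fun (f := mulR t g' ∘ₗ mulL g) (g := mulL g ∘ₗ mulR t g') ?_ m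
  refine emb_ext fun x y C hC i v ↦ ?_
  simp only [LinearMap.comp_apply, mulR_emb, mulL_emb]
  refine emb_congr (mul_assoc ..) (mul_assoc ..) ?_
  congr 3
  simp [CosetReps.zeta, mul_assoc]

/-- The Hopf bimodule `(kQ₁ᶜ, G, r, ρ, u)` over `kG` on the span of the arrows. -/
def coarrow (t : R.CosetReps) : HopfBimodule k (MonoidAlgebra k G) (R.Arrow →₀ k) where
  actL := R.actL
  actR := (actR t).flip
  coactL := R.coactTgt
  coactR := R.coactSrc
  one_actL m := by simp [actL]
  mul_actL a b m := by simp [actL]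
  actR_one m := by simp [actR]
  actR_mul m a b := by simp [actR]
  actL_actR a m b := by
    refine LinearMap.congr_fun (f := (actR t).flip (R.actL a m))
      (g := R.actL a ∘ₗ (actR t).flip m) (MonoidAlgebra.lhom_ext' fun z ↦ LinearMap.ext_ring ?_) b
    refine bilin_ext (f := R.actL.compr₂ (actR t (MonoidAlgebra.single z 1)))
      (g := R.actL.compl₂ (actR t (MonoidAlgebra.single z 1))) ?_ a m
    intro z' x y C hC i v
    simp [mulL_mulR]
  coassocL m := by
    refine LinearMap.congr_fun (f := (TensorProduct.assoc k _ _ _).toLinearMap ∘ₗ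
      Coalgebra.comul.rTensor _ ∘ₗ R.coactTgt) (g := R.coactTgt.lTensor _ ∘ₗ R.coactTgt) ?_ m
    refine emb_ext fun x y C hC i v ↦ ?_
    simp [coactTgt_emb]
  counitL m := by
    refine LinearMap.congr_fun (f := Coalgebra.counit.rTensor _ ∘ₗ R.coactTgt)
      (g := TensorProduct.mk k k _ 1) ?_ m
    refine emb_ext fun x y C hC i v ↦ ?_
    simp [coactTgt_emb]
  coassocR m := by
    refine LinearMap.congr_fun (f := (TensorProduct.assoc k _ _ _).toLinearMap ∘ₗ
      R.coactSrc.rTensor _ ∘ₗ R.coactSrc) (g := Coalgebra.comul.lTensor _ ∘ₗ R.coactSrc) ?_ m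
    refine emb_ext fun x y C hC i v ↦ ?_
    simp [coactSrc_emb]
  counitR m := by
    refine LinearMap.congr_fun (f := Coalgebra.counit.lTensor _ ∘ₗ R.coactSrc)
      (g := (TensorProduct.mk k _ k).flip 1) ?_ m
    refine emb_ext fun x y C hC i v ↦ ?_
    simp [coactSrc_emb]
  coactL_coactR m := by
    refine LinearMap.congr_fun (f := (TensorProduct.assoc k _ _ _).toLinearMap ∘ₗ
      R.coactTgt.rTensor _ ∘ₗ R.coactSrc) (g := R.coactSrc.lTensor _ ∘ₗ R.coactTgt) ?_ m
    refine emb_ext fun x y C hC i v ↦ ?_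
    simp [coactSrc_emb, coactTgt_emb]
  coactL_actL b m := by
    refine bilin_ext (f := R.actL.compr₂ R.coactTgt) (g := (TensorProduct.map₂
      (LinearMap.mul k (MonoidAlgebra k G)) R.actL).compl₁₂ Coalgebra.comul R.coactTgt) ?_ b m
    intro z x y C hC i v
    simp [coactTgt_emb, mulL_emb]
  coactL_actR m b := by
    refine bilin_ext (f := (actR t).compr₂ R.coactTgt) (g := ((TensorProduct.map₂
      (LinearMap.mul k (MonoidAlgebra k G)) (actR t).flip).compl₁₂
        R.coactTgt Coalgebra.comul).flip) ?_ b m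
    intro z x y C hC i v
    simp [coactTgt_emb, mulR_emb]
  coactR_actL b m := by
    refine bilin_ext (f := R.actL.compr₂ R.coactSrc) (g := (TensorProduct.map₂ R.actL
      (LinearMap.mul k (MonoidAlgebra k G))).compl₁₂ Coalgebra.comul R.coactSrc) ?_ b m
    intro z x y C hC i v
    simp [coactSrc_emb, mulL_emb]
  coactR_actR m b := by
    refine bilin_ext (f := (actR t).compr₂ R.coactSrc) (g := ((TensorProduct.map₂
      (actR t).flip (LinearMap.mul k (MonoidAlgebra k G))).compl₁₂
        R.coactSrc Coalgebra.comul).flip) ?_ b m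
    intro z x y C hC i v
    simp [coactSrc_emb, mulR_emb]

end RSR
end RSR

section ArrowBimodule

set_option linter.unusedSectionVars false

namespace GroupFun

variable {k G : Type*} [Field k] [Group G] [DecidableEq G]

/-- Evaluation at `x`. -/
def eval (x : G) : GroupFun k G →ₗ[k] k := (Pi.evalAlgHom k (fun _ : G ↦ k) x).toLinearMap

theorem mul_delta (f : GroupFun k G) (g : G) : f * delta g = eval g f • (delta g : GroupFun k G) := by
  funext y
  change f y * (Pi.single g 1 : G → k) y = f g * (Pi.single g 1 : G → k) y
  by_cases h : y = g
  · rw [h]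
  · simp [h]

theorem eval_shift (x y : G) (f : GroupFun k G) : eval y (shift x f) = eval (x * y) f := rfl

theorem eval_delta (x y : G) : eval y (delta x : GroupFun k G) = if x = y then 1 else 0 := by
  change (Pi.single x 1 : G → k) y = _
  simp only [Pi.single_apply, eq_comm]

end GroupFun

variable {k : Type*} [Field k]

/-- The transpose of a linear map with respect to the standard basis. -/
def transpose {J : Type*} [Finite J] (f : Module.End k (J →₀ k)) : Module.End k (J →₀ k) :=
  Finsupp.linearCombination k fun j ↦
    Finsupp.equivFunOnFinite.symm fun s ↦ f (Finsupp.single s 1) j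

theorem transpose_single {J : Type*} [Finite J] (f : Module.End k (J →₀ k)) (s j : J) :
    transpose f (Finsupp.single j 1) s = f (Finsupp.single s 1) j := by
  simp [transpose]

theorem transpose_one {J : Type*} [Finite J] : transpose (1 : Module.End k (J →₀ k)) = 1 := by
  refine Finsupp.lhom_ext' fun j ↦ LinearMap.ext_ring (Finsupp.ext fun s ↦ ?_)
  classical
  simp [transpose_single, Finsupp.single_apply, eq_comm]

theorem apply_eq_sum {J : Type*} [Fintype J] (f : Module.End k (J →₀ k)) (v : J →₀ k) (s : J) :
    f v s = ∑ j, v j * f (Finsupp.single j 1) s := by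
  have : v = ∑ j, v j • Finsupp.single j (1 : k) := by
    ext j
    classical
    simp
  calc f v s = f (∑ j, v j • Finsupp.single j (1 : k)) s := by rw [← this]
    _ = _ := by simp only [map_sum, map_smul, Finsupp.finsetSum_apply, Finsupp.smul_apply,
      smul_eq_mul]

theorem transpose_mul {J : Type*} [Finite J] (f g : Module.End k (J →₀ k)) :
    transpose (f * g) = transpose g * transpose f := by
  cases nonempty_fintype J
  refine Finsupp.lhom_ext' fun j ↦ LinearMap.ext_ring (Finsupp.ext fun s ↦ ?_)
  simp only [LinearMap.comp_apply, Finsupp.lsingle_apply, Module.End.mul_apply, transpose_single]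
  rw [apply_eq_sum, apply_eq_sum]
  exact Finset.sum_congr rfl fun i _ ↦ by rw [transpose_single, transpose_single, mul_comm]

namespace RSR

variable {G : Type*} [Group G] {R : RSR k G}

attribute [instance] RSR.finite_J

/-- The transpose of the right translation by `g` with respect to the basis of arrows. -/
def mulT (t : R.CosetReps) (g : G) : Module.End k (R.Arrow →₀ k) :=
  blockMap (· * g⁻¹) (· * g⁻¹) (mk_mulRight g⁻¹) fun x y C hC i ↦
    transpose (R.ρ C i (MulOpposite.op (t.zeta C ((x * g⁻¹)⁻¹ * (y * g⁻¹))
      ((mk_mulRight g⁻¹ x y).trans hC) g)))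

theorem mulT_emb (t : R.CosetReps) (g x y : G) (C hC) (i : R.I C) (v) :
    mulT t g (emb x y C hC i v) = emb (x * g⁻¹) (y * g⁻¹) C ((mk_mulRight g⁻¹ x y).trans hC) i
      (transpose (R.ρ C i (MulOpposite.op (t.zeta C ((x * g⁻¹)⁻¹ * (y * g⁻¹))
        ((mk_mulRight g⁻¹ x y).trans hC) g))) v) := blockMap_emb ..

theorem mulT_one (t : R.CosetReps) (m) : mulT t 1 m = m := by
  refine LinearMap.congr_fun (f := mulT t 1) (g := LinearMap.id) (emb_ext fun x y C hC i v ↦ ?_) m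
  rw [mulT_emb, t.zeta_one]
  refine emb_congr (by simp) (by simp) ?_
  rw [MulOpposite.op_one, map_one, transpose_one]
  rfl

theorem mulT_mulT (t : R.CosetReps) (g h : G) (m) : mulT t g (mulT t h m) = mulT t (g * h) m := by
  refine LinearMap.congr_fun (f := mulT t g ∘ₗ mulT t h) (g := mulT t (g * h))
    (emb_ext fun x y C hC i v ↦ ?_) m
  rw [LinearMap.comp_apply, mulT_emb, mulT_emb, mulT_emb]
  refine emb_congr (by group) (by group) ?_
  rw [← Module.End.mul_apply, ← transpose_mul, ← map_mul, ← MulOpposite.op_mul]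
  congr 4
  ext
  simp [CosetReps.zeta, mul_assoc]

theorem mulT_mulL (t : R.CosetReps) (g h : G) (m : R.Arrow →₀ k) :
    mulT t g (mulL h m) = mulL h (mulT t g m) := by
  refine LinearMap.congr_fun (f := mulT t g ∘ₗ mulL h) (g := mulL h ∘ₗ mulT t g)
    (emb_ext fun x y C hC i v ↦ ?_) m
  simp only [LinearMap.comp_apply, mulT_emb, mulL_emb]
  refine emb_congr (by group) (by group) ?_
  congr 4
  simp [CosetReps.zeta, mul_assoc]

/-- The action `f ⊗ a ↦ f(p(a)) a` of functions on arrows. -/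
def funAct (p : R.Arrow → G) : (R.Arrow →₀ k) →ₗ[k] GroupFun k G →ₗ[k] (R.Arrow →₀ k) :=
  Finsupp.linearCombination k fun a ↦ (GroupFun.eval (p a)).smulRight (Finsupp.single a 1)

theorem funAct_emb (p : R.Arrow → G) (z : G) (x y : G) (C hC) (i : R.I C) (v) (f : GroupFun k G)
    (hp : ∀ j, p ⟨x, y, C, hC, i, j⟩ = z) :
    funAct p (emb x y C hC i v) f = GroupFun.eval z f • emb x y C hC i v := by
  refine LinearMap.congr_fun (f := (funAct p).flip f ∘ₗ emb x y C hC i)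
    (g := GroupFun.eval z f • emb x y C hC i) ?_ v
  refine Finsupp.lhom_ext fun j c ↦ ?_
  simp [funAct, hp, mul_comm]

theorem funAct_tgt (x y : G) (C hC) (i : R.I C) (v) (f : GroupFun k G) :
    funAct Arrow.tgt (emb x y C hC i v) f = GroupFun.eval y f • emb x y C hC i v :=
  funAct_emb _ _ _ _ _ _ _ _ _ fun _ ↦ rfl

theorem funAct_src (x y : G) (C hC) (i : R.I C) (v) (f : GroupFun k G) :
    funAct Arrow.src (emb x y C hC i v) f = GroupFun.eval x f • emb x y C hC i v :=
  funAct_emb _ _ _ _ _ _ _ _ _ fun _ ↦ rfl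

variable [DecidableEq G] [Fintype G]

variable (R) in
/-- The left coaction `a ↦ ∑_g δ_g ⊗ g⁻¹ a` of `(kG)^*`, dual to the left action of `kG`. -/
def coactFunL : (R.Arrow →₀ k) →ₗ[k] GroupFun k G ⊗[k] (R.Arrow →₀ k) :=
  ∑ g : G, TensorProduct.mk k _ _ (GroupFun.delta g) ∘ₗ mulL g⁻¹

/-- The right coaction of `(kG)^*`, dual to the right action of `kG`. -/
def coactFunR (t : R.CosetReps) : (R.Arrow →₀ k) →ₗ[k] (R.Arrow →₀ k) ⊗[k] GroupFun k G :=
  ∑ g : G, (TensorProduct.mk k _ _).flip (GroupFun.delta g) ∘ₗ mulT t g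

theorem coactFunL_apply (m) : R.coactFunL m = ∑ g : G, GroupFun.delta g ⊗ₜ mulL g⁻¹ m := by
  simp [coactFunL]

theorem coactFunR_apply (t : R.CosetReps) (m) :
    coactFunR t m = ∑ g : G, mulT t g m ⊗ₜ GroupFun.delta g := by
  simp [coactFunR]

theorem mulL_mulL (g h : G) (m : R.Arrow →₀ k) : mulL g (mulL h m) = mulL (g * h) m :=
  (LinearMap.congr_fun (R.leftHom.map_mul g h) m).symm

theorem mulL_one (m : R.Arrow →₀ k) : mulL 1 m = m :=
  LinearMap.congr_fun R.leftHom.map_one m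

theorem emb_induction {P : (R.Arrow →₀ k) → Prop} (h0 : P 0) (ha : ∀ x y, P x → P y → P (x + y))
    (h : ∀ x y C hC i v, P (emb x y C hC i v)) (m) : P m := by
  induction m using Finsupp.induction_linear with
  | zero => exact h0
  | add f g hf hg => exact ha f g hf hg
  | single a c =>
    have := h a.src a.tgt a.cls a.mk_eq a.i (Finsupp.single a.j c)
    rwa [emb_single] at this

/-- The Hopf bimodule `(kQ₁ᵃ, G, r, ρ, u)` over `(kG)^*` on the span of the arrows, dual to the
Hopf bimodule `(kQ₁ᶜ, G, r, ρ, u)` over `kG`. -/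
def arrow (t : R.CosetReps) : HopfBimodule k (GroupFun k G) (R.Arrow →₀ k) where
  actL := (funAct Arrow.tgt).flip
  actR := funAct Arrow.src
  coactL := R.coactFunL
  coactR := coactFunR t
  one_actL m := by
    induction m using emb_induction with
    | h0 => simp
    | ha x y hx hy => rw [map_add, hx, hy]
    | h x y C hC i v => rw [LinearMap.flip_apply, funAct_tgt]; exact one_smul _ _
  mul_actL a b m := by
    induction m using emb_induction with
    | h0 => simp
    | ha x y hx hy => simp only [map_add, hx, hy]
    | h x y C hC i v =>
      simp only [LinearMap.flip_apply, funAct_tgt, map_smul]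
      rw [smul_smul, mul_comm]; rfl
  actR_one m := by
    induction m using emb_induction with
    | h0 => simp
    | ha x y hx hy => rw [map_add, LinearMap.add_apply, hx, hy]
    | h x y C hC i v => rw [funAct_src]; exact one_smul _ _
  actR_mul m a b := by
    induction m using emb_induction with
    | h0 => simp
    | ha x y hx hy => simp only [map_add, LinearMap.add_apply, hx, hy]
    | h x y C hC i v =>
      simp only [funAct_src, map_smul, LinearMap.smul_apply]
      rw [smul_smul]; rfl
  actL_actR a m b := by
    induction m using emb_induction with
    | h0 => simp
    | ha x y hx hy => simp only [map_add, LinearMap.add_apply, hx, hy]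
    | h x y C hC i v =>
      simp only [LinearMap.flip_apply, funAct_src,
        funAct_tgt, map_smul, LinearMap.smul_apply]
      rw [smul_comm]
  coassocL m := by
    simp only [coactFunL_apply, map_sum, LinearMap.rTensor_tmul, LinearMap.lTensor_tmul,
      GroupFun.comul_def, TensorProduct.sum_tmul, TensorProduct.tmul_sum, TensorProduct.assoc_tmul,
      GroupFun.shift_delta, mulL_mulL]
    rw [Finset.sum_comm]
    refine Finset.sum_congr rfl fun x _ ↦ ?_
    refine Fintype.sum_equiv (Equiv.mulLeft x⁻¹) _ _ fun y ↦ ?_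
    simp
  counitL m := by
    simp only [coactFunL_apply, map_sum, LinearMap.rTensor_tmul]
    rw [Finset.sum_eq_single 1 (fun b _ hb ↦ by
      rw [show Coalgebra.counit (R := k) (GroupFun.delta b : GroupFun k G) = _ from
        GroupFun.counit_delta b]; simp [hb]) (by simp)]
    rw [show Coalgebra.counit (R := k) (GroupFun.delta (1 : G) : GroupFun k G) = _ from
        GroupFun.counit_delta 1]
    simp [mulL_one]
  coassocR m := by
    simp only [coactFunR_apply, map_sum, LinearMap.rTensor_tmul, LinearMap.lTensor_tmul,
      GroupFun.comul_def, TensorProduct.sum_tmul, TensorProduct.tmul_sum, TensorProduct.assoc_tmul,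
      GroupFun.shift_delta, mulT_mulT]
    rw [Finset.sum_comm, Finset.sum_comm (f := fun (x y : G) ↦ mulT t x m ⊗ₜ[k] _)]
    refine Finset.sum_congr rfl fun x _ ↦ ?_
    refine Fintype.sum_equiv (Equiv.mulLeft x) _ _ fun y ↦ ?_
    simp
  counitR m := by
    simp only [coactFunR_apply, map_sum, LinearMap.lTensor_tmul]
    rw [Finset.sum_eq_single 1 (fun b _ hb ↦ by
      rw [show Coalgebra.counit (R := k) (GroupFun.delta b : GroupFun k G) = _ from
        GroupFun.counit_delta b]; simp [hb]) (by simp)]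
    rw [show Coalgebra.counit (R := k) (GroupFun.delta (1 : G) : GroupFun k G) = _ from
        GroupFun.counit_delta 1]
    simp [mulT_one]
  coactL_coactR m := by
    simp only [coactFunL_apply, coactFunR_apply, map_sum, LinearMap.rTensor_tmul,
      LinearMap.lTensor_tmul, TensorProduct.sum_tmul, TensorProduct.tmul_sum,
      TensorProduct.assoc_tmul, mulT_mulL]
    rw [Finset.sum_comm]
  coactL_actL f m := by
    induction m using emb_induction with
    | h0 => simp
    | ha x y hx hy => simp only [map_add, hx, hy]
    | h x y C hC i v =>
      simp only [LinearMap.flip_apply, funAct_tgt, map_smul,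
        coactFunL_apply, GroupFun.comul_def, map_sum, LinearMap.sum_apply,
        TensorProduct.map₂_apply_tmul, TensorProduct.map_tmul,
        LinearMap.mul_apply', mulL_emb, Finset.smul_sum]
      rw [Finset.sum_comm]
      refine Finset.sum_congr rfl fun g _ ↦ ?_
      rw [Finset.sum_eq_single g (fun b _ hb ↦ by
        rw [GroupFun.delta_mul_of_ne (Ne.symm hb), TensorProduct.zero_tmul]) (by simp),
        GroupFun.delta_mul_self,
        GroupFun.eval_shift, mul_inv_cancel_left, TensorProduct.tmul_smul]
  coactL_actR m f := by
    induction m using emb_induction with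
    | h0 => simp
    | ha x y hx hy => simp only [map_add, hx, hy, LinearMap.add_apply]
    | h x y C hC i v =>
      simp only [funAct_src, map_smul,
        coactFunL_apply, GroupFun.comul_def, map_sum, LinearMap.sum_apply,
        TensorProduct.map₂_apply_tmul, TensorProduct.map_tmul,
        LinearMap.mul_apply', mulL_emb, Finset.smul_sum]
      rw [Finset.sum_comm]
      refine Finset.sum_congr rfl fun g _ ↦ ?_
      rw [Finset.sum_eq_single g (fun b _ hb ↦ by
        rw [GroupFun.delta_mul_of_ne (Ne.symm hb), TensorProduct.zero_tmul]) (by simp),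
        GroupFun.delta_mul_self,
        GroupFun.eval_shift, mul_inv_cancel_left, TensorProduct.tmul_smul]
  coactR_actL f m := by
    induction m using emb_induction with
    | h0 => simp
    | ha x y hx hy => simp only [map_add, hx, hy]
    | h x y C hC i v =>
      simp only [LinearMap.flip_apply, funAct_tgt, map_smul,
        coactFunR_apply, GroupFun.comul_def, map_sum, LinearMap.sum_apply,
        TensorProduct.map₂_apply_tmul, TensorProduct.map_tmul,
        LinearMap.mul_apply', mulT_emb, Finset.smul_sum]
      refine Finset.sum_congr rfl fun g _ ↦ ?_
      simp only [GroupFun.mul_delta,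
        GroupFun.eval_shift, GroupFun.eval_delta]
      rw [Finset.sum_eq_single (y * g⁻¹) (fun b _ hb ↦ by simp [hb]) (by simp)]
      simp
  coactR_actR m f := by
    induction m using emb_induction with
    | h0 => simp
    | ha x y hx hy => simp only [map_add, hx, hy, LinearMap.add_apply]
    | h x y C hC i v =>
      simp only [funAct_src, map_smul,
        coactFunR_apply, GroupFun.comul_def, map_sum, LinearMap.sum_apply,
        TensorProduct.map₂_apply_tmul, TensorProduct.map_tmul,
        LinearMap.mul_apply', mulT_emb, Finset.smul_sum]
      rw [Finset.sum_comm]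
      refine Finset.sum_congr rfl fun g _ ↦ ?_
      simp only [mul_comm (GroupFun.delta g), GroupFun.mul_delta,
        GroupFun.eval_shift, GroupFun.eval_delta]
      rw [Finset.sum_eq_single (x * g⁻¹) (fun b _ hb ↦ by simp [hb]) (by simp)]
      simp

end RSR
end ArrowBimodule
end
end QuiverHopf

/-! All the conditions are compared with one that involves only degrees zero and one. Each of the
three graded algebras built from a Hopf bimodule `M` over `B` has `B` in degree zero and `M` in
degree one. The products of degree zero with degree one are the two actions, and `Δ` on degree one
is `δ⁻ + δ⁺`, with one summand in `B ⊗ M` and the other in `M ⊗ B`. A graded isomorphism therefore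
restricts to a bialgebra isomorphism `φ : B → B'` and a linear isomorphism `f : M → M'` compatible
with actions and coactions along `φ` (`LowDegrees.equivAlong`). Conversely such a pair extends to
all degrees, because the constructions are functorial: on the tensor algebra by its universal
property, on the cotensor coalgebra because a coalgebra map into words is determined by its
components in degrees zero and one, and on `B[M]` by restriction. So every graded condition amounts
to `EquivAlong`, and so does condition (ii), by moving `φ` to the other side of the coaction
equations.

For arrow bimodules `EquivAlong` is unwound further. A bialgebra isomorphism of group algebras
permutes group-like elements and one of function algebras permutes characters, so in both cases `φ`
comes from a group isomorphism `σ`. Over `kG` the coactions are the gradings by target and source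
and the actions are the translations; over `(kG)^*` the roles are exchanged. Both times the outcome
is an `ArrowIso`, that is, a linear isomorphism of arrow spaces respecting endpoints, left
translations and right translations (`mulR` over `kG`, the transposes `mulT` over `(kG)^*`). When
the quiver is finite, the inverse transpose of an isomorphism passes between these two versions
(`exists_arrowIso_mulT_iff`).

It remains to compare an `ArrowIso` with an isomorphism of ramification systems. The arrows from `1`
to `u C`, with the centralizer acting by conjugation, span the direct sum of the `ρ C i`. An
`ArrowIso` followed by conjugation by a suitable element identifies two such direct sums, and
uniqueness of decompositions into finite-dimensional irreducibles (`exists_index_equiv`), with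
possibly infinite multiplicities, gives the bijection of indices. Conversely, intertwiners `ρ C i ≅
ρ' (e i)` spread to all arrows of class `C` by translation. The coset representatives on the two
sides need not correspond, and the discrepancy is an element of the centralizer whose operator
corrects the intertwiner (`IsIso.exists_arrowIso`). -/

namespace QuiverHopf

noncomputable section

/-! ### Uniqueness of decompositions into finite-dimensional irreducible representations. -/

section DirectSums

variable {k : Type*} [Field k]

/-- Every operator of `Δ` is already an operator of `Γ`, so the two actions have the same invariant
subspaces. It serves to pull `ρ'` back to the centralizer in `G`. -/
theorem _root_.Representation.IsIrreducible.comp_surjective {Γ Δ V : Type*} [Monoid Γ] [Monoid Δ]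
    [AddCommGroup V] [Module k V] {ρ : Representation k Δ V} (hρ : ρ.IsIrreducible) {f : Γ →* Δ}
    (hf : Function.Surjective f) : Representation.IsIrreducible (ρ.comp f : Representation k Γ V) := by
  have o : Subrepresentation (ρ.comp f : Representation k Γ V) ≃o Subrepresentation ρ :=
    { toFun := fun S ↦ ⟨S.toSubmodule, fun d v hv ↦ by
        obtain ⟨g, rfl⟩ := hf d
        exact S.apply_mem_toSubmodule g hv⟩
      invFun := fun S ↦ ⟨S.toSubmodule, fun g v hv ↦ S.apply_mem_toSubmodule (f g) hv⟩
      left_inv := fun S ↦ rfl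
      right_inv := fun S ↦ rfl
      map_rel_iff' := Iff.rfl }
  exact o.isSimpleOrder_iff.mpr hρ

/-- A nonzero finite factor can be cancelled in a product of cardinals even when the other factor is
infinite. This is what allows infinite families of representations. -/
theorem nonempty_equiv_of_prod_fin {α β : Type*} {d : ℕ} (hd : d ≠ 0)
    (e : α × Fin d ≃ β × Fin d) : Nonempty (α ≃ β) := by
  have := Cardinal.mk_congr_lift e
  rw [← Cardinal.lift_mk_eq'] 
  simp only [Cardinal.mk_prod, Cardinal.lift_mul, Cardinal.mk_fin, Cardinal.lift_natCast,
    Cardinal.lift_lift, mul_comm _ (d : Cardinal)] at this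
  rwa [Cardinal.natCast_mul_inj hd] at this

variable {Γ : Type*} [Monoid Γ]

/-- The inclusion of a summand in a direct sum of spaces with bases. -/
def sigmaIncl {I : Type*} (J : I → Type*) (i : I) : (J i →₀ k) →ₗ[k] ((Σ i, J i) →₀ k) :=
  Finsupp.lmapDomain k k (Sigma.mk i)

/-- The projection of a direct sum of spaces with bases to a summand. -/
def sigmaProj {I : Type*} (J : I → Type*) (i : I) : ((Σ i, J i) →₀ k) →ₗ[k] (J i →₀ k) :=
  Finsupp.lcomapDomain (Sigma.mk i) sigma_mk_injective

theorem sigmaProj_apply {I : Type*} (J : I → Type*) (i : I) (v : (Σ i, J i) →₀ k) (j : J i) :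
    sigmaProj J i v j = v ⟨i, j⟩ := rfl

/-- Isomorphism as an equivalence relation on the indices of a family of representations. -/
def isoSetoid {I : Type*} {V : I → Type*} [∀ i, AddCommGroup (V i)] [∀ i, Module k (V i)]
    (ρ : ∀ i, Representation k Γ (V i)) : Setoid I where
  r i i' := Nonempty ((ρ i).Equiv (ρ i'))
  iseqv := ⟨fun _ ↦ ⟨.refl _⟩, fun ⟨e⟩ ↦ ⟨e.symm⟩, fun ⟨e⟩ ⟨e'⟩ ↦ ⟨e.trans e'⟩⟩

/-- Schur's lemma: each block of `F` from `ρ i` to `ρ' i'` intertwines two irreducibles, so it is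
bijective or zero, and only the blocks within one isomorphism class survive. Equivariance is stated
block by block, so that no action on the direct sum has to be introduced. -/
theorem supported_map_le {I I' : Type*} {J : I → Type*} {J' : I' → Type*}
    {ρ : ∀ i, Representation k Γ (J i →₀ k)} {ρ' : ∀ i, Representation k Γ (J' i →₀ k)}
    (hρ : ∀ i, (ρ i).IsIrreducible) (hρ' : ∀ i, (ρ' i).IsIrreducible)
    (F : ((Σ i, J i) →₀ k) →ₗ[k] ((Σ i, J' i) →₀ k))
    (hF : ∀ g i v i', sigmaProj J' i' (F (sigmaIncl J i (ρ i g v))) =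
      ρ' i' g (sigmaProj J' i' (F (sigmaIncl J i v))))
    {s : Set I} {s' : Set I'} (hs : ∀ i ∈ s, ∀ i', Nonempty ((ρ i).Equiv (ρ' i')) → i' ∈ s')
    {v : (Σ i, J i) →₀ k} (hv : v ∈ Finsupp.supported k k {a : Σ i, J i | a.1 ∈ s}) :
    F v ∈ Finsupp.supported k k {a : Σ i, J' i | a.1 ∈ s'} := by
  rw [Finsupp.supported_eq_span_single] at hv
  induction hv using Submodule.span_induction with
  | zero => simp
  | add x y _ _ hx hy => rw [map_add]; exact add_mem hx hy
  | smul c x _ hx => rw [map_smul]; exact Submodule.smul_mem _ _ hx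
  | mem x hx =>
    obtain ⟨⟨i, j⟩, hi, rfl⟩ := hx
    rw [Finsupp.mem_supported']
    rintro ⟨i', j'⟩ hi'
    let T : (ρ i).IntertwiningMap (ρ' i') :=
      LinearMap.intertwiningMap_of_isIntertwiningMap _ _
        (sigmaProj J' i' ∘ₗ F ∘ₗ sigmaIncl J i) fun g v ↦ hF g i v i'
    have := hρ i
    have := hρ' i'
    -- A bijective block would put `i'` into `s'` by `hs`; a zero block makes the coefficient at
    -- `(i', j')` vanish.
    rcases Representation.IsIrreducible.bijective_or_eq_zero T with h | h
    · exact absurd (hs i hi i' ⟨T.ofBijective h⟩) hi'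
    · have h₂ : T (Finsupp.single j 1) = 0 := by rw [h]; rfl
      have h₃ : sigmaProj J' i' (F (sigmaIncl J i (Finsupp.single j 1))) j' = 0 :=
        DFunLike.congr_fun h₂ j'
      simpa [sigmaIncl, sigmaProj_apply] using h₃

/-- The set of basis vectors of the summands with index in `s`, when each has dimension `d`. -/
def sigmaMemEquiv {I : Type*} {J : I → Type*} [∀ i, Finite (J i)] {s : Set I} {d : ℕ}
    (hd : ∀ i ∈ s, Nat.card (J i) = d) : {a : Σ i, J i | a.1 ∈ s} ≃ s × Fin d :=
  calc {a : Σ i, J i | a.1 ∈ s} ≃ Σ i : s, J i :=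
        { toFun := fun a ↦ ⟨⟨a.1.1, a.2⟩, a.1.2⟩
          invFun := fun a ↦ ⟨⟨a.1.1, a.2⟩, a.1.2⟩
          left_inv := fun _ ↦ rfl
          right_inv := fun _ ↦ rfl }
    _ ≃ Σ _ : s, Fin d := Equiv.sigmaCongrRight fun i ↦ Finite.equivFinOfCardEq (hd i i.2)
    _ ≃ s × Fin d := Equiv.sigmaEquivProd _ _

theorem card_eq_of_equiv {J J' : Type*} {ρ : Representation k Γ (J →₀ k)}
    {ρ' : Representation k Γ (J' →₀ k)} (e : Nonempty (ρ.Equiv ρ')) : Nat.card J = Nat.card J' :=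
  Nat.card_congr <| Finsupp.basisSingleOne.indexEquiv
    (Finsupp.basisSingleOne.map e.some.toLinearEquiv.symm)

/-- The zero space has only one subrepresentation, whereas an irreducible one has two. -/
theorem card_ne_zero_of_irreducible {J : Type*} [Finite J] {ρ : Representation k Γ (J →₀ k)}
    (hρ : ρ.IsIrreducible) : Nat.card J ≠ 0 := by
  intro h
  have : IsEmpty J := (Nat.card_eq_zero.mp h).resolve_right (not_infinite_iff_finite.mpr ‹_›)
  obtain ⟨S, T, hST⟩ := hρ.toNontrivial
  exact hST (Subrepresentation.toSubmodule_injective (Subsingleton.elim _ _))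

section

variable {I I' : Type*} {J : I → Type*} {J' : I' → Type*}
  [∀ i, Finite (J i)] [∀ i, Finite (J' i)]
  {ρ : ∀ i, Representation k Γ (J i →₀ k)} {ρ' : ∀ i, Representation k Γ (J' i →₀ k)}

/-- Since `s` and `s'` consist of mutually corresponding isomorphism types, `F` and its inverse
exchange the subspaces spanned by the summands over `s` and over `s'`. Comparing bases of these
gives `s × Fin d ≃ s' × Fin d`, and the common dimension `d` is cancelled. -/
theorem nonempty_equiv_isotypic (hρ : ∀ i, (ρ i).IsIrreducible) (hρ' : ∀ i, (ρ' i).IsIrreducible)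
    (F : ((Σ i, J i) →₀ k) ≃ₗ[k] ((Σ i, J' i) →₀ k))
    (hF : ∀ g i v i', sigmaProj J' i' (F (sigmaIncl J i (ρ i g v))) =
      ρ' i' g (sigmaProj J' i' (F (sigmaIncl J i v))))
    (hF' : ∀ g i v i', sigmaProj J i' (F.symm (sigmaIncl J' i (ρ' i g v))) =
      ρ i' g (sigmaProj J i' (F.symm (sigmaIncl J' i v))))
    {s : Set I} {s' : Set I'} (hs : ∀ i ∈ s, ∀ i', Nonempty ((ρ i).Equiv (ρ' i')) → i' ∈ s')
    (hs' : ∀ i' ∈ s', ∀ i, Nonempty ((ρ' i').Equiv (ρ i)) → i ∈ s) {d : ℕ} (hd₀ : d ≠ 0)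
    (hd : ∀ i ∈ s, Nat.card (J i) = d) (hd' : ∀ i ∈ s', Nat.card (J' i) = d) :
    Nonempty (s ≃ s') := by
  have hmap : (Finsupp.supported k k {a : Σ i, J i | a.1 ∈ s}).map F.toLinearMap =
      Finsupp.supported k k {a : Σ i, J' i | a.1 ∈ s'} := by
    refine le_antisymm ?_ fun v hv ↦ ⟨F.symm v, ?_, F.apply_symm_apply v⟩
    · rintro _ ⟨v, hv, rfl⟩
      exact supported_map_le hρ hρ' F.toLinearMap hF hs hv
    · exact supported_map_le hρ' hρ F.symm.toLinearMap hF' hs' hv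
  have e := (Finsupp.supportedEquivFinsupp {a : Σ i, J i | a.1 ∈ s}).symm ≪≫ₗ
    F.ofSubmodules _ _ hmap ≪≫ₗ Finsupp.supportedEquivFinsupp {a : Σ i, J' i | a.1 ∈ s'}
  have e' := Finsupp.basisSingleOne.indexEquiv (Finsupp.basisSingleOne.map e.symm)
  exact nonempty_equiv_of_prod_fin hd₀
    ((sigmaMemEquiv hd).symm.trans (e'.trans (sigmaMemEquiv hd')))

/-- The decomposition of a representation as a direct sum of finite-dimensional irreducible
representations is unique. -/
theorem exists_index_equiv
    (hρ : ∀ i, (ρ i).IsIrreducible) (hρ' : ∀ i, (ρ' i).IsIrreducible)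
    (F : ((Σ i, J i) →₀ k) ≃ₗ[k] ((Σ i, J' i) →₀ k))
    (hF : ∀ g i v i', sigmaProj J' i' (F (sigmaIncl J i (ρ i g v))) =
      ρ' i' g (sigmaProj J' i' (F (sigmaIncl J i v))))
    (hF' : ∀ g i v i', sigmaProj J i' (F.symm (sigmaIncl J' i (ρ' i g v))) =
      ρ i' g (sigmaProj J i' (F.symm (sigmaIncl J' i v)))) :
    ∃ e : I ≃ I', ∀ i, Nonempty ((ρ i).Equiv (ρ' (e i))) := by
  -- The isotypic parts of type `ρ' i'` on both sides have equally many summands, and on the primed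
  -- side `i'` is one of them.
  have exists_iso (i' : I') : ∃ i, Nonempty ((ρ i).Equiv (ρ' i')) := by
    obtain ⟨e⟩ := nonempty_equiv_isotypic hρ hρ' F hF hF'
      (s := {i | Nonempty ((ρ i).Equiv (ρ' i'))}) (s' := {j | Nonempty ((ρ' j).Equiv (ρ' i'))})
      (fun i ⟨a⟩ j ⟨b⟩ ↦ ⟨b.symm.trans a⟩) (fun j ⟨a⟩ i ⟨b⟩ ↦ ⟨b.symm.trans a⟩)
      (card_ne_zero_of_irreducible (hρ' i')) (fun i a ↦ card_eq_of_equiv a)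
      (fun i a ↦ card_eq_of_equiv a)
    exact ⟨_, (e.symm ⟨i', ⟨.refl _⟩⟩).2⟩
  choose p hp using exists_iso
  -- Through `p` both index sets map to the isomorphism classes of the family `ρ`. Over each class
  -- the fibres index corresponding isotypic parts, so they have the same cardinality.
  have fiber (q : Quotient (isoSetoid ρ)) :
      Nonempty ({i // Quotient.mk (isoSetoid ρ) i = q} ≃
        {i' // Quotient.mk (isoSetoid ρ) (p i') = q}) := by
    induction q using Quotient.inductionOn with
    | h i₀ =>
      have h₁ (i) : Quotient.mk (isoSetoid ρ) i = Quotient.mk _ i₀ ↔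
        Nonempty ((ρ i).Equiv (ρ i₀)) := Quotient.eq
      have h₂ (i') : Quotient.mk (isoSetoid ρ) (p i') = Quotient.mk _ i₀ ↔
          Nonempty ((ρ' i').Equiv (ρ i₀)) := by
        obtain ⟨a⟩ := hp i'
        rw [h₁]
        exact ⟨fun ⟨b⟩ ↦ ⟨a.symm.trans b⟩, fun ⟨b⟩ ↦ ⟨a.trans b⟩⟩
      refine nonempty_equiv_isotypic hρ hρ' F hF hF' (d := Nat.card (J i₀)) ?_ ?_
        (card_ne_zero_of_irreducible (hρ i₀)) (fun i a ↦ card_eq_of_equiv ((h₁ i).mp a))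
        (fun i a ↦ card_eq_of_equiv ((h₂ i).mp a))
      · rintro i hi i' ⟨b⟩
        obtain ⟨a⟩ := (h₁ i).mp hi
        exact (h₂ i').mpr ⟨b.symm.trans a⟩
      · rintro i' hi' i ⟨b⟩
        obtain ⟨a⟩ := (h₂ i').mp hi'
        exact (h₁ i).mpr ⟨b.symm.trans a⟩
  -- An index set is the disjoint union of its fibres, so the fibrewise bijections glue.
  let e : I ≃ I' := (Equiv.sigmaFiberEquiv (Quotient.mk (isoSetoid ρ))).symm.trans
    ((Equiv.sigmaCongrRight fun q ↦ (fiber q).some).trans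
      (Equiv.sigmaFiberEquiv fun i' ↦ Quotient.mk (isoSetoid ρ) (p i')))
  refine ⟨e, fun i ↦ ?_⟩
  -- By construction `e i` lies over the class of `i`, whence `ρ i ≅ ρ (p (e i)) ≅ ρ' (e i)`.
  have h : Quotient.mk (isoSetoid ρ) (p (e i)) = Quotient.mk _ i :=
    ((fiber _).some ⟨i, rfl⟩).2
  obtain ⟨a⟩ : Nonempty ((ρ (p (e i))).Equiv (ρ i)) := Quotient.eq.mp h
  obtain ⟨b⟩ := hp (e i)
  exact ⟨a.symm.trans b⟩

end

end DirectSums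
-- Hopf bimodule isomorphisms along an isomorphism of bialgebras.
section SemilinearHom

variable {k : Type*} [Field k]
variable {B : Type*} [Ring B] [Bialgebra k B] {M : Type*} [AddCommGroup M] [Module k M]
variable {B' : Type*} [Ring B'] [Bialgebra k B'] {M' : Type*} [AddCommGroup M'] [Module k M']

/-- A linear map of Hopf bimodules compatible with the actions and coactions along a morphism of
bialgebras. -/
structure HopfBimodule.IsHomAlong (h : HopfBimodule k B M) (h' : HopfBimodule k B' M')
    (φ : B →ₐc[k] B') (f : M →ₗ[k] M') : Prop where
  map_actL : ∀ b m, f (h.actL b m) = h'.actL (φ b) (f m)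
  map_actR : ∀ m b, f (h.actR m b) = h'.actR (f m) (φ b)
  map_coactL : ∀ m, h'.coactL (f m) = TensorProduct.map (φ : B →ₗ[k] B') f (h.coactL m)
  map_coactR : ∀ m, h'.coactR (f m) = TensorProduct.map f (φ : B →ₗ[k] B') (h.coactR m)

/-- Isomorphism of Hopf bimodules along an isomorphism of bialgebras. -/
def HopfBimodule.EquivAlong (h : HopfBimodule k B M) (h' : HopfBimodule k B' M') : Prop :=
  ∃ (φ : B ≃ₐc[k] B') (f : M ≃ₗ[k] M'), h.IsHomAlong h' φ f

variable {h : HopfBimodule k B M} {h' : HopfBimodule k B' M'}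

theorem HopfBimodule.IsHomAlong.symm {φ : B ≃ₐc[k] B'} {f : M ≃ₗ[k] M'}
    (hf : h.IsHomAlong h' φ f) : h'.IsHomAlong h φ.symm f.symm where
  map_actL b m := by
    apply f.injective
    have := hf.map_actL (φ.symm b) (f.symm m)
    simp only [LinearEquiv.coe_coe] at this ⊢
    simp [this]
  map_actR m b := by
    apply f.injective
    have := hf.map_actR (f.symm m) (φ.symm b)
    simp only [LinearEquiv.coe_coe] at this ⊢
    simp [this]
  map_coactL m := by
    have := hf.map_coactL (f.symm m)
    simp only [LinearEquiv.coe_coe, LinearEquiv.apply_symm_apply] at this ⊢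
    rw [this, TensorProduct.map_map]
    generalize h.coactL (f.symm m) = z
    induction z with
    | zero => simp
    | add x y hx hy => rw [map_add, ← hx, ← hy]
    | tmul a b => simp
  map_coactR m := by
    have := hf.map_coactR (f.symm m)
    simp only [LinearEquiv.coe_coe, LinearEquiv.apply_symm_apply] at this ⊢
    rw [this, TensorProduct.map_map]
    generalize h.coactR (f.symm m) = z
    induction z with
    | zero => simp
    | add x y hx hy => rw [map_add, ← hx, ← hy]
    | tmul a b => simp

/-- The same `φ` and `f` serve both sides. The action clauses coincide by definition, and the
coaction clauses differ by applying the invertible map `φ` to the factor `B`. -/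
theorem exists_isIso_pullPush_iff :
    (∃ φ : B ≃ₐc[k] B', h.IsIso (h'.pullPush φ)) ↔ h.EquivAlong h' := by
  have cancel {X : Type _} (φ : B ≃ₐc[k] B') [AddCommGroup X] [Module k X]
      (z : B' ⊗[k] X) : (φ : B →ₗ[k] B').rTensor X ((φ.symm : B' →ₗ[k] B).rTensor X z) = z := by
    induction z with
    | zero => simp
    | add x y hx hy => rw [map_add, map_add, hx, hy]
    | tmul a b => simp
  have cancel' {X : Type _} (φ : B ≃ₐc[k] B') [AddCommGroup X] [Module k X]
      (z : X ⊗[k] B') : (φ : B →ₗ[k] B').lTensor X ((φ.symm : B' →ₗ[k] B).lTensor X z) = z := by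
    induction z with
    | zero => simp
    | add x y hx hy => rw [map_add, map_add, hx, hy]
    | tmul a b => simp
  refine exists_congr fun φ ↦ exists_congr fun f ↦
    ⟨fun ⟨h₁, h₂, h₃, h₄⟩ ↦ ⟨h₁, h₂, fun m ↦ ?_, fun m ↦ ?_⟩,
      fun H ↦ ⟨H.map_actL, H.map_actR, fun m ↦ ?_, fun m ↦ ?_⟩⟩
  · have := congrArg ((φ : B →ₗ[k] B').rTensor M') (h₃ m)
    simp only [HopfBimodule.pullPush, LinearMap.comp_apply] at this
    rw [cancel, ← LinearMap.comp_apply, LinearMap.rTensor_comp_lTensor] at this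
    exact this
  · have := congrArg ((φ : B →ₗ[k] B').lTensor M') (h₄ m)
    simp only [HopfBimodule.pullPush, LinearMap.comp_apply] at this
    rw [cancel', ← LinearMap.comp_apply, LinearMap.lTensor_comp_rTensor] at this
    exact this
  · have := H.map_coactL m
    simp only [HopfBimodule.pullPush, LinearMap.comp_apply]
    simp only [LinearEquiv.coe_coe] at this
    rw [this]
    generalize h.coactL m = z
    induction z with
    | zero => simp
    | add x y hx hy => rw [map_add, map_add, hx, hy, map_add]
    | tmul a b => simp
  · have := H.map_coactR m
    simp only [HopfBimodule.pullPush, LinearMap.comp_apply]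
    simp only [LinearEquiv.coe_coe] at this
    rw [this]
    generalize h.coactR m = z
    induction z with
    | zero => simp
    | add x y hx hy => rw [map_add, map_add, hx, hy, map_add]
    | tmul a b => simp

end SemilinearHom

/-! ### What a graded bialgebra isomorphism does in degrees zero and one. -/

section LowDegrees

variable {k : Type*} [Field k]
variable {B : Type*} [Ring B] [Bialgebra k B] {M : Type*} [AddCommGroup M] [Module k M]
variable {B' : Type*} [Ring B'] [Bialgebra k B'] {M' : Type*} [AddCommGroup M'] [Module k M']

/-- The data by which a graded bialgebra has the bialgebra `B` as its component of degree zero and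
the Hopf bimodule `M` as its component of degree one. -/
structure LowDegrees (h : HopfBimodule k B M) {H : Type*} [Ring H] [Bialgebra k H]
    (𝒜 : ℕ → Submodule k H) where
  inB : B →ₐ[k] H
  inM : M →ₗ[k] H
  toB : H →ₗ[k] B
  toM : H →ₗ[k] M
  toB_inB : ∀ b, toB (inB b) = b
  toM_inM : ∀ m, toM (inM m) = m
  toB_inM : ∀ m, toB (inM m) = 0
  toM_inB : ∀ b, toM (inB b) = 0
  counit_inB : ∀ b, Coalgebra.counit (R := k) (inB b) = Coalgebra.counit b
  comul_inB : ∀ b, Coalgebra.comul (R := k) (inB b) =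
    TensorProduct.map inB.toLinearMap inB.toLinearMap (Coalgebra.comul b)
  comul_inM : ∀ m, Coalgebra.comul (R := k) (inM m) =
    TensorProduct.map inB.toLinearMap inM (h.coactL m) +
      TensorProduct.map inM inB.toLinearMap (h.coactR m)
  inB_mul_inM : ∀ b m, inB b * inM m = inM (h.actL b m)
  inM_mul_inB : ∀ m b, inM m * inB b = inM (h.actR m b)
  range_inB : LinearMap.range inB.toLinearMap = 𝒜 0
  range_inM : LinearMap.range inM = 𝒜 1

namespace LowDegrees

variable {h : HopfBimodule k B M} {h' : HopfBimodule k B' M'}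
variable {H : Type*} [Ring H] [Bialgebra k H] {𝒜 : ℕ → Submodule k H}
variable {H' : Type*} [Ring H'] [Bialgebra k H'] {𝒜' : ℕ → Submodule k H'}
variable (L : LowDegrees h 𝒜) (L' : LowDegrees h' 𝒜')

theorem inB_injective : Function.Injective L.inB := Function.LeftInverse.injective L.toB_inB

theorem inB_toB {x : H} (hx : x ∈ 𝒜 0) : L.inB (L.toB x) = x := by
  rw [← L.range_inB] at hx
  obtain ⟨b, rfl⟩ := hx
  simp [L.toB_inB]

theorem inM_toM {x : H} (hx : x ∈ 𝒜 1) : L.inM (L.toM x) = x := by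
  rw [← L.range_inM] at hx
  obtain ⟨b, rfl⟩ := hx
  simp [L.toM_inM]

section

variable (F : H →ₐc[k] H') (hF : ∀ n, ∀ x ∈ 𝒜 n, F x ∈ 𝒜' n)

include hF in
theorem inB_toB_map (b : B) : L'.inB (L'.toB (F (L.inB b))) = F (L.inB b) :=
  L'.inB_toB (hF 0 _ (L.range_inB ▸ ⟨b, rfl⟩))

include hF in
theorem inM_toM_map (m : M) : L'.inM (L'.toM (F (L.inM m))) = F (L.inM m) :=
  L'.inM_toM (hF 1 _ (L.range_inM ▸ ⟨m, rfl⟩))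

/-- The linear map induced in degree zero. -/
def linB : B →ₗ[k] B' := L'.toB ∘ₗ (F : H →ₗ[k] H') ∘ₗ L.inB.toLinearMap

/-- The linear map induced in degree one. -/
def linM : M →ₗ[k] M' := L'.toM ∘ₗ (F : H →ₗ[k] H') ∘ₗ L.inM

include hF in
theorem inB_comp_linB : L'.inB.toLinearMap ∘ₗ linB L L' F =
    (F : H →ₗ[k] H') ∘ₗ L.inB.toLinearMap := LinearMap.ext (inB_toB_map L L' F hF)

include hF in
theorem inM_comp_linM : L'.inM ∘ₗ linM L L' F = (F : H →ₗ[k] H') ∘ₗ L.inM :=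
  LinearMap.ext (inM_toM_map L L' F hF)

/-- The morphism of bialgebras induced in degree zero by a graded morphism. -/
def mapB : B →ₐc[k] B' where
  toLinearMap := linB L L' F
  map_one' := L'.inB_injective <| (inB_toB_map L L' F hF 1).trans (by simp)
  map_mul' a b := L'.inB_injective <| by
    refine (inB_toB_map L L' F hF (a * b)).trans ?_
    rw [map_mul, map_mul, map_mul]
    exact congrArg₂ _ (inB_toB_map L L' F hF a).symm (inB_toB_map L L' F hF b).symm
  counit_comp := LinearMap.ext fun b ↦ by
    have := CoalgHomClass.counit_comp_apply F (L.inB b)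
    rw [← inB_toB_map L L' F hF, L.counit_inB, L'.counit_inB] at this
    exact this
  map_comp_comul := LinearMap.ext fun b ↦ by
    have e : ∀ z, TensorProduct.map L'.toB L'.toB (TensorProduct.map L'.inB.toLinearMap
        L'.inB.toLinearMap z) = z := fun z ↦ by
      induction z with
      | zero => simp
      | add x y hx hy => rw [map_add, map_add, hx, hy]
      | tmul a b => simp [L'.toB_inB]
    have := CoalgHomClass.map_comp_comul_apply F (L.inB b)
    rw [← inB_toB_map L L' F hF, L.comul_inB, L'.comul_inB, TensorProduct.map_map,
      ← inB_comp_linB L L' F hF, ← TensorProduct.map_map] at this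
    have := congrArg (TensorProduct.map L'.toB L'.toB) this
    rw [e, e] at this
    exact this

theorem inB_mapB (b : B) : L'.inB (mapB L L' F hF b) = F (L.inB b) := inB_toB_map L L' F hF b

include hF in
theorem inM_linM (m : M) : L'.inM (linM L L' F m) = F (L.inM m) := inM_toM_map L L' F hF m

/-- The actions are products of elements of degrees zero and one, and `F` respects products. The
coactions are the two homogeneous components of `Δ` on degree one, so `F` respects each separately
once the components are told apart by the projections `toB` and `toM`. -/
theorem isHomAlong : h.IsHomAlong h' (mapB L L' F hF) (linM L L' F) where
  map_actL b m := by
    apply Function.LeftInverse.injective L'.toM_inM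
    rw [← L'.inB_mul_inM, inM_linM _ _ _ hF, inM_linM _ _ _ hF, inB_mapB, ← map_mul,
      L.inB_mul_inM]
  map_actR m b := by
    apply Function.LeftInverse.injective L'.toM_inM
    rw [← L'.inM_mul_inB, inM_linM _ _ _ hF, inM_linM _ _ _ hF, inB_mapB, ← map_mul,
      L.inM_mul_inB]
  map_coactL m := by
    have e : ∀ z, TensorProduct.map L'.toB L'.toM (TensorProduct.map L'.inB.toLinearMap
        L'.inM z) = z := fun z ↦ by
      induction z with
      | zero => simp
      | add x y hx hy => rw [map_add, map_add, hx, hy]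
      | tmul a b => simp [L'.toB_inB, L'.toM_inM]
    -- The right coaction contributes tensors of bidegree `(1, 0)`; the projection to bidegree `(0,
    -- 1)` kills these and keeps the left coaction.
    have e' : ∀ z, TensorProduct.map L'.toB L'.toM (TensorProduct.map L'.inM
        L'.inB.toLinearMap z) = 0 := fun z ↦ by
      induction z with
      | zero => simp
      | add x y hx hy => rw [map_add, map_add, hx, hy, add_zero]
      | tmul a b => simp [L'.toB_inM, L'.toM_inB]
    have := CoalgHomClass.map_comp_comul_apply F (L.inM m)
    rw [← inM_toM_map L L' F hF, L.comul_inM, L'.comul_inM, map_add, TensorProduct.map_map,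
      TensorProduct.map_map, ← inB_comp_linB L L' F hF, ← inM_comp_linM L L' F hF,
      ← TensorProduct.map_map, ← TensorProduct.map_map] at this
    have := congrArg (TensorProduct.map L'.toB L'.toM) this
    simp only [map_add, e, e', add_zero] at this
    exact this.symm
  map_coactR m := by
    have e : ∀ z, TensorProduct.map L'.toM L'.toB (TensorProduct.map L'.inM
        L'.inB.toLinearMap z) = z := fun z ↦ by
      induction z with
      | zero => simp
      | add x y hx hy => rw [map_add, map_add, hx, hy]
      | tmul a b => simp [L'.toB_inB, L'.toM_inM]
    -- Now the left coaction, of bidegree `(0, 1)`, is the part that is killed.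
    have e' : ∀ z, TensorProduct.map L'.toM L'.toB (TensorProduct.map L'.inB.toLinearMap
        L'.inM z) = 0 := fun z ↦ by
      induction z with
      | zero => simp
      | add x y hx hy => rw [map_add, map_add, hx, hy, add_zero]
      | tmul a b => simp [L'.toB_inM, L'.toM_inB]
    have := CoalgHomClass.map_comp_comul_apply F (L.inM m)
    rw [← inM_toM_map L L' F hF, L.comul_inM, L'.comul_inM, map_add, TensorProduct.map_map,
      TensorProduct.map_map, ← inB_comp_linB L L' F hF, ← inM_comp_linM L L' F hF,
      ← TensorProduct.map_map, ← TensorProduct.map_map] at this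
    have := congrArg (TensorProduct.map L'.toM L'.toB) this
    simp only [map_add, e, e', zero_add] at this
    exact this.symm

end

include L L' in
-- A graded isomorphism maps each component onto the corresponding one, so its inverse is graded as
-- well. Both directions induce maps in degrees zero and one, and these are mutually inverse because
-- `B` and `M` embed.
theorem equivAlong (hi : GradedIso 𝒜 𝒜') : h.EquivAlong h' := by
  obtain ⟨F, hF⟩ := hi
  have h₁ : ∀ n, ∀ x ∈ 𝒜 n, (F : H →ₐc[k] H') x ∈ 𝒜' n := fun n x hx ↦
    hF n ▸ Submodule.mem_map_of_mem hx
  have h₂ : ∀ n, ∀ x ∈ 𝒜' n, (F.symm : H' →ₐc[k] H) x ∈ 𝒜 n := by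
    intro n x hx
    rw [← hF] at hx
    obtain ⟨y, hy, rfl⟩ := hx
    simpa using hy
  refine ⟨BialgEquiv.ofBialgHom (mapB L L' F h₁) (mapB L' L F.symm h₂) ?_ ?_,
    LinearEquiv.ofLinearMap (linM L L' F) (linM L' L F.symm) ?_ ?_, isHomAlong L L' F h₁⟩
  · ext b
    apply L'.inB_injective
    simp [inB_mapB]
  · ext b
    apply L.inB_injective
    simp [inB_mapB]
  · ext b
    apply Function.LeftInverse.injective L'.toM_inM
    simp [inM_linM _ _ _ h₁, inM_linM _ _ _ h₂]
  · ext b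
    apply Function.LeftInverse.injective L.toM_inM
    simp [inM_linM _ _ _ h₁, inM_linM _ _ _ h₂]

end LowDegrees

theorem gradedIso_of_inverse {H : Type*} [Ring H] [Bialgebra k H] {𝒜 : ℕ → Submodule k H}
    {H' : Type*} [Ring H'] [Bialgebra k H'] {𝒜' : ℕ → Submodule k H'}
    (F : H →ₐc[k] H') (F' : H' →ₐc[k] H) (h₁ : ∀ x, F' (F x) = x) (h₂ : ∀ x, F (F' x) = x)
    (hF : ∀ n, ∀ x ∈ 𝒜 n, F x ∈ 𝒜' n) (hF' : ∀ n, ∀ x ∈ 𝒜' n, F' x ∈ 𝒜 n) :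
    GradedIso 𝒜 𝒜' := by
  refine ⟨BialgEquiv.ofBialgHom F F' (BialgHom.ext h₂) (BialgHom.ext h₁), fun n ↦
    le_antisymm ?_ fun x hx ↦ ⟨F' x, hF' n x hx, h₂ x⟩⟩
  rintro _ ⟨x, hx, rfl⟩
  exact hF n x hx

end LowDegrees

/-! ### The tensor Hopf algebra: its low degrees and functoriality. -/

section TensorHopf

variable {k : Type*} [Field k]
variable {B : Type*} [Ring B] [Bialgebra k B] {M : Type*} [AddCommGroup M] [Module k M]
variable {B' : Type*} [Ring B'] [Bialgebra k B'] {M' : Type*} [AddCommGroup M'] [Module k M']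
variable {h : HopfBimodule k B M} {h' : HopfBimodule k B' M'}

namespace TensorHopf

variable (h) in
/-- The action of `B` on `B ⊕ M` by left multiplication. -/
def leftB : B →ₐ[k] Module.End k (B × M) :=
  AlgHom.ofLinearMap
    (LinearMap.mk₂ k (fun b x ↦ (b * x.1, h.actL b x.2)) (by intros; simp [add_mul])
      (by intros; simp) (by intros; simp [mul_add]) (by intros; simp))
    (by ext <;> simp [h.one_actL]) (fun a b ↦ by ext <;> simp [h.mul_actL, mul_assoc])

variable (h) in
/-- The action of `M` on `B ⊕ M` by left multiplication in the trivial square-zero extension. -/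
def leftM : M →ₗ[k] Module.End k (B × M) :=
  LinearMap.mk₂ k (fun m x ↦ (0, h.actR m x.1)) (by intros; simp)
      (by intros; simp) (by intros; simp) (by intros; simp)

variable (h) in
/-- The projection of the tensor algebra onto its components of degree at most one. -/
def toLow : TensorHopf h →ₗ[k] B × M :=
  -- The presentation by generators and relations does not show that `B` and `M` embed. The tensor
  -- algebra acts on the trivial extension `B ⊕ M` with `M² = 0`, and the value of an element at the
  -- unit `(1, 0)` reads off its components of degrees zero and one.
  LinearMap.applyₗ (1, 0) ∘ₗ (lift (leftB h) (leftM h)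
    (fun b m ↦ by ext <;> simp [leftB, leftM, h.actL_actR])
    (fun m b ↦ by ext <;> simp [leftB, leftM, h.actR_mul])).toLinearMap

theorem toLow_inB (b : B) : toLow h (inB h b) = (b, 0) := by
  simp [toLow, lift_inB, leftB]

theorem toLow_inM (m : M) : toLow h (inM h m) = (0, m) := by
  simp [toLow, lift_inM, leftM, h.actR_one]

variable (h) in
/-- The components of degree zero and one of the tensor algebra. -/
def lowDegrees : LowDegrees h (degree h) where
  inB := inB h
  inM := inM h
  toB := LinearMap.fst k B M ∘ₗ toLow h
  toM := LinearMap.snd k B M ∘ₗ toLow h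
  toB_inB b := by simp [toLow_inB]
  toM_inM m := by simp [toLow_inM]
  toB_inM m := by simp [toLow_inM]
  toM_inB b := by simp [toLow_inB]
  counit_inB := counitHom_inB h
  comul_inB := comulHom_inB h
  comul_inM := comulHom_inM h
  inB_mul_inM := inB_mul_inM h
  inM_mul_inB := inM_mul_inB h
  range_inB := by simp [degree]
  range_inM := by
    -- Degree one is defined as the product `B · M`. It contains `M` since `1 ∈ B`, and it is
    -- contained in `M` since `B · M` is the left action.
    rw [degree, pow_one]
    refine le_antisymm ?_ (Submodule.mul_le.mpr ?_)
    · rintro _ ⟨m, rfl⟩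
      have h₁ : (1 : TensorHopf h) ∈ LinearMap.range (inB h).toLinearMap := ⟨1, map_one (inB h)⟩
      simpa using Submodule.mul_mem_mul h₁ (LinearMap.mem_range_self (inM h) m)
    · rintro _ ⟨b, rfl⟩ _ ⟨m, rfl⟩
      exact ⟨_, (inB_mul_inM h b m).symm⟩

section map

variable {φ : B →ₐc[k] B'} {f : M →ₗ[k] M'} (hf : h.IsHomAlong h' φ f)

/-- The algebra map induced on tensor algebras. -/
def mapAlg : TensorHopf h →ₐ[k] TensorHopf h' :=
  lift ((inB h').comp (φ : B →ₐ[k] B')) (inM h' ∘ₗ f)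
    (fun b m ↦ by simp [hf.map_actL, inB_mul_inM]) (fun m b ↦ by simp [hf.map_actR, inM_mul_inB])

theorem mapAlg_inB (b : B) : mapAlg hf (inB h b) = inB h' (φ b) := lift_inB _ _ _ _ b
theorem mapAlg_inM (m : M) : mapAlg hf (inM h m) = inM h' (f m) := lift_inM _ _ _ _ m

/-- The bialgebra map induced on tensor algebras. -/
def map : TensorHopf h →ₐc[k] TensorHopf h' :=
  .ofAlgHom (mapAlg hf)
    (algHom_ext
      (fun b ↦ by
        have h₁ : Coalgebra.counit (R := k) (inB h' (φ b)) = _ := counitHom_inB h' (φ b)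
        have h₂ : Coalgebra.counit (R := k) (inB h b) = _ := counitHom_inB h b
        simp [mapAlg_inB, h₁, h₂])
      (fun m ↦ by
        have h₁ : Coalgebra.counit (R := k) (inM h' (f m)) = _ := counitHom_inM h' (f m)
        have h₂ : Coalgebra.counit (R := k) (inM h m) = _ := counitHom_inM h m
        simp [mapAlg_inM, h₁, h₂]))
    (algHom_ext
      (fun b ↦ by
        change TensorProduct.map (mapAlg hf).toLinearMap (mapAlg hf).toLinearMap
          (comulHom h (inB h b)) = comulHom h' (mapAlg hf (inB h b))
        rw [mapAlg_inB, comulHom_inB, comulHom_inB, ← CoalgHomClass.map_comp_comul_apply φ,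
          TensorProduct.map_map, TensorProduct.map_map]
        congr 2 <;> ext <;> simp [mapAlg_inB])
      (fun m ↦ by
        change TensorProduct.map (mapAlg hf).toLinearMap (mapAlg hf).toLinearMap
          (comulHom h (inM h m)) = comulHom h' (mapAlg hf (inM h m))
        have e₁ : (mapAlg hf).toLinearMap ∘ₗ inM h = inM h' ∘ₗ f :=
          LinearMap.ext (mapAlg_inM hf)
        have e₂ : (mapAlg hf).toLinearMap ∘ₗ (inB h).toLinearMap =
          (inB h').toLinearMap ∘ₗ (φ : B →ₗ[k] B') := LinearMap.ext (mapAlg_inB hf)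
        rw [mapAlg_inM, comulHom_inM, comulHom_inM, hf.map_coactL, hf.map_coactR, map_add]
        simp only [TensorProduct.map_map, e₁, e₂]))

theorem map_mem_degree (n : ℕ) {x : TensorHopf h} (hx : x ∈ degree h n) :
    map hf x ∈ degree h' n := by
  have : (degree h n).map (mapAlg hf).toLinearMap ≤ degree h' n := by
    rw [degree, Submodule.map_mul, Submodule.map_pow]
    refine mul_le_mul' ?_ (pow_le_pow_left' ?_ n)
    · rintro _ ⟨_, ⟨b, rfl⟩, rfl⟩
      exact ⟨_, (mapAlg_inB hf b).symm⟩
    · rintro _ ⟨_, ⟨m, rfl⟩, rfl⟩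
      exact ⟨_, (mapAlg_inM hf m).symm⟩
  exact this ⟨x, hx, rfl⟩

end map

theorem map_map_symm {φ : B →ₐc[k] B'} {f : M →ₗ[k] M'} (hf : h.IsHomAlong h' φ f)
    {ψ : B' →ₐc[k] B} {g : M' →ₗ[k] M} (hg : h'.IsHomAlong h ψ g)
    (h₁ : ∀ b, ψ (φ b) = b) (h₂ : ∀ m, g (f m) = m) (x : TensorHopf h) :
    map hg (map hf x) = x := by
  have : (mapAlg hg).comp (mapAlg hf) = .id k _ :=
    algHom_ext (fun b ↦ by simp [mapAlg_inB, h₁]) (fun m ↦ by simp [mapAlg_inM, h₂])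
  exact DFunLike.congr_fun this x

theorem gradedIso (he : h.EquivAlong h') : GradedIso (degree h) (degree h') := by
  obtain ⟨φ, f, hf⟩ := he
  exact gradedIso_of_inverse (map hf) (map hf.symm)
    (map_map_symm _ _ (by simp) (by simp)) (map_map_symm _ _ (by simp) (by simp))
    (fun n _ ↦ map_mem_degree hf n) (fun n _ ↦ map_mem_degree hf.symm n)

/-- The higher degrees carry no further information: an isomorphism in degrees zero and one extends
by the universal property. -/
theorem gradedIso_iff : GradedIso (degree h) (degree h') ↔ h.EquivAlong h' :=
  ⟨(lowDegrees h).equivAlong (lowDegrees h'), gradedIso⟩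

end TensorHopf
end TensorHopf

/-! ### Words: products of degrees zero and one, the equality `M □ B = M`, and functoriality. -/

section WordsMap

variable {k : Type*} [Field k]
variable {B : Type*} [Ring B] [Bialgebra k B] {M : Type*} [AddCommGroup M] [Module k M]
variable {B' : Type*} [Ring B'] [Bialgebra k B'] {M' : Type*} [AddCommGroup M'] [Module k M']
variable {h : HopfBimodule k B M} {h' : HopfBimodule k B' M'}

namespace Words

/-- This is the counit axiom of the right coaction: `inM` embeds `M` through `δ⁺`, and `toM` applies
the counit to the last entry. -/
theorem toM_inM (m : M) : toM h (inM h m) = m := by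
  have e := congrArg (TensorProduct.rid k M) (h.counitR m)
  rw [← uncons_inM, ← LinearMap.lTensor_comp_apply, TensorProduct.rid_tmul, one_smul] at e
  exact e

/-- The multiplication is known through its recursion: the first letter of a product is given by
`mulM` and the remainder by the product again. On tensors of degree zero `mulM` vanishes, so only
the degree zero term is left. -/
theorem inB_mul_inB (a b : B) : inB h a * inB h b = inB h (a * b) := by
  rw [mul_def, mulL_isExtension, TensorProduct.comul_tmul, comul_eq, comul_inB, comul_inB]
  suffices H : ∀ x y, TensorProduct.map (mulM h) (mulL h)
      (TensorProduct.AlgebraTensorModule.tensorTensorTensorComm k k k k _ _ _ _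
        (TensorProduct.map (inB h) (inB h) x ⊗ₜ TensorProduct.map (inB h) (inB h) y)) = 0 by
    rw [H]; simp
  intro x y
  induction x with
  | zero => simp
  | add x y hx hy => simp only [map_add, TensorProduct.add_tmul, hx, hy, add_zero]
  | tmul a b =>
    induction y with
    | zero => simp
    | add x y hx hy => simp only [map_add, TensorProduct.tmul_add, hx, hy, add_zero]
    | tmul c d => simp

/-- In the recursion for the product, `Δ (inM m)` splits into the parts coming from `δ⁻` and `δ⁺`.
On the first, `mulM` meets two elements of degree zero and vanishes (`H₁`). The second yields `b₍₁₎
m₍₀₎ ⊗ b₍₂₎ m₍₁₎` (`H₂`), which is `δ⁺ (b m)` because the right coaction is a map of left modules.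
-/
theorem inB_mul_inM (b : B) (m : M) : inB h b * inM h m = inM h (h.actL b m) := by
  rw [mul_def, mulL_isExtension, TensorProduct.comul_tmul, comul_eq, comul_inB,
    CotensorHopf.words_comul_inM, mulB_tmul, toB_inM, mul_zero, map_zero, zero_add,
    TensorProduct.tmul_add, map_add, map_add]
  have H₁ : ∀ x y, TensorProduct.map (mulM h) (mulL h)
      (TensorProduct.AlgebraTensorModule.tensorTensorTensorComm k k k k _ _ _ _
        (TensorProduct.map (inB h) (inB h) x ⊗ₜ TensorProduct.map (inB h) (inM h) y)) = 0 := by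
    intro x y
    induction x with
    | zero => simp
    | add x y hx hy => simp only [map_add, TensorProduct.add_tmul, hx, hy, add_zero]
    | tmul a b =>
      induction y with
      | zero => simp
      | add x y hx hy => simp only [map_add, TensorProduct.tmul_add, hx, hy, add_zero]
      | tmul c d => simp
  have H₂ : ∀ x y, TensorProduct.map (mulM h) (mulL h)
      (TensorProduct.AlgebraTensorModule.tensorTensorTensorComm k k k k _ _ _ _
        (TensorProduct.map (inB h) (inB h) x ⊗ₜ TensorProduct.map (inM h) (inB h) y)) =
      (inB h).lTensor M (TensorProduct.map₂ h.actL (LinearMap.mul k B) x y) := by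
    intro x y
    induction x with
    | zero => simp
    | add x y hx hy => simp only [map_add, TensorProduct.add_tmul, hx, hy, LinearMap.add_apply]
    | tmul a b =>
      induction y with
      | zero => simp
      | add x y hx hy => simp only [map_add, TensorProduct.tmul_add, hx, hy]
      | tmul c d => simp [toM_inM, ← mul_def, inB_mul_inB]
  rw [H₁, H₂, zero_add, ← h.coactR_actL]
  rfl

/-- Mirror image of the previous argument, now ending with the compatibility of the right coaction
with the right action. -/
theorem inM_mul_inB (m : M) (b : B) : inM h m * inB h b = inM h (h.actR m b) := by
  rw [mul_def, mulL_isExtension, TensorProduct.comul_tmul, comul_eq, comul_inB,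
    CotensorHopf.words_comul_inM, mulB_tmul, toB_inM, zero_mul, map_zero, zero_add,
    TensorProduct.add_tmul, map_add, map_add]
  have H₁ : ∀ x y, TensorProduct.map (mulM h) (mulL h)
      (TensorProduct.AlgebraTensorModule.tensorTensorTensorComm k k k k _ _ _ _
        (TensorProduct.map (inB h) (inM h) x ⊗ₜ TensorProduct.map (inB h) (inB h) y)) = 0 := by
    intro x y
    induction x with
    | zero => simp
    | add x y hx hy => simp only [map_add, TensorProduct.add_tmul, hx, hy, add_zero]
    | tmul a b =>
      induction y with
      | zero => simp
      | add x y hx hy => simp only [map_add, TensorProduct.tmul_add, hx, hy, add_zero]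
      | tmul c d => simp
  have H₂ : ∀ x y, TensorProduct.map (mulM h) (mulL h)
      (TensorProduct.AlgebraTensorModule.tensorTensorTensorComm k k k k _ _ _ _
        (TensorProduct.map (inM h) (inB h) x ⊗ₜ TensorProduct.map (inB h) (inB h) y)) =
      (inB h).lTensor M (TensorProduct.map₂ h.actR (LinearMap.mul k B) x y) := by
    intro x y
    induction x with
    | zero => simp
    | add x y hx hy => simp only [map_add, TensorProduct.add_tmul, hx, hy, LinearMap.add_apply]
    | tmul a b =>
      induction y with
      | zero => simp
      | add x y hx hy => simp only [map_add, TensorProduct.tmul_add, hx, hy]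
      | tmul c d => simp [toM_inM, ← mul_def, inB_mul_inB]
  rw [H₁, H₂, zero_add, ← h.coactR_actR]
  rfl

theorem eq_lift_uncons_of_mem_degree_one {x : Words h} (hx : x ∈ degree h 1) :
    x = TensorProduct.lift (cons h) ((inB h).lTensor M ((toB h).lTensor M (uncons h x))) := by
  have : degree h 1 ≤ LinearMap.eqLocus LinearMap.id (TensorProduct.lift (cons h) ∘ₗ
      (inB h).lTensor M ∘ₗ (toB h).lTensor M ∘ₗ uncons h) := by
    refine Submodule.map₂_le.mpr ?_
    rintro m _ _ ⟨b, rfl⟩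
    simp
  exact this hx

/-- This is the equality `M □ B = M`. A word `x` of degree one is determined by its first letter and
last entry, and these are read off from `(toM ⊗ toB) (Δ x)`. Membership in the cotensor product
makes this tensor equal to `δ⁺ (toM x)`, which is how `inM` embeds `toM x`. -/
theorem inM_toM_of_mem_degree_one {x : Words h} (hx : x ∈ degree h 1) (hc : x ∈ cotensor h) :
    inM h (toM h x) = x := by
  have e₁ := map_toM_toB (⟨x, hc⟩ : cotensor h)
  simp only at e₁
  have e₂ := eq_lift_uncons_of_mem_degree_one hx
  rw [← map_toM_id, LinearMap.lTensor_map, LinearMap.comp_id, e₁] at e₂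
  exact e₂.symm

theorem inM_mem_degree (m : M) : inM h m ∈ degree h 1 := by
  rw [inM, LinearMap.comp_apply, LinearMap.comp_apply]
  induction h.coactR m with
  | zero => simp
  | add x y hx hy => simp only [map_add]; exact add_mem hx hy
  | tmul m b =>
    have hb : inB h b ∈ degree h 0 := ⟨b, rfl⟩
    exact Submodule.apply_mem_map₂ (cons h) Submodule.mem_top hb

section map

variable {φ : B →ₐc[k] B'} {f : M →ₗ[k] M'}

variable (h h' φ f) in
/-- The map on words which applies `f` to the letters and `φ` to the last entry. -/
def mapLin : Words h →ₗ[k] Words h' :=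
  recL (inB h' ∘ₗ (φ : B →ₗ[k] B'))
    (LinearMap.mk₂ k (fun m x ↦ cons h' (f m) x.2) (by intros; simp) (by intros; simp)
      (by intros; simp) (by intros; simp))

@[simp] theorem mapLin_inB (b : B) : mapLin h h' φ f (inB h b) = inB h' (φ b) := recL_inB _ _ _
@[simp] theorem mapLin_cons (m : M) (w : Words h) :
    mapLin h h' φ f (cons h m w) = cons h' (f m) (mapLin h h' φ f w) := recL_cons _ _ _ _

theorem toB_mapLin (w : Words h) : toB h' (mapLin h h' φ f w) = φ (toB h w) := by
  refine LinearMap.congr_fun (f := toB h' ∘ₗ mapLin h h' φ f) (g := (φ : B →ₗ[k] B') ∘ₗ toB h)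
    (hom_ext ?_ ?_) w
  · intro b; simp
  · intro m w _; simp

theorem toM_mapLin (w : Words h) : toM h' (mapLin h h' φ f w) = f (toM h w) := by
  refine LinearMap.congr_fun (f := toM h' ∘ₗ mapLin h h' φ f) (g := f ∘ₗ toM h)
    (hom_ext ?_ ?_) w
  · intro b; simp
  · intro m w _; simp [toB_mapLin]

theorem mapLin_mem_degree (n : ℕ) {x : Words h} (hx : x ∈ degree h n) :
    mapLin h h' φ f x ∈ degree h' n := by
  induction n generalizing x with
  | zero =>
    obtain ⟨b, rfl⟩ := hx
    exact ⟨_, (mapLin_inB b).symm⟩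
  | succ n ih =>
    have : degree h (n + 1) ≤ (degree h' (n + 1)).comap (mapLin h h' φ f) :=
      Submodule.map₂_le.mpr fun m _ w hw ↦ by
        rw [Submodule.mem_comap, mapLin_cons]
        exact Submodule.apply_mem_map₂ _ trivial (ih hw)
    exact this hx

theorem mapLin_mapLin {ψ : B' →ₐc[k] B} {g : M' →ₗ[k] M} (h₁ : ∀ b, ψ (φ b) = b)
    (h₂ : ∀ m, g (f m) = m) (x : Words h) : mapLin h' h ψ g (mapLin h h' φ f x) = x := by
  refine LinearMap.congr_fun (f := mapLin h' h ψ g ∘ₗ mapLin h h' φ f) (g := LinearMap.id)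
    (hom_ext ?_ ?_) x
  · intro b; simp [h₁]
  · intro m w hw
    simp only [LinearMap.comp_apply, LinearMap.id_apply] at hw
    simp [h₂, hw]

variable (hf : h.IsHomAlong h' φ f)

/-- The map on words as a morphism of coalgebras. -/
def mapCoalg : Words h →ₗc[k] Words h' where
  toLinearMap := mapLin h h' φ f
  counit_comp := LinearMap.ext fun w ↦ by simp [counit_eq, toB_mapLin]
  map_comp_comul := by
    rw [comul_eq, comul_eq]
    refine hom_ext ?_ ?_
    · intro b
      simp only [LinearMap.comp_apply, comul_inB, mapLin_inB, TensorProduct.map_map]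
      rw [← CoalgHomClass.map_comp_comul_apply φ, TensorProduct.map_map]
      congr 2 <;> ext <;> simp
    · intro m w hw
      simp only [LinearMap.comp_apply] at hw
      simp only [LinearMap.comp_apply, comul_cons, mapLin_cons, map_add]
      -- The cut before the first letter involves only the left coaction of that letter, which `f`
      -- respects. The later cuts are covered by the induction hypothesis.
      congr 1
      · rw [hf.map_coactL, TensorProduct.map_map, TensorProduct.map_map]
        congr 2 <;> ext <;> simp
      · rw [← hw]
        generalize comul h w = z
        induction z with
        | zero => simp
        | add x y hx hy => simp only [map_add, hx, hy]
        | tmul a b => simp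

include hf in
-- Both sides are coalgebra maps from `Words h ⊗ Words h` to words, hence determined by their
-- components in degrees zero and one. There the multiplication is the product of `B` and the two
-- actions, which `φ` and `f` respect.
theorem mapLin_mul (x y : Words h) :
    mapLin h h' φ f (x * y) = mapLin h h' φ f x * mapLin h h' φ f y := by
  have : (mapCoalg hf).comp (mulHom h) =
      (mulHom h').comp (Coalgebra.TensorProduct.map (mapCoalg hf) (mapCoalg hf)) := by
    apply coalgHom_ext
    · intro d
      induction d with
      | zero => simp
      | add x y hx hy => simp only [map_add, hx, hy]
      | tmul x y =>
        change toB h' (mapLin h h' φ f (x * y)) =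
          toB h' (mapLin h h' φ f x * mapLin h h' φ f y)
        simp only [toB_mul, toB_mapLin, map_mul]
    · intro d
      induction d with
      | zero => simp
      | add x y hx hy => simp only [map_add, hx, hy]
      | tmul x y =>
        change toM h' (mapLin h h' φ f (x * y)) =
          toM h' (mapLin h h' φ f x * mapLin h h' φ f y)
        simp only [toM_mul, toB_mapLin, toM_mapLin, map_add, hf.map_actL, hf.map_actR]
  exact DFunLike.congr_fun this (x ⊗ₜ y)

include hf in
-- By `mem_cotensor_of_coalgHom` the cotensor conditions at all places of a word reduce to one
-- identity between the right coaction and the components of degrees zero and one. That identity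
-- holds on `cotensor h` by `map_toM_toB`, and `φ` and `f` transport it.
theorem mapLin_mem_cotensor {x : Words h} (hx : x ∈ cotensor h) :
    mapLin h h' φ f x ∈ cotensor h' := by
  refine mem_cotensor_of_coalgHom ((mapCoalg hf).comp cotensorIncl) (fun d ↦ ?_)
    (⟨x, hx⟩ : cotensor h)
  have e₁ : toM h' ∘ₗ ((mapCoalg hf).comp cotensorIncl).toLinearMap =
      f ∘ₗ toM h ∘ₗ (cotensor h).subtype := LinearMap.ext fun w ↦ toM_mapLin _
  have e₂ : toB h' ∘ₗ ((mapCoalg hf).comp cotensorIncl).toLinearMap =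
      (φ : B →ₗ[k] B') ∘ₗ toB h ∘ₗ (cotensor h).subtype := LinearMap.ext fun w ↦ toB_mapLin _
  have e₃ : toM h' (((mapCoalg hf).comp cotensorIncl) d) = f (toM h d) := toM_mapLin _
  have e₄ := CoalgHomClass.map_comp_comul_apply (cotensorIncl (h := h)) d
  have e₅ := map_toM_toB d
  rw [e₁, e₂, e₃, hf.map_coactR, ← e₅, ← TensorProduct.map_map, ← TensorProduct.map_map]
  exact congrArg _ (congrArg _ e₄)

end map

end Words
end WordsMap

/-! ### The cotensor Hopf algebra: its low degrees and functoriality. -/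

section CotensorMap

variable {k : Type*} [Field k]
variable {B : Type*} [Ring B] [Bialgebra k B] {M : Type*} [AddCommGroup M] [Module k M]
variable {B' : Type*} [Ring B'] [Bialgebra k B'] {M' : Type*} [AddCommGroup M'] [Module k M']
variable {h : HopfBimodule k B M} {h' : HopfBimodule k B' M'}

namespace CotensorHopf

theorem val_mul (x y : CotensorHopf h) : val h (x * y) = val h x * val h y := rfl
theorem counit_def (x : CotensorHopf h) :
    Coalgebra.counit (R := k) x = Coalgebra.counit (R := k) (Words.toB h (val h x)) := rfl

variable (h) in
/-- The inclusion of `B` as a morphism of algebras. -/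
def inBAlg : B →ₐ[k] CotensorHopf h :=
  AlgHom.ofLinearMap (inB h) rfl
    (fun a b ↦ val_injective (by rw [val_mul]; exact (Words.inB_mul_inB a b).symm))

variable (h) in
/-- The components of degree zero and one of the cotensor bialgebra. -/
def lowDegrees : LowDegrees h (degree h) where
  inB := inBAlg h
  inM := inM h
  toB := Words.toB h ∘ₗ val h
  toM := Words.toM h ∘ₗ val h
  toB_inB b := Words.toB_inB h b
  toM_inM m := Words.toM_inM m
  toB_inM m := Words.toB_inM m
  toM_inB b := Words.toM_inB h b
  counit_inB b := congrArg _ (Words.toB_inB h b)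
  comul_inB := comul_inB
  comul_inM := comul_inM
  inB_mul_inM b m := val_injective (Words.inB_mul_inM b m)
  inM_mul_inB m b := val_injective (Words.inM_mul_inB m b)
  range_inB := by
    refine le_antisymm ?_ ?_
    · rintro _ ⟨b, rfl⟩
      exact ⟨b, rfl⟩
    · rintro x ⟨b, hb⟩
      exact ⟨b, val_injective hb⟩
  range_inM := by
    -- Here the cotensor condition is essential: in the ambient space of words the component of
    -- degree one is all of `M ⊗ B`.
    refine le_antisymm ?_ fun x hx ↦
      ⟨Words.toM h (val h x), val_injective (Words.inM_toM_of_mem_degree_one hx x.2)⟩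
    rintro _ ⟨m, rfl⟩
    exact Words.inM_mem_degree m

section map

variable {φ : B →ₐc[k] B'} {f : M →ₗ[k] M'} (hf : h.IsHomAlong h' φ f)

/-- The linear map induced on cotensor coalgebras. -/
def mapLin : CotensorHopf h →ₗ[k] CotensorHopf h' :=
  (Words.mapLin h h' φ f ∘ₗ val h).codRestrict (Words.cotensor h')
    fun x ↦ Words.mapLin_mem_cotensor hf x.2

theorem val_mapLin (x : CotensorHopf h) :
    val h' (mapLin hf x) = Words.mapLin h h' φ f (val h x) := rfl

theorem val_comp_mapLin : val h' ∘ₗ mapLin hf = Words.mapLin h h' φ f ∘ₗ val h := rfl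

/-- The bialgebra map induced on cotensor bialgebras. -/
def map : CotensorHopf h →ₐc[k] CotensorHopf h' where
  toLinearMap := mapLin hf
  counit_comp := LinearMap.ext fun x ↦ by
    rw [LinearMap.comp_apply, counit_def, counit_def, val_mapLin, Words.toB_mapLin]
    exact CoalgHomClass.counit_comp_apply φ _
  map_comp_comul := LinearMap.ext fun x ↦ by
    -- Over a field the tensor square of an injective map is injective, so the identity can be
    -- checked among words, where it holds by `mapCoalg`.
    apply map_val_injective
    rw [LinearMap.comp_apply, LinearMap.comp_apply, map_val_comul, TensorProduct.map_map,
      val_comp_mapLin, ← TensorProduct.map_map, map_val_comul, val_mapLin]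
    exact CoalgHomClass.map_comp_comul_apply (Words.mapCoalg hf) (val h x)
  map_one' := val_injective <| by
    change Words.mapLin h h' φ f (Words.inB h 1) = Words.inB h' 1
    rw [Words.mapLin_inB, map_one]
  map_mul' x y := val_injective (Words.mapLin_mul hf (val h x) (val h y))

theorem map_inB (b : B) : map hf (inB h b) = inB h' (φ b) :=
  val_injective (Words.mapLin_inB b)

include hf in
-- `M` sits among the words through its right coaction, so this is compatibility of `f` and `φ` with
-- `δ⁺`.
theorem words_mapLin_inM (m : M) : Words.mapLin h h' φ f (Words.inM h m) = Words.inM h' (f m) := by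
  simp only [Words.inM, LinearMap.comp_apply, hf.map_coactR]
  generalize h.coactR m = z
  induction z with
  | zero => simp
  | add x y hx hy => simp only [map_add, hx, hy]
  | tmul a b => simp

theorem map_inM (m : M) : map hf (inM h m) = inM h' (f m) :=
  val_injective (words_mapLin_inM hf m)

theorem map_mem_degree (n : ℕ) {x : CotensorHopf h} (hx : x ∈ degree h n) :
    map hf x ∈ degree h' n := Words.mapLin_mem_degree n hx

/-- The generators from `B` and `M` go to generators, so the induced map restricts to the one-type
subalgebras. -/
theorem map_mem_oneType {x : CotensorHopf h} (hx : x ∈ oneType h) : map hf x ∈ oneType h' := by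
  have : oneType h ≤ (oneType h').comap (map hf : CotensorHopf h →ₐ[k] CotensorHopf h') := by
    refine Algebra.adjoin_le ?_
    rintro _ (⟨b, rfl⟩ | ⟨m, rfl⟩)
    · exact Algebra.subset_adjoin (Or.inl ⟨φ b, (map_inB hf b).symm⟩)
    · exact Algebra.subset_adjoin (Or.inr ⟨f m, (map_inM hf m).symm⟩)
  exact this hx

end map

theorem map_map_symm {φ : B →ₐc[k] B'} {f : M →ₗ[k] M'} (hf : h.IsHomAlong h' φ f)
    {ψ : B' →ₐc[k] B} {g : M' →ₗ[k] M} (hg : h'.IsHomAlong h ψ g)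
    (h₁ : ∀ b, ψ (φ b) = b) (h₂ : ∀ m, g (f m) = m) (x : CotensorHopf h) :
    map hg (map hf x) = x :=
  val_injective (Words.mapLin_mapLin h₁ h₂ (val h x))

theorem gradedIso (he : h.EquivAlong h') : GradedIso (degree h) (degree h') := by
  obtain ⟨φ, f, hf⟩ := he
  exact gradedIso_of_inverse (map hf) (map hf.symm)
    (map_map_symm _ _ (by simp) (by simp)) (map_map_symm _ _ (by simp) (by simp))
    (fun n _ ↦ map_mem_degree hf n) (fun n _ ↦ map_mem_degree hf.symm n)

theorem gradedIso_iff : GradedIso (degree h) (degree h') ↔ h.EquivAlong h' :=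
  ⟨(lowDegrees h).equivAlong (lowDegrees h'), gradedIso⟩

end CotensorHopf

/-! ### The one-type Hopf algebra `B[M]`, by restriction from the cotensor Hopf algebra. -/

namespace OneTypeHopf

variable (h) in
/-- The inclusion in the cotensor bialgebra. -/
def val : OneTypeHopf h →ₐ[k] CotensorHopf h := (CotensorHopf.oneType h).val

theorem val_injective : Function.Injective (val h) := Subtype.val_injective

theorem map_val_injective :
    Function.Injective (TensorProduct.map (val h).toLinearMap (val h).toLinearMap) :=
  TensorProduct.map_injective_of_flat_flat _ _ val_injective val_injective

theorem map_val_comul (x : OneTypeHopf h) :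
    TensorProduct.map (val h).toLinearMap (val h).toLinearMap (Coalgebra.comul x) =
      Coalgebra.comul (R := k) (val h x) :=
  map_subComul (CotensorHopf.oneType h).val.toLinearMap Subtype.val_injective
    CotensorHopf.comul_mem_oneType x

variable (h) in
/-- The inclusion of `B` in degree zero. -/
def inB : B →ₐ[k] OneTypeHopf h :=
  (CotensorHopf.inBAlg h).codRestrict (CotensorHopf.oneType h)
    fun b ↦ Algebra.subset_adjoin (Or.inl ⟨b, rfl⟩)

variable (h) in
/-- The inclusion of `M` in degree one. -/
def inM : M →ₗ[k] OneTypeHopf h :=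
  (CotensorHopf.inM h).codRestrict (Subalgebra.toSubmodule (CotensorHopf.oneType h))
    fun m ↦ Algebra.subset_adjoin (Or.inr ⟨m, rfl⟩)

variable (h) in
/-- The components of degree zero and one of the one-type bialgebra. -/
def lowDegrees : LowDegrees h (degree h) where
  inB := inB h
  inM := inM h
  toB := (CotensorHopf.lowDegrees h).toB ∘ₗ (val h).toLinearMap
  toM := (CotensorHopf.lowDegrees h).toM ∘ₗ (val h).toLinearMap
  toB_inB := (CotensorHopf.lowDegrees h).toB_inB
  toM_inM := (CotensorHopf.lowDegrees h).toM_inM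
  toB_inM := (CotensorHopf.lowDegrees h).toB_inM
  toM_inB := (CotensorHopf.lowDegrees h).toM_inB
  counit_inB := (CotensorHopf.lowDegrees h).counit_inB
  comul_inB b := map_val_injective <| by
    rw [map_val_comul, TensorProduct.map_map]
    exact (CotensorHopf.lowDegrees h).comul_inB b
  comul_inM m := map_val_injective <| by
    rw [map_val_comul, map_add, TensorProduct.map_map, TensorProduct.map_map]
    exact (CotensorHopf.lowDegrees h).comul_inM m
  inB_mul_inM b m := val_injective ((CotensorHopf.lowDegrees h).inB_mul_inM b m)
  inM_mul_inB m b := val_injective ((CotensorHopf.lowDegrees h).inM_mul_inB m b)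
  -- `B[M]` already contains all of `B` and `M`, so its components of degrees zero and one are those
  -- of the cotensor Hopf algebra.
  range_inB := by
    refine le_antisymm ?_ fun x hx ↦
      ⟨_, val_injective ((CotensorHopf.lowDegrees h).inB_toB hx)⟩
    rintro _ ⟨b, rfl⟩
    exact (CotensorHopf.lowDegrees h).range_inB.le ⟨b, rfl⟩
  range_inM := by
    refine le_antisymm ?_ fun x hx ↦
      ⟨_, val_injective ((CotensorHopf.lowDegrees h).inM_toM hx)⟩
    rintro _ ⟨b, rfl⟩
    exact (CotensorHopf.lowDegrees h).range_inM.le ⟨b, rfl⟩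

section map

variable {φ : B →ₐc[k] B'} {f : M →ₗ[k] M'} (hf : h.IsHomAlong h' φ f)

/-- The algebra map induced on one-type bialgebras. -/
def mapAlg : OneTypeHopf h →ₐ[k] OneTypeHopf h' :=
  ((CotensorHopf.map hf : CotensorHopf h →ₐ[k] CotensorHopf h').comp (val h)).codRestrict
    (CotensorHopf.oneType h') fun x ↦ CotensorHopf.map_mem_oneType hf x.2

/-- The bialgebra map induced on one-type bialgebras. -/
def map : OneTypeHopf h →ₐc[k] OneTypeHopf h' where
  toLinearMap := (mapAlg hf).toLinearMap
  counit_comp := LinearMap.ext fun x ↦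
    CoalgHomClass.counit_comp_apply (CotensorHopf.map hf) (val h x)
  map_comp_comul := LinearMap.ext fun x ↦ by
    have e : (val h').toLinearMap ∘ₗ (mapAlg hf).toLinearMap =
      (CotensorHopf.map hf : CotensorHopf h →ₗ[k] CotensorHopf h') ∘ₗ (val h).toLinearMap := rfl
    apply map_val_injective
    rw [LinearMap.comp_apply, LinearMap.comp_apply, map_val_comul, TensorProduct.map_map,
      e, ← TensorProduct.map_map, map_val_comul]
    exact CoalgHomClass.map_comp_comul_apply (CotensorHopf.map hf) (val h x)
  map_one' := map_one (mapAlg hf)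
  map_mul' := map_mul (mapAlg hf)

theorem map_mem_degree (n : ℕ) {x : OneTypeHopf h} (hx : x ∈ degree h n) :
    map hf x ∈ degree h' n := CotensorHopf.map_mem_degree hf n hx

end map

theorem map_map_symm {φ : B →ₐc[k] B'} {f : M →ₗ[k] M'} (hf : h.IsHomAlong h' φ f)
    {ψ : B' →ₐc[k] B} {g : M' →ₗ[k] M} (hg : h'.IsHomAlong h ψ g)
    (h₁ : ∀ b, ψ (φ b) = b) (h₂ : ∀ m, g (f m) = m) (x : OneTypeHopf h) :
    map hg (map hf x) = x :=
  val_injective (CotensorHopf.map_map_symm hf hg h₁ h₂ (val h x))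

theorem gradedIso (he : h.EquivAlong h') : GradedIso (degree h) (degree h') := by
  obtain ⟨φ, f, hf⟩ := he
  exact gradedIso_of_inverse (map hf) (map hf.symm)
    (map_map_symm _ _ (by simp) (by simp)) (map_map_symm _ _ (by simp) (by simp))
    (fun n _ ↦ map_mem_degree hf n) (fun n _ ↦ map_mem_degree hf.symm n)

theorem gradedIso_iff : GradedIso (degree h) (degree h') ↔ h.EquivAlong h' :=
  ⟨(lowDegrees h).equivAlong (lowDegrees h'), gradedIso⟩

end OneTypeHopf
end CotensorMap

/-! ### Bialgebra isomorphisms of `kG` and of `(kG)^*` come from group isomorphisms. -/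

section GroupFunEquiv

set_option linter.unusedSectionVars false

variable {k : Type*} [Field k]
variable {G : Type*} [Group G] [Fintype G] [DecidableEq G]
variable {G' : Type*} [Group G'] [Fintype G'] [DecidableEq G']

/-- The group-like elements of `kG` are exactly the elements of `G`, and bialgebra maps preserve
group-likes. Functoriality of this restriction makes `φ` and its inverse give inverse homomorphisms.
-/
theorem exists_mulEquiv_of_monoidAlgebra_bialgEquiv
    (φ : MonoidAlgebra k G ≃ₐc[k] MonoidAlgebra k G') :
    ∃ σ : G ≃* G', ∀ g, φ (MonoidAlgebra.single g 1) = MonoidAlgebra.single (σ g) 1 := by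
  let σ := MonoidAlgebra.mapDomainOfBialgHom (φ : MonoidAlgebra k G →ₐc[k] MonoidAlgebra k G')
  let τ := MonoidAlgebra.mapDomainOfBialgHom (φ.symm : MonoidAlgebra k G' →ₐc[k] MonoidAlgebra k G)
  refine ⟨MonoidHom.toMulEquiv σ τ ?_ ?_, fun g ↦ ?_⟩
  · rw [← MonoidAlgebra.mapDomainOfBialgHom_comp, BialgEquiv.symm_comp,
      MonoidAlgebra.mapDomainOfBialgHom_id]
  · rw [← MonoidAlgebra.mapDomainOfBialgHom_comp, BialgEquiv.comp_symm,
      MonoidAlgebra.mapDomainOfBialgHom_id]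
  · exact (MonoidAlgebra.single_mapDomainOfBialgHom
      (φ : MonoidAlgebra k G →ₐc[k] MonoidAlgebra k G') g 1).symm

namespace GroupFun

/-- The idempotents `δ_g` sum to `1`, so some `χ(δ_g)` is nonzero. Applying `χ` to `f δ_g = f(g)
δ_g` and cancelling gives `χ(f) = f(g)`. -/
theorem exists_algHom_eq_eval (χ : GroupFun k G →ₐ[k] k) : ∃ g, ∀ f, χ f = eval g f := by
  obtain ⟨g, hg⟩ : ∃ g, χ (delta g) ≠ 0 := by
    by_contra! H
    have h₁ := map_one χ
    rw [← sum_delta, map_sum, Finset.sum_eq_zero fun g _ ↦ H g] at h₁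
    exact zero_ne_one h₁
  refine ⟨g, fun f ↦ mul_right_cancel₀ hg ?_⟩
  rw [← map_mul, mul_delta, map_smul, smul_eq_mul]

theorem ext_eval {a b : GroupFun k G} (h : ∀ x, eval x a = eval x b) : a = b := funext h

theorem eq_of_eval_eq {x y : G} (h : ∀ f : GroupFun k G, eval x f = eval y f) : x = y := by
  have := h (delta x)
  rw [eval_delta, eval_delta, if_pos rfl] at this
  by_contra H
  rw [if_neg H] at this
  exact one_ne_zero this

/-- Evaluation at a point as a morphism of algebras. -/
def evalAlg (x : G) : GroupFun k G →ₐ[k] k := Pi.evalAlgHom k (fun _ : G ↦ k) x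

/-- The comultiplication is dual to the group law, so points are recovered from `(kG)^*` together
with their product: convolution of characters is multiplication of points. -/
theorem map_eval_comul (x y : G) (f : GroupFun k G) :
    TensorProduct.lid k k (TensorProduct.map (eval x) (eval y) (Coalgebra.comul f)) =
      eval (x * y) f := by
  rw [comul_def, map_sum, map_sum, Finset.sum_eq_single x]
  · simp [eval_delta, eval_shift]
  · intro z _ hz
    simp [eval_delta, hz]
  · simp

/-- Precomposing an evaluation with `φ` gives a character, hence an evaluation; this defines `τ`,
contravariantly. It is multiplicative because `φ` respects `Δ` and thereby convolution. -/
theorem exists_monoidHom (φ : GroupFun k G →ₐc[k] GroupFun k G') :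
    ∃ τ : G' → G, (∀ x y, τ (x * y) = τ x * τ y) ∧ ∀ x f, eval x (φ f) = eval (τ x) f := by
  choose τ hτ using fun x ↦
    exists_algHom_eq_eval ((evalAlg x).comp (φ : GroupFun k G →ₐ[k] GroupFun k G'))
  have hτ' : ∀ x f, eval x (φ f) = eval (τ x) f := hτ
  refine ⟨τ, fun x y ↦ eq_of_eval_eq (k := k) fun f ↦ ?_, hτ'⟩
  have e (x) : eval x ∘ₗ (φ : GroupFun k G →ₗ[k] GroupFun k G') = eval (τ x) :=
    LinearMap.ext (hτ' x)
  rw [← hτ', ← map_eval_comul, ← CoalgHomClass.map_comp_comul_apply, TensorProduct.map_map, e, e,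
    map_eval_comul]

theorem exists_mulEquiv_of_bialgEquiv (φ : GroupFun k G ≃ₐc[k] GroupFun k G') :
    ∃ σ : G ≃* G', ∀ g, φ (delta g) = delta (σ g) := by
  obtain ⟨τ, hτ, hτ'⟩ := exists_monoidHom (φ : GroupFun k G →ₐc[k] GroupFun k G')
  obtain ⟨υ, -, hυ'⟩ := exists_monoidHom (φ.symm : GroupFun k G' →ₐc[k] GroupFun k G)
  have h₁ (x) : τ (υ x) = x := eq_of_eval_eq (k := k) fun f ↦ by
    rw [← hτ', ← hυ']; simp
  have h₂ (x) : υ (τ x) = x := eq_of_eval_eq (k := k) fun f ↦ by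
    rw [← hυ', ← hτ']; simp
  let σ : G' ≃* G := ⟨⟨τ, υ, h₂, h₁⟩, hτ⟩
  -- The function `φ(δ_g)` sends `x` to `δ_g(τ x)`, so it is the delta function at the preimage of
  -- `g` under `τ`; hence the inverse is taken.
  refine ⟨σ.symm, fun g ↦ ext_eval fun x ↦ (hτ' x _).trans ?_⟩
  change eval (σ x) _ = _
  rw [eval_delta, eval_delta]
  exact if_congr (by rw [MulEquiv.symm_apply_eq]) rfl rfl

/-- The morphism of algebras induced by an isomorphism of groups. -/
def congrAlg (σ : G ≃* G') : GroupFun k G ≃ₐ[k] GroupFun k G' :=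
  AlgEquiv.piCongrLeft' k (fun _ ↦ k) σ.toEquiv

theorem congrAlg_delta (σ : G ≃* G') (g : G) : congrAlg σ (delta g : GroupFun k G) = delta (σ g) :=
  ext_eval fun x ↦ by
    change eval (σ.symm x) (delta g : GroupFun k G) = _
    rw [eval_delta, eval_delta]
    exact if_congr (by rw [MulEquiv.eq_symm_apply]) rfl rfl

/-- The isomorphism of bialgebras induced by an isomorphism of groups. -/
def congr (σ : G ≃* G') : GroupFun k G ≃ₐc[k] GroupFun k G' :=
  .ofAlgEquiv (congrAlg σ)
    (AlgHom.toLinearMap_injective <| hom_ext fun g ↦ by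
      change counit (congrAlg σ (delta g)) = counit (delta g)
      rw [congrAlg_delta, counit_delta, counit_delta]
      simp)
    (AlgHom.toLinearMap_injective <| hom_ext fun g ↦ by
      change TensorProduct.map (congrAlg σ).toLinearMap (congrAlg σ).toLinearMap (comul (delta g)) =
        comul (congrAlg σ (delta g))
      rw [congrAlg_delta, comul_delta, comul_delta, map_sum]
      refine Fintype.sum_equiv σ.toEquiv _ _ fun x ↦ ?_
      simp [congrAlg_delta])

theorem congr_delta (σ : G ≃* G') (g : G) : congr σ (delta g : GroupFun k G) = delta (σ g) :=
  congrAlg_delta σ g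

end GroupFun
end GroupFunEquiv

/-! ### Isomorphisms of arrow bimodules expressed by translations and endpoints. -/

section ArrowIso

set_option linter.unusedSectionVars false

namespace RSR

variable {k : Type*} [Field k]
variable {G : Type*} [Group G] [Fintype G] [DecidableEq G]
variable {G' : Type*} [Group G'] [Fintype G'] [DecidableEq G']
variable {R : RSR k G} {R' : RSR k G'}

/-- A linear isomorphism between the spans of the arrows of two Hopf quivers that is compatible
with an isomorphism of groups, the left translations, given right translations, and the
decompositions according to sources and targets. -/
structure ArrowIso (S : G → Module.End k (R.Arrow →₀ k)) (S' : G' → Module.End k (R'.Arrow →₀ k))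
    (σ : G ≃* G') (f : (R.Arrow →₀ k) ≃ₗ[k] (R'.Arrow →₀ k)) : Prop where
  map_mulL : ∀ g m, f (mulL g m) = mulL (σ g) (f m)
  map_right : ∀ g m, f (S g m) = S' (σ g) (f m)
  map_src : ∀ x m, f (funAct Arrow.src m (GroupFun.delta x)) =
    funAct Arrow.src (f m) (GroupFun.delta (σ x))
  map_tgt : ∀ x m, f (funAct Arrow.tgt m (GroupFun.delta x)) =
    funAct Arrow.tgt (f m) (GroupFun.delta (σ x))

/-- A coaction of `kG` is a grading by `G`. Written as a sum over homogeneous components, two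
coactions can be compared coefficient by coefficient. -/
theorem coactTgt_eq_sum (m : R.Arrow →₀ k) : R.coactTgt m =
    ∑ y, MonoidAlgebra.single y 1 ⊗ₜ funAct Arrow.tgt m (GroupFun.delta y) := by
  induction m using emb_induction with
  | h0 => simp
  | ha x y hx hy => simp only [map_add, LinearMap.add_apply, hx, hy, TensorProduct.tmul_add,
      Finset.sum_add_distrib]
  | h x y C hC i v =>
    rw [coactTgt_emb, Finset.sum_eq_single y]
    · simp [funAct_tgt, GroupFun.eval_delta]
    · intro z _ hz
      simp [funAct_tgt, GroupFun.eval_delta, hz]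
    · simp

theorem coactSrc_eq_sum (m : R.Arrow →₀ k) : R.coactSrc m =
    ∑ x, funAct Arrow.src m (GroupFun.delta x) ⊗ₜ MonoidAlgebra.single x 1 := by
  induction m using emb_induction with
  | h0 => simp
  | ha x y hx hy => simp only [map_add, LinearMap.add_apply, hx, hy, TensorProduct.add_tmul,
      Finset.sum_add_distrib]
  | h x y C hC i v =>
    rw [coactSrc_emb, Finset.sum_eq_single x]
    · simp [funAct_src, GroupFun.eval_delta]
    · intro z _ hz
      simp [funAct_src, GroupFun.eval_delta, hz]
    · simp

/-- Two sums over a basis of the left factor agree exactly when all coefficients do. -/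
theorem sum_tmul_eq_iff {V A ι : Type*} [AddCommGroup V] [Module k V] [AddCommGroup A] [Module k A]
    [Fintype ι] [DecidableEq ι] (b : ι → A) (c : ι → A →ₗ[k] k)
    (hbc : ∀ i j, c i (b j) = if j = i then 1 else 0) (v w : ι → V) :
    ∑ i, b i ⊗ₜ[k] v i = ∑ i, b i ⊗ₜ[k] w i ↔ ∀ i, v i = w i := by
  refine ⟨fun H i ↦ ?_, fun H ↦ by simp only [H]⟩
  have := congrArg (TensorProduct.lid k V ∘ (c i).rTensor V) H
  simpa [map_sum, hbc] using this

theorem sum_tmul_eq_iff' {V A ι : Type*} [AddCommGroup V] [Module k V] [AddCommGroup A]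
    [Module k A] [Fintype ι] [DecidableEq ι] (b : ι → A) (c : ι → A →ₗ[k] k)
    (hbc : ∀ i j, c i (b j) = if j = i then 1 else 0) (v w : ι → V) :
    ∑ i, v i ⊗ₜ[k] b i = ∑ i, w i ⊗ₜ[k] b i ↔ ∀ i, v i = w i := by
  refine ⟨fun H i ↦ ?_, fun H ↦ by simp only [H]⟩
  have := congrArg (TensorProduct.rid k V ∘ (c i).lTensor V) H
  simpa [map_sum, hbc] using this

/-- The actions are tested on group elements, which gives the translations. The coactions are tested
on coefficients, which gives the decompositions by target and source. -/
theorem coarrow_isHomAlong_iff (t : R.CosetReps) (t' : R'.CosetReps)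
    {φ : MonoidAlgebra k G ≃ₐc[k] MonoidAlgebra k G'} {σ : G ≃* G'}
    (hφ : ∀ g, φ (MonoidAlgebra.single g 1) = MonoidAlgebra.single (σ g) 1)
    (f : (R.Arrow →₀ k) ≃ₗ[k] (R'.Arrow →₀ k)) :
    (coarrow t).IsHomAlong (coarrow t') φ f ↔ ArrowIso (mulR t) (mulR t') σ f := by
  -- The coordinate functionals of the basis of group elements.
  let c (i : G') : MonoidAlgebra k G' →ₗ[k] k :=
    Finsupp.lapply i ∘ₗ (MonoidAlgebra.coeffLinearEquiv k).toLinearMap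
  have hc (i j : G') : c i (MonoidAlgebra.single j 1) = if j = i then 1 else 0 :=
    Finsupp.single_apply
  have hact (A : MonoidAlgebra k G →ₗ[k] Module.End k (R.Arrow →₀ k))
      (A' : MonoidAlgebra k G' →ₗ[k] Module.End k (R'.Arrow →₀ k)) :
      (∀ b m, f (A b m) = A' (φ b) (f m)) ↔
      ∀ x m, f (A (MonoidAlgebra.single x 1) m) = A' (MonoidAlgebra.single (σ x) 1) (f m) := by
    refine ⟨fun H x m ↦ by rw [H, hφ], fun H b m ↦ ?_⟩
    refine LinearMap.congr_fun (f := f.toLinearMap ∘ₗ A.flip m)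
      (g := A'.flip (f m) ∘ₗ (φ : MonoidAlgebra k G →ₗ[k] MonoidAlgebra k G')) ?_ b
    exact MonoidAlgebra.lhom_ext' fun x ↦ LinearMap.ext_ring (by simp [H, hφ])
  have hL (m) : R'.coactTgt (f m) = TensorProduct.map
      (φ : MonoidAlgebra k G →ₗ[k] MonoidAlgebra k G') f.toLinearMap (R.coactTgt m) ↔
      ∀ g, f (funAct Arrow.tgt m (GroupFun.delta (σ.symm g))) =
        funAct Arrow.tgt (f m) (GroupFun.delta g) := by
    -- Reindexing along `σ` makes both sums run over the same basis of `kG'`.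
    rw [coactTgt_eq_sum, coactTgt_eq_sum, map_sum, ← σ.symm.toEquiv.sum_comp, eq_comm]
    simp only [TensorProduct.map_tmul]
    refine Iff.trans ?_ (sum_tmul_eq_iff _ c hc _ _)
    simp [hφ]
  have hR (m) : R'.coactSrc (f m) = TensorProduct.map f.toLinearMap
      (φ : MonoidAlgebra k G →ₗ[k] MonoidAlgebra k G') (R.coactSrc m) ↔
      ∀ g, f (funAct Arrow.src m (GroupFun.delta (σ.symm g))) =
        funAct Arrow.src (f m) (GroupFun.delta g) := by
    rw [coactSrc_eq_sum, coactSrc_eq_sum, map_sum, ← σ.symm.toEquiv.sum_comp, eq_comm]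
    simp only [TensorProduct.map_tmul]
    refine Iff.trans ?_ (sum_tmul_eq_iff' _ c hc _ _)
    simp [hφ]
  constructor
  · intro H
    refine ⟨fun g m ↦ ?_, fun g m ↦ ?_, fun x m ↦ ?_, fun x m ↦ ?_⟩
    · simpa using (hact R.actL R'.actL).mp H.map_actL g m
    · simpa using (hact (actR t) (actR t')).mp (fun b m ↦ H.map_actR m b) g m
    · simpa using (hR m).mp (H.map_coactR m) (σ x)
    · simpa using (hL m).mp (H.map_coactL m) (σ x)
  · intro H
    refine ⟨(hact R.actL R'.actL).mpr fun g m ↦ ?_,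
      fun m b ↦ (hact (actR t) (actR t')).mpr (fun g m ↦ ?_) b m,
      fun m ↦ (hL m).mpr fun g ↦ ?_, fun m ↦ (hR m).mpr fun g ↦ ?_⟩
    · simpa using H.map_mulL g m
    · simpa using H.map_right g m
    · rw [H.map_tgt]; simp
    · rw [H.map_src]; simp

theorem coarrow_equivAlong_iff (t : R.CosetReps) (t' : R'.CosetReps) :
    (coarrow t).EquivAlong (coarrow t') ↔ ∃ σ f, ArrowIso (mulR t) (mulR t') σ f := by
  constructor
  · rintro ⟨φ, f, hf⟩
    obtain ⟨σ, hσ⟩ := exists_mulEquiv_of_monoidAlgebra_bialgEquiv φ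
    exact ⟨σ, f, (coarrow_isHomAlong_iff t t' hσ f).mp hf⟩
  · rintro ⟨σ, f, hf⟩
    exact ⟨MonoidAlgebra.domCongrBialgEquiv k k σ, f,
      (coarrow_isHomAlong_iff t t' (fun g ↦ MonoidAlgebra.domCongr_single (R := k) σ g (1 : k)) f).mpr hf⟩

/-- Compared with `kG` the roles are exchanged: the actions, tested on delta functions, now give the
decompositions by endpoints, and the coefficients of the coactions give the translations. The
conditions are those of `ArrowIso` with transposed right translations. -/
theorem arrow_isHomAlong_iff (t : R.CosetReps) (t' : R'.CosetReps)
    {φ : GroupFun k G ≃ₐc[k] GroupFun k G'} {σ : G ≃* G'}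
    (hφ : ∀ g, φ (GroupFun.delta g) = GroupFun.delta (σ g))
    (f : (R.Arrow →₀ k) ≃ₗ[k] (R'.Arrow →₀ k)) :
    (arrow t).IsHomAlong (arrow t') φ f ↔ ArrowIso (mulT t) (mulT t') σ f := by
  have hc : ∀ i j : G', GroupFun.eval i (GroupFun.delta j : GroupFun k G') = if j = i then 1 else 0 :=
    fun i j ↦ GroupFun.eval_delta j i
  have hact (p : R.Arrow → G) (p' : R'.Arrow → G') :
      (∀ m b, f (funAct p m b) = funAct p' (f m) (φ b)) ↔
      ∀ x m, f (funAct p m (GroupFun.delta x)) = funAct p' (f m) (GroupFun.delta (σ x)) := by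
    refine ⟨fun H x m ↦ by rw [H, hφ], fun H m b ↦ ?_⟩
    refine LinearMap.congr_fun (f := f.toLinearMap ∘ₗ funAct p m)
      (g := funAct p' (f m) ∘ₗ (φ : GroupFun k G →ₗ[k] GroupFun k G')) ?_ b
    exact GroupFun.hom_ext fun x ↦ by simp [H, hφ]
  have hL (m) : R'.coactFunL (f m) = TensorProduct.map
      (φ : GroupFun k G →ₗ[k] GroupFun k G') f.toLinearMap (R.coactFunL m) ↔
      ∀ g, f (mulL (σ.symm g⁻¹) m) = mulL g⁻¹ (f m) := by
    rw [coactFunL_apply, coactFunL_apply, map_sum, ← σ.symm.toEquiv.sum_comp, eq_comm]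
    simp only [TensorProduct.map_tmul]
    refine Iff.trans ?_ (sum_tmul_eq_iff (A := GroupFun k G') GroupFun.delta
      (fun i ↦ GroupFun.eval i) hc _ _)
    simp [hφ]
  have hR (m) : coactFunR t' (f m) = TensorProduct.map f.toLinearMap
      (φ : GroupFun k G →ₗ[k] GroupFun k G') (coactFunR t m) ↔
      ∀ g, f (mulT t (σ.symm g) m) = mulT t' g (f m) := by
    rw [coactFunR_apply, coactFunR_apply, map_sum, ← σ.symm.toEquiv.sum_comp, eq_comm]
    simp only [TensorProduct.map_tmul]
    refine Iff.trans ?_ (sum_tmul_eq_iff' (A := GroupFun k G') GroupFun.delta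
      (fun i ↦ GroupFun.eval i) hc _ _)
    simp [hφ]
  constructor
  · intro H
    refine ⟨fun g m ↦ ?_, fun g m ↦ ?_, (hact _ _).mp H.map_actR,
      (hact _ _).mp fun m b ↦ H.map_actL b m⟩
    -- The coefficient of the left coaction at an element is translation by its inverse, hence the
    -- evaluation at `(σ g)⁻¹`.
    · simpa using (hL m).mp (H.map_coactL m) (σ g)⁻¹
    · simpa using (hR m).mp (H.map_coactR m) (σ g)
  · intro H
    refine ⟨fun b m ↦ (hact _ _).mpr H.map_tgt m b, (hact _ _).mpr H.map_src,
      fun m ↦ (hL m).mpr fun g ↦ ?_, fun m ↦ (hR m).mpr fun g ↦ ?_⟩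
    · rw [H.map_mulL]; simp
    · rw [H.map_right]; simp

theorem arrow_equivAlong_iff (t : R.CosetReps) (t' : R'.CosetReps) :
    (arrow t).EquivAlong (arrow t') ↔ ∃ σ f, ArrowIso (mulT t) (mulT t') σ f := by
  constructor
  · rintro ⟨φ, f, hf⟩
    obtain ⟨σ, hσ⟩ := GroupFun.exists_mulEquiv_of_bialgEquiv φ
    exact ⟨σ, f, (arrow_isHomAlong_iff t t' hσ f).mp hf⟩
  · rintro ⟨σ, f, hf⟩
    exact ⟨GroupFun.congr σ, f, (arrow_isHomAlong_iff t t' (GroupFun.congr_delta σ) f).mpr hf⟩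

end RSR
end ArrowIso

/-! ### Duality for finite quivers: transposes in the basis of arrows. -/

section Transpose

set_option linter.unusedSectionVars false

namespace RSR

variable {k : Type*} [Field k] {G : Type*} [Group G] {R : RSR k G}

/-- The source, the target, and the index of the representation to which an arrow belongs. -/
def Arrow.block (a : R.Arrow) : G × G × Σ C, R.I C := (a.src, a.tgt, ⟨a.cls, a.i⟩)

theorem emb_apply (x y : G) (C hC) (i : R.I C) (v : R.J C i →₀ k) (j : R.J C i) :
    emb x y C hC i v ⟨x, y, C, hC, i, j⟩ = v j := by
  refine Finsupp.mapDomain_apply (fun a b h ↦ ?_) v j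
  simpa using h

theorem emb_apply_of_ne (x y : G) (C hC) (i : R.I C) (v : R.J C i →₀ k) (a : R.Arrow)
    (ha : a.block ≠ (x, y, ⟨C, i⟩)) : emb x y C hC i v a = 0 := by
  refine Finsupp.mapDomain_of_notMem_range v a ?_
  rintro ⟨j, rfl⟩
  exact ha rfl

variable [Fintype G] [DecidableEq G] [Finite R.Arrow]

open Classical in
variable (R) in
/-- The isomorphism of the span of finitely many arrows with its dual. -/
def toDual : (R.Arrow →₀ k) ≃ₗ[k] Module.Dual k (R.Arrow →₀ k) :=
  (Finsupp.basisSingleOne (R := k) (ι := R.Arrow)).toDualEquiv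

theorem toDual_single (a : R.Arrow) (n : R.Arrow →₀ k) :
    R.toDual (Finsupp.single a 1) n = n a := by
  classical
  exact (Finsupp.basisSingleOne (R := k) (ι := R.Arrow)).toDual_apply_right a n

theorem toDual_comm (m n : R.Arrow →₀ k) : R.toDual m n = R.toDual n m := by
  refine LinearMap.congr_fun (f := R.toDual.toLinearMap) (g := R.toDual.toLinearMap.flip) ?_ m |>
    (LinearMap.congr_fun · n)
  refine Finsupp.lhom_ext' fun a ↦ LinearMap.ext_ring (Finsupp.lhom_ext' fun b ↦
    LinearMap.ext_ring ?_)
  classical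
  simp [toDual_single, Finsupp.single_apply, eq_comm]

/-- `X` and `Y` are transposes of each other with respect to the basis of arrows. -/
def IsTranspose (X Y : Module.End k (R.Arrow →₀ k)) : Prop :=
  ∀ m n, R.toDual (X m) n = R.toDual m (Y n)

theorem IsTranspose.symm {X Y : Module.End k (R.Arrow →₀ k)} (h : IsTranspose X Y) :
    IsTranspose Y X := fun m n ↦ by
  rw [toDual_comm, ← h, toDual_comm]

theorem isTranspose_of_single {X Y : Module.End k (R.Arrow →₀ k)}
    (h : ∀ a b, X (Finsupp.single a 1) b = Y (Finsupp.single b 1) a) : IsTranspose X Y := by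
  intro m n
  refine LinearMap.congr_fun (f := R.toDual.toLinearMap ∘ₗ X)
    (g := (LinearMap.lcomp k k Y) ∘ₗ R.toDual.toLinearMap) ?_ m |> (LinearMap.congr_fun · n)
  refine Finsupp.lhom_ext' fun a ↦ LinearMap.ext_ring (Finsupp.lhom_ext' fun b ↦
    LinearMap.ext_ring ?_)
  simp only [LinearMap.comp_apply, Finsupp.lsingle_apply, LinearEquiv.coe_coe,
    LinearMap.lcomp_apply, toDual_single]
  rw [toDual_comm, toDual_single, h]

/-- A left translation permutes the arrows, and the transpose of a permutation matrix is its
inverse. -/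
theorem isTranspose_mulL (g : G) : IsTranspose (R := R) (mulL g⁻¹) (mulL g) := by
  refine isTranspose_of_single ?_
  rintro ⟨x, y, C, hC, i, j⟩ ⟨x', y', C', hC', i', j'⟩
  rw [← emb_single, ← emb_single, mulL_emb, mulL_emb]
  -- If the block of the second arrow is not the translate of the block of the first, both matrix
  -- entries vanish.
  by_cases h : (x', y', (⟨C', i'⟩ : Σ C, R.I C)) = (g⁻¹ * x, g⁻¹ * y, ⟨C, i⟩)
  · simp only [Prod.mk.injEq, Sigma.mk.injEq] at h
    obtain ⟨rfl, rfl, rfl, h⟩ := h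
    obtain rfl := eq_of_heq h
    rw [emb_apply, emb_congr (mul_inv_cancel_left g x) (mul_inv_cancel_left g y) rfl (hC' := hC),
      emb_apply]
    classical
    rw [Finsupp.single_apply, Finsupp.single_apply]
    exact if_congr eq_comm rfl rfl
  · rw [emb_apply_of_ne _ _ _ _ _ _ _ h, emb_apply_of_ne]
    rintro h'
    refine h ?_
    simp only [Arrow.block, Prod.mk.injEq] at h' ⊢
    obtain ⟨rfl, rfl, h₂⟩ := h'
    simpa using h₂.symm

/-- Right translations permute the blocks of arrows. On a single block, `mulT` is by definition the
transpose of the operator of `ρ` that occurs in `mulR`. -/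
theorem isTranspose_mulT (t : R.CosetReps) (g : G) : IsTranspose (mulT t g) (mulR t g) := by
  refine isTranspose_of_single ?_
  rintro ⟨x, y, C, hC, i, j⟩ ⟨x', y', C', hC', i', j'⟩
  rw [← emb_single, ← emb_single, mulT_emb, mulR_emb]
  by_cases h : (x', y', (⟨C', i'⟩ : Σ C, R.I C)) = (x * g⁻¹, y * g⁻¹, ⟨C, i⟩)
  · simp only [Prod.mk.injEq, Sigma.mk.injEq] at h
    obtain ⟨rfl, rfl, rfl, h⟩ := h
    obtain rfl := eq_of_heq h
    rw [emb_apply, emb_congr (inv_mul_cancel_right x g) (inv_mul_cancel_right y g) rfl (hC' := hC),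
      emb_apply, transpose_single]
  · rw [emb_apply_of_ne _ _ _ _ _ _ _ h, emb_apply_of_ne]
    rintro h'
    refine h ?_
    simp only [Arrow.block, Prod.mk.injEq] at h' ⊢
    obtain ⟨rfl, rfl, h₂⟩ := h'
    simpa using h₂.symm

/-- A function on the group acts diagonally in the basis of arrows, so its operator is its own
transpose. -/
theorem isTranspose_funAct (p : R.Arrow → G) (x : G) :
    IsTranspose ((funAct p).flip (GroupFun.delta x)) ((funAct p).flip (GroupFun.delta x)) := by
  refine isTranspose_of_single fun a b ↦ ?_
  simp only [funAct, LinearMap.flip_apply, Finsupp.linearCombination_single, one_smul,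
    LinearMap.smulRight_apply, GroupFun.eval_delta, Finsupp.smul_apply]
  by_cases h : a = b
  · rw [h]
  · rw [Finsupp.single_eq_of_ne h, Finsupp.single_eq_of_ne (Ne.symm h)]
    simp

variable {G' : Type*} [Group G'] [Fintype G'] [DecidableEq G'] {R' : RSR k G'} [Finite R'.Arrow]

/-- The inverse transpose of a linear isomorphism. -/
def contragredient (f : (R.Arrow →₀ k) ≃ₗ[k] (R'.Arrow →₀ k)) :
    (R.Arrow →₀ k) ≃ₗ[k] (R'.Arrow →₀ k) :=
  R.toDual ≪≫ₗ f.symm.dualMap ≪≫ₗ R'.toDual.symm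

theorem toDual_contragredient (f : (R.Arrow →₀ k) ≃ₗ[k] (R'.Arrow →₀ k)) (m n) :
    R'.toDual (contragredient f m) n = R.toDual m (f.symm n) := by
  simp [contragredient]

/-- Transposing `f Y = Y' f` reverses the compositions, and inverting the transpose of `f` restores
their order. -/
theorem contragredient_comm {f : (R.Arrow →₀ k) ≃ₗ[k] (R'.Arrow →₀ k)}
    {X Y : Module.End k (R.Arrow →₀ k)} {X' Y' : Module.End k (R'.Arrow →₀ k)}
    (h : IsTranspose X Y) (h' : IsTranspose X' Y') (hf : ∀ m, f (Y m) = Y' (f m)) (m) :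
    contragredient f (X m) = X' (contragredient f m) := by
  apply R'.toDual.injective
  refine LinearMap.ext fun n ↦ ?_
  rw [toDual_contragredient, h, h', toDual_contragredient]
  congr 1
  apply f.injective
  rw [hf, LinearEquiv.apply_symm_apply, LinearEquiv.apply_symm_apply]

/-- The left translations are stable under transposition as a family and the endpoint projections
are self-transpose, so only the right translations change. -/
theorem ArrowIso.dual {S T : G → Module.End k (R.Arrow →₀ k)}
    {S' T' : G' → Module.End k (R'.Arrow →₀ k)} {σ : G ≃* G'}
    {f : (R.Arrow →₀ k) ≃ₗ[k] (R'.Arrow →₀ k)} (hf : ArrowIso S S' σ f)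
    (h : ∀ g, IsTranspose (T g) (S g)) (h' : ∀ g, IsTranspose (T' g) (S' g)) :
    ArrowIso T T' σ (contragredient f) where
  map_mulL g m := by
    have h₁ := (isTranspose_mulL (R := R) g).symm
    have h₂ := (isTranspose_mulL (R := R') (σ g)).symm
    exact contragredient_comm h₁ h₂ (fun m ↦ by rw [hf.map_mulL, map_inv]) m
  map_right g m := contragredient_comm (h g) (h' (σ g)) (hf.map_right g) m
  map_src x m := by
    have h₁ := isTranspose_funAct (R := R) Arrow.src x
    have h₂ := isTranspose_funAct (R := R') Arrow.src (σ x)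
    exact contragredient_comm h₁ h₂ (hf.map_src x) m
  map_tgt x m := by
    have h₁ := isTranspose_funAct (R := R) Arrow.tgt x
    have h₂ := isTranspose_funAct (R := R') Arrow.tgt (σ x)
    exact contragredient_comm h₁ h₂ (hf.map_tgt x) m

theorem finite_arrow_of_equiv {R : RSR k G} [Finite R.Arrow] {R' : RSR k G'}
    (f : (R.Arrow →₀ k) ≃ₗ[k] (R'.Arrow →₀ k)) : Finite R'.Arrow :=
  .of_equiv _ (Finsupp.basisSingleOne.indexEquiv (Finsupp.basisSingleOne.map f.symm))

/-- Transposition is symmetric, so the same duality argument gives both implications. -/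
theorem exists_arrowIso_mulT_iff {R : RSR k G} [Finite R.Arrow] {R' : RSR k G'}
    (t : R.CosetReps) (t' : R'.CosetReps) :
    (∃ σ f, ArrowIso (mulT t) (mulT t') σ f) ↔ ∃ σ f, ArrowIso (mulR t) (mulR t') σ f := by
  -- Finiteness is assumed for one quiver only. The isomorphism `f` equates the cardinalities of the
  -- bases and provides it for the other, where the identification with the dual is needed too.
  constructor <;> rintro ⟨σ, f, hf⟩ <;> have := finite_arrow_of_equiv f
  · exact ⟨σ, _, hf.dual (fun g ↦ (isTranspose_mulT t g).symm)
      fun g ↦ (isTranspose_mulT t' g).symm⟩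
  · exact ⟨σ, _, hf.dual (isTranspose_mulT t) (isTranspose_mulT t')⟩

end RSR
end Transpose

/-! ### Block-diagonal operators on direct sums. -/

section SigmaMap

variable {k : Type*} [Field k] {I : Type*} {J : I → Type*}

/-- The direct sum of a family of endomorphisms. -/
def sigmaMap (T : ∀ i, Module.End k (J i →₀ k)) : Module.End k ((Σ i, J i) →₀ k) :=
  Finsupp.linearCombination k fun a ↦ sigmaIncl J a.1 (T a.1 (Finsupp.single a.2 1))

theorem sigmaIncl_single (i : I) (j : J i) (c : k) :
    sigmaIncl J i (Finsupp.single j c) = Finsupp.single ⟨i, j⟩ c := by simp [sigmaIncl]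

theorem sigma_hom_ext {V : Type*} [AddCommMonoid V] [Module k V] {f g : ((Σ i, J i) →₀ k) →ₗ[k] V}
    (h : ∀ i v, f (sigmaIncl J i v) = g (sigmaIncl J i v)) : f = g :=
  Finsupp.lhom_ext fun a c ↦ by
    have := h a.1 (Finsupp.single a.2 c)
    rwa [sigmaIncl_single] at this

theorem sigmaMap_sigmaIncl (T : ∀ i, Module.End k (J i →₀ k)) (i : I) (v : J i →₀ k) :
    sigmaMap T (sigmaIncl J i v) = sigmaIncl J i (T i v) := by
  refine LinearMap.congr_fun (f := sigmaMap T ∘ₗ sigmaIncl J i) (g := sigmaIncl J i ∘ₗ T i) ?_ v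
  refine Finsupp.lhom_ext' fun j ↦ LinearMap.ext_ring ?_
  simp [sigmaIncl_single, sigmaMap]

theorem sigmaProj_sigmaIncl_self (i : I) (v : J i →₀ k) :
    sigmaProj J i (sigmaIncl J i v) = v :=
  Finsupp.ext fun j ↦ Finsupp.mapDomain_apply sigma_mk_injective v j

theorem sigmaProj_sigmaIncl_of_ne {i i' : I} (h : i' ≠ i) (v : J i →₀ k) :
    sigmaProj J i' (sigmaIncl J i v) = 0 :=
  Finsupp.ext fun j ↦ Finsupp.mapDomain_of_notMem_range v _ (by
    rintro ⟨j', hj'⟩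
    exact h (congrArg Sigma.fst hj').symm)

theorem sigmaProj_sigmaMap (T : ∀ i, Module.End k (J i →₀ k)) (i : I) (w : (Σ i, J i) →₀ k) :
    sigmaProj J i (sigmaMap T w) = T i (sigmaProj J i w) := by
  refine LinearMap.congr_fun (f := sigmaProj J i ∘ₗ sigmaMap T) (g := T i ∘ₗ sigmaProj J i)
    (sigma_hom_ext fun i' v ↦ ?_) w
  simp only [LinearMap.comp_apply, sigmaMap_sigmaIncl]
  by_cases h : i = i'
  · subst h
    rw [sigmaProj_sigmaIncl_self, sigmaProj_sigmaIncl_self]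
  · rw [sigmaProj_sigmaIncl_of_ne h, sigmaProj_sigmaIncl_of_ne h, map_zero]

/-- Commuting with the block-diagonal operators implies equivariance of all blocks of `F`, and of
`F.symm` as well, which uniqueness of decompositions asks for. -/
theorem exists_index_equiv_of_comm {Γ : Type*} [Monoid Γ] {I' : Type*} {J' : I' → Type*}
    [∀ i, Finite (J i)] [∀ i, Finite (J' i)]
    {ρ : ∀ i, Representation k Γ (J i →₀ k)} {ρ' : ∀ i, Representation k Γ (J' i →₀ k)}
    (hρ : ∀ i, (ρ i).IsIrreducible) (hρ' : ∀ i, (ρ' i).IsIrreducible)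
    (F : ((Σ i, J i) →₀ k) ≃ₗ[k] ((Σ i, J' i) →₀ k))
    (hF : ∀ g w, F (sigmaMap (fun i ↦ ρ i g) w) = sigmaMap (fun i ↦ ρ' i g) (F w)) :
    ∃ e : I ≃ I', ∀ i, Nonempty ((ρ i).Equiv (ρ' (e i))) := by
  refine exists_index_equiv hρ hρ' F (fun g i v i' ↦ ?_) fun g i v i' ↦ ?_
  · rw [← sigmaMap_sigmaIncl (fun i ↦ ρ i g), hF, sigmaProj_sigmaMap]
  · rw [← sigmaMap_sigmaIncl (fun i ↦ ρ' i g), ← sigmaProj_sigmaMap (fun i ↦ ρ i g)]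
    congr 1
    apply F.injective
    rw [hF, F.apply_symm_apply, F.apply_symm_apply]

end SigmaMap

/-! ### Recovering the representations from the arrows between `1` and `u C`. -/

section Classification

set_option linter.unusedSectionVars false

namespace RSR

variable {k : Type*} [Field k]
variable {G : Type*} [Group G] {G' : Type*} [Group G']
variable {R : RSR k G} {R' : RSR k G'}

section Loop

/-- The conjugation `m ↦ g⁻¹ m g` on the span of the arrows. -/
def conj (t : R.CosetReps) (g : G) : Module.End k (R.Arrow →₀ k) := mulL g⁻¹ ∘ₗ mulR t g

theorem conj_emb (t : R.CosetReps) (g x y : G) (C hC) (i : R.I C) (v) :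
    conj t g (emb x y C hC i v) = emb (g⁻¹ * (x * g)) (g⁻¹ * (y * g)) C
      ((mk_mulLeft _ _ _).trans ((mk_mulRight g x y).trans hC)) i
      (R.ρ C i (MulOpposite.op (t.zeta C (x⁻¹ * y) hC g)) v) := by
  rw [conj, LinearMap.comp_apply, mulR_emb, mulL_emb]

theorem mulR_mulR (t : R.CosetReps) (g h : G) (m) : mulR t g (mulR t h m) = mulR t (h * g) m :=
  (LinearMap.congr_fun (congrArg MulOpposite.unop ((rightHom t).map_mul h g)) m).symm

theorem mulL_mulL' (g h : G) (m : R.Arrow →₀ k) : mulL g (mulL h m) = mulL (g * h) m :=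
  (LinearMap.congr_fun (R.leftHom.map_mul g h) m).symm

theorem conj_conj (t : R.CosetReps) (g h : G) (m) : conj t g (conj t h m) = conj t (h * g) m := by
  simp only [conj, LinearMap.comp_apply, mulL_mulR, mulR_mulR, mulL_mulL', mul_inv_rev]

theorem conj_one (t : R.CosetReps) (m) : conj t 1 m = m := by
  have h₁ : mulL (1 : G) = (1 : Module.End k (R.Arrow →₀ k)) := R.leftHom.map_one
  have h₂ : mulR t 1 = 1 := congrArg MulOpposite.unop (rightHom t).map_one
  rw [conj, inv_one, h₁, h₂]
  rfl

/-- Conjugation as a linear isomorphism. -/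
def conjEquiv (t : R.CosetReps) (g : G) : (R.Arrow →₀ k) ≃ₗ[k] (R.Arrow →₀ k) :=
  LinearEquiv.ofLinearMap (conj t g) (conj t g⁻¹)
    (LinearMap.ext fun m ↦ by simp [conj_conj, conj_one])
    (LinearMap.ext fun m ↦ by simp [conj_conj, conj_one])

theorem mk_one_inv_mul_u (C : ConjClasses G) : ConjClasses.mk ((1 : G)⁻¹ * R.u C) = C := by
  rw [inv_one, one_mul, R.mk_u]

variable (R) in
/-- The arrow from `1` to `u C` with given indices. -/
def baseArrow (C : ConjClasses G) (a : Σ i : R.I C, R.J C i) : R.Arrow :=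
  ⟨1, R.u C, C, mk_one_inv_mul_u C, a.1, a.2⟩

theorem baseArrow_injective (C : ConjClasses G) : Function.Injective (R.baseArrow C) := by
  rintro ⟨i, j⟩ ⟨i', j'⟩ h
  simp only [baseArrow, Arrow.mk.injEq, true_and, heq_eq_eq] at h
  obtain ⟨rfl, h⟩ := h
  rw [eq_of_heq h]

variable (R) in
/-- The inclusion of the span of the arrows from `1` to `u C`. -/
def baseIncl (C : ConjClasses G) : ((Σ i : R.I C, R.J C i) →₀ k) →ₗ[k] (R.Arrow →₀ k) :=
  Finsupp.lmapDomain k k (R.baseArrow C)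

variable (R) in
/-- The projection onto the span of the arrows from `1` to `u C`. -/
def baseProj (C : ConjClasses G) : (R.Arrow →₀ k) →ₗ[k] ((Σ i : R.I C, R.J C i) →₀ k) :=
  Finsupp.lcomapDomain (R.baseArrow C) (baseArrow_injective C)

theorem baseIncl_sigmaIncl (C : ConjClasses G) (i : R.I C) (v : R.J C i →₀ k) :
    R.baseIncl C (sigmaIncl (R.J C) i v) = emb 1 (R.u C) C (mk_one_inv_mul_u C) i v :=
  (Finsupp.mapDomain_comp (f := Sigma.mk i) (g := R.baseArrow C)).symm

theorem baseProj_baseIncl (C : ConjClasses G) (w) : R.baseProj C (R.baseIncl C w) = w :=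
  Finsupp.ext fun a ↦ Finsupp.mapDomain_apply (baseArrow_injective C) w a

/-- Conjugation by an element of the centralizer fixes the endpoints `1` and `u C`, so it acts on
the arrows between them. The action is exactly the direct sum of the `ρ C i`, because the
representative that belongs to `u C` is `1`. -/
theorem conj_baseIncl (t : R.CosetReps) (C : ConjClasses G) (z : Subgroup.centralizer {R.u C})
    (w) : conj t z (R.baseIncl C w) =
      R.baseIncl C (sigmaMap (fun i ↦ R.ρ C i (MulOpposite.op z)) w) := by
  refine LinearMap.congr_fun (f := conj t z ∘ₗ R.baseIncl C)
    (g := R.baseIncl C ∘ₗ sigmaMap fun i ↦ R.ρ C i (MulOpposite.op z)) ?_ w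
  refine sigma_hom_ext fun i v ↦ ?_
  have hz : (z : G) * R.u C = R.u C * z := Subgroup.mem_centralizer_singleton_iff.mp z.2
  have hz' : (z : G)⁻¹ * (R.u C * z) = R.u C := by rw [← hz, inv_mul_cancel_left]
  simp only [LinearMap.comp_apply, sigmaMap_sigmaIncl, baseIncl_sigmaIncl, conj_emb]
  refine emb_congr (by simp) hz' ?_
  -- Both representatives in `ζ` belong to `u C` and equal `1` by `rep_u`, so `ζ` is `z` itself.
  congr 3
  ext
  simp [CosetReps.zeta, mul_assoc, hz', t.rep_u]

variable [Fintype G] [DecidableEq G] [Fintype G'] [DecidableEq G']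

variable (R) in
/-- The projection onto the span of the arrows with given source and target. -/
def srcTgt (x y : G) : Module.End k (R.Arrow →₀ k) :=
  (funAct Arrow.tgt).flip (GroupFun.delta y) ∘ₗ (funAct Arrow.src).flip (GroupFun.delta x)

theorem srcTgt_emb (x y x' y' : G) (C hC) (i : R.I C) (v) :
    R.srcTgt x y (emb x' y' C hC i v) = if x = x' ∧ y = y' then emb x' y' C hC i v else 0 := by
  simp only [srcTgt, LinearMap.comp_apply, LinearMap.flip_apply, funAct_src, GroupFun.eval_delta,
    map_smul, funAct_tgt]
  by_cases h : x = x' <;> by_cases h' : y = y' <;> simp [h, h']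

theorem baseIncl_baseProj (C : ConjClasses G) (m) :
    R.baseIncl C (R.baseProj C m) = R.srcTgt 1 (R.u C) m := by
  refine LinearMap.congr_fun (f := R.baseIncl C ∘ₗ R.baseProj C) (g := R.srcTgt 1 (R.u C))
    (emb_ext fun x y C' hC i v ↦ ?_) m
  rw [srcTgt_emb, LinearMap.comp_apply]
  split_ifs with h
  · obtain ⟨rfl, rfl⟩ := h
    -- The class of an arrow is forced by its endpoints.
    obtain rfl : C' = C := hC.symm.trans (mk_one_inv_mul_u C)
    rw [← baseIncl_sigmaIncl, baseProj_baseIncl]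
  · suffices R.baseProj C (emb x y C' hC i v) = 0 by rw [this, map_zero]
    refine Finsupp.ext fun a ↦ emb_apply_of_ne x y C' hC i v _ fun h' ↦ h ?_
    simp only [Arrow.block, baseArrow, Prod.mk.injEq] at h'
    exact ⟨h'.1, h'.2.1⟩

theorem conj_srcTgt (t : R.CosetReps) (g x y : G) (m) :
    conj t g (R.srcTgt x y m) = R.srcTgt (g⁻¹ * (x * g)) (g⁻¹ * (y * g)) (conj t g m) := by
  refine LinearMap.congr_fun (f := conj t g ∘ₗ R.srcTgt x y)
    (g := R.srcTgt (g⁻¹ * (x * g)) (g⁻¹ * (y * g)) ∘ₗ conj t g)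
    (emb_ext fun x y C' hC i v ↦ ?_) m
  simp only [LinearMap.comp_apply, srcTgt_emb, conj_emb, mul_right_inj, mul_left_inj]
  split_ifs
  · rw [conj_emb]
  · rw [map_zero]

end Loop

section OfArrowIso

variable [Fintype G] [DecidableEq G] [Fintype G'] [DecidableEq G']

theorem ArrowIso.map_srcTgt {S : G → Module.End k (R.Arrow →₀ k)}
    {S' : G' → Module.End k (R'.Arrow →₀ k)} {σ : G ≃* G'}
    {f : (R.Arrow →₀ k) ≃ₗ[k] (R'.Arrow →₀ k)} (hf : ArrowIso S S' σ f) (x y : G) (m) :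
    f (R.srcTgt x y m) = R'.srcTgt (σ x) (σ y) (f m) := by
  simp only [srcTgt, LinearMap.comp_apply, LinearMap.flip_apply, hf.map_tgt, hf.map_src]

theorem ArrowIso.map_conj {t : R.CosetReps} {t' : R'.CosetReps} {σ : G ≃* G'}
    {f : (R.Arrow →₀ k) ≃ₗ[k] (R'.Arrow →₀ k)} (hf : ArrowIso (mulR t) (mulR t') σ f) (g : G) (m) :
    f (conj t g m) = conj t' (σ g) (f m) := by
  simp only [conj, LinearMap.comp_apply, hf.map_mulL, hf.map_right, map_inv]

/-- The preimage of `φ w` is `c w c⁻¹`, which commutes with `u` exactly when `w` commutes with `c⁻¹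
u c`. -/
theorem centralizerHom_surjective (φ : G ≃* G') (c u : G) (u' : G')
    (hu : φ (c⁻¹ * u * c) = u') : Function.Surjective (centralizerHom φ c u u' hu) := by
  rintro ⟨z, hz⟩
  obtain ⟨w, rfl⟩ := φ.surjective z
  rw [Subgroup.mem_centralizer_singleton_iff, ← hu, ← map_mul, ← map_mul] at hz
  have hz := φ.injective hz
  refine ⟨⟨c * w * c⁻¹, ?_⟩, Subtype.ext ?_⟩
  · rw [Subgroup.mem_centralizer_singleton_iff]
    calc c * w * c⁻¹ * u = c * (w * (c⁻¹ * u * c)) * c⁻¹ := by group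
      _ = u * (c * w * c⁻¹) := by rw [hz]; group
  · change φ (c⁻¹ * (c * w * c⁻¹) * c) = φ w
    congr 1
    group

/-- For each class the spans of the arrows `1 → u C` and `1 → u' C'` become isomorphic along the map
of centralizers. Both are direct sums of finite-dimensional irreducibles, so uniqueness of the
decomposition matches the indices. -/
theorem ArrowIso.isIso {t : R.CosetReps} {t' : R'.CosetReps} {σ : G ≃* G'}
    {f : (R.Arrow →₀ k) ≃ₗ[k] (R'.Arrow →₀ k)} (hf : ArrowIso (mulR t) (mulR t') σ f) :
    R.IsIso R' := by
  refine ⟨σ, fun C ↦ ?_⟩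
  generalize hC' : C.map σ.toMonoidHom = C'
  -- Both `σ (u C)` and `u' C'` lie in the class `C'`, hence are conjugate in `G'`; the conjugating
  -- element is inverted and pulled back through `σ`.
  obtain ⟨c, hc⟩ : ∃ c, σ (c⁻¹ * R.u C * c) = R'.u C' := by
    have h₁ : ConjClasses.mk (σ (R.u C)) = ConjClasses.mk (R'.u C') := by
      rw [R'.mk_u, ← hC']
      conv_rhs => rw [← R.mk_u C]
      rfl
    obtain ⟨c, hc⟩ := isConj_iff.mp (ConjClasses.mk_eq_mk_iff_isConj.mp h₁)
    exact ⟨σ.symm c⁻¹, by simp [hc]⟩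
  refine ⟨c, hc, ?_⟩
  -- `f` takes arrows `1 → u C` to arrows `1 → σ (u C)`; conjugation by `σ c` then moves the target
  -- to `u' C'` and keeps the source `1`.
  let Fc := f ≪≫ₗ conjEquiv t' (σ c)
  have hFc (m) : Fc m = conj t' (σ c) (f m) := rfl
  have hsrc (m) : Fc (R.srcTgt 1 (R.u C) m) = R'.srcTgt 1 (R'.u C') (Fc m) := by
    rw [hFc, hFc, hf.map_srcTgt, conj_srcTgt, ← hc]
    simp [mul_assoc]
  have hsrc' (m) : Fc.symm (R'.srcTgt 1 (R'.u C') m) = R.srcTgt 1 (R.u C) (Fc.symm m) := by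
    apply Fc.injective
    rw [hsrc, Fc.apply_symm_apply, Fc.apply_symm_apply]
  have h₁ (w) : R'.baseIncl C' (R'.baseProj C' (Fc (R.baseIncl C w))) = Fc (R.baseIncl C w) := by
    rw [baseIncl_baseProj, ← hsrc, ← baseIncl_baseProj, baseProj_baseIncl]
  have h₂ (w) : R.baseIncl C (R.baseProj C (Fc.symm (R'.baseIncl C' w))) =
      Fc.symm (R'.baseIncl C' w) := by
    rw [baseIncl_baseProj, ← hsrc', ← baseIncl_baseProj, baseProj_baseIncl]
  let F : ((Σ i : R.I C, R.J C i) →₀ k) ≃ₗ[k] ((Σ i : R'.I C', R'.J C' i) →₀ k) :=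
    LinearEquiv.ofLinearMap (R'.baseProj C' ∘ₗ Fc.toLinearMap ∘ₗ R.baseIncl C)
      (R.baseProj C ∘ₗ Fc.symm.toLinearMap ∘ₗ R'.baseIncl C')
      (LinearMap.ext fun w ↦ by simp [h₂, baseProj_baseIncl])
      (LinearMap.ext fun w ↦ by simp [h₁, baseProj_baseIncl])
  have hF (w) : F w = R'.baseProj C' (Fc (R.baseIncl C w)) := rfl
  -- Conjugation by `σ z` followed by that by `σ c` equals conjugation by `σ c` followed by that by
  -- `σ (c⁻¹ z c)`. This is where the twist of `centralizerHom` arises.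
  have hconj (z : G) (m) : Fc (conj t z m) = conj t' (σ (c⁻¹ * z * c)) (Fc m) := by
    rw [hFc, hFc, hf.map_conj, conj_conj, conj_conj]
    simp [mul_assoc]
  refine exists_index_equiv_of_comm (R.irreducible C) (fun i ↦ (R'.irreducible C' i).comp_surjective
    (f := (centralizerHom σ c _ _ hc).op) ?_) F ?_
  · intro z
    obtain ⟨w, hw⟩ := centralizerHom_surjective σ c _ _ hc z.unop
    exact ⟨MulOpposite.op w, MulOpposite.unop_injective hw⟩
  · intro g w
    rw [hF, ← MulOpposite.op_unop g, ← conj_baseIncl t, hconj, ← h₁]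
    refine Eq.trans (congrArg _ (conj_baseIncl t' C' (centralizerHom σ c _ _ hc g.unop) _)) ?_
    rw [baseProj_baseIncl]
    rfl

end OfArrowIso

end RSR
end Classification

/-! ### Building an isomorphism of arrow spaces from an isomorphism of ramification systems. -/

namespace RSR

variable {k : Type*} [Field k]
variable {G : Type*} [Group G] {G' : Type*} [Group G']
variable {R : RSR k G} {R' : RSR k G'}

section BlockEquiv

theorem map_mk_inv_mul (σ : G ≃* G') {x y : G} {C : ConjClasses G}
    (hC : ConjClasses.mk (x⁻¹ * y) = C) :
    ConjClasses.mk ((σ x)⁻¹ * σ y) = C.map σ.toMonoidHom := by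
  rw [← hC, ← map_inv, ← map_mul]
  rfl

theorem map_conjClasses_injective (σ : G ≃* G') :
    Function.Injective (ConjClasses.map σ.toMonoidHom) := by
  refine Function.LeftInverse.injective (g := ConjClasses.map σ.symm.toMonoidHom) fun C ↦ ?_
  induction C using Quotient.inductionOn with
  | h a => exact congrArg ConjClasses.mk (σ.symm_apply_apply a)

variable (σ : G ≃* G') (e : ∀ C, R.I C ≃ R'.I (C.map σ.toMonoidHom))
  (F : ∀ (d : G) (C : ConjClasses G) (_ : ConjClasses.mk d = C) (i : R.I C),
    (R.J C i →₀ k) ≃ₗ[k] (R'.J (C.map σ.toMonoidHom) (e C i) →₀ k))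

/-- The map between the spans of the arrows that is given by `F` on the arrows from `x` to `y` of
class `C` with index `i`. -/
def blockHom : (R.Arrow →₀ k) →ₗ[k] (R'.Arrow →₀ k) :=
  Finsupp.linearCombination k fun a ↦ emb (σ a.src) (σ a.tgt) (a.cls.map σ.toMonoidHom)
    (map_mk_inv_mul σ a.mk_eq) (e a.cls a.i)
    (F (a.src⁻¹ * a.tgt) a.cls a.mk_eq a.i (Finsupp.single a.j 1))

theorem blockHom_emb (x y : G) (C hC) (i : R.I C) (v) :
    blockHom σ e F (emb x y C hC i v) = emb (σ x) (σ y) (C.map σ.toMonoidHom)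
      (map_mk_inv_mul σ hC) (e C i) (F (x⁻¹ * y) C hC i v) := by
  refine LinearMap.congr_fun (f := blockHom σ e F ∘ₗ emb x y C hC i)
    (g := emb (σ x) (σ y) _ (map_mk_inv_mul σ hC) (e C i) ∘ₗ (F (x⁻¹ * y) C hC i).toLinearMap) ?_ v
  refine Finsupp.lhom_ext fun j c ↦ ?_
  simp only [LinearMap.comp_apply, emb_single, blockHom, Finsupp.linearCombination_single,
    LinearEquiv.coe_coe]
  rw [← map_smul, ← map_smul, Finsupp.smul_single, smul_eq_mul, mul_one]

theorem mk_injective (x y : G) (C hC) (i : R.I C) :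
    Function.Injective fun j : R.J C i ↦ (⟨x, y, C, hC, i, j⟩ : R.Arrow) := by
  intro a b h
  simpa using h

/-- The projection onto the span of the arrows from `x` to `y` of class `C` with index `i`. -/
def proj (x y : G) (C : ConjClasses G) (hC : ConjClasses.mk (x⁻¹ * y) = C) (i : R.I C) :
    (R.Arrow →₀ k) →ₗ[k] (R.J C i →₀ k) :=
  Finsupp.lcomapDomain _ (mk_injective x y C hC i)

/-- Distinct blocks go to distinct blocks, since `σ`, the induced map on classes and each `e C` are
injective. Thus every coefficient of `m` can be recovered from its image. -/
theorem proj_blockHom (x y : G) (C hC) (i : R.I C) (m) :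
    proj (σ x) (σ y) _ (map_mk_inv_mul σ hC) (e C i) (blockHom σ e F m) =
      F (x⁻¹ * y) C hC i (proj x y C hC i m) := by
  refine LinearMap.congr_fun
    (f := proj (σ x) (σ y) _ (map_mk_inv_mul σ hC) (e C i) ∘ₗ blockHom σ e F)
    (g := (F (x⁻¹ * y) C hC i).toLinearMap ∘ₗ proj x y C hC i)
    (emb_ext fun x' y' C' hC' i' v ↦ ?_) m
  simp only [LinearMap.comp_apply, LinearEquiv.coe_coe, blockHom_emb]
  by_cases h : (x, y, (⟨C, i⟩ : Σ C, R.I C)) = (x', y', ⟨C', i'⟩)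
  · simp only [Prod.mk.injEq, Sigma.mk.injEq] at h
    obtain ⟨rfl, rfl, rfl, h⟩ := h
    obtain rfl := eq_of_heq h
    have h₁ : proj x y C hC i (emb x y C hC' i v) = v := Finsupp.ext fun j ↦ emb_apply ..
    rw [h₁]
    exact Finsupp.ext fun j ↦ emb_apply ..
  · have h₁ : proj x y C hC i (emb x' y' C' hC' i' v) = 0 :=
      Finsupp.ext fun j ↦ emb_apply_of_ne _ _ _ _ _ _ _ h
    rw [h₁, map_zero]
    refine Finsupp.ext fun j ↦ emb_apply_of_ne _ _ _ _ _ _ _ fun h' ↦ h ?_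
    simp only [Arrow.block, Prod.mk.injEq, Sigma.mk.injEq, EmbeddingLike.apply_eq_iff_eq] at h'
    obtain ⟨rfl, rfl, h₂, h'⟩ := h'
    obtain rfl := map_conjClasses_injective σ h₂
    rw [(e C).injective (eq_of_heq h')]

variable [Fintype G'] [DecidableEq G']

theorem blockHom_bijective : Function.Bijective (blockHom σ e F) := by
  constructor
  · rw [← LinearMap.ker_eq_bot, LinearMap.ker_eq_bot']
    refine fun m hm ↦ Finsupp.ext fun a ↦ ?_
    have h := proj_blockHom σ e F a.src a.tgt a.cls a.mk_eq a.i m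
    rw [hm, map_zero, eq_comm, LinearEquiv.map_eq_zero_iff] at h
    exact DFunLike.congr_fun h a.j
  · intro m
    induction m using emb_induction with
    | h0 => exact ⟨0, map_zero _⟩
    | ha x y hx hy =>
      obtain ⟨x, rfl⟩ := hx
      obtain ⟨y, rfl⟩ := hy
      exact ⟨x + y, map_add _ x y⟩
    | h x y C hC i v =>
      obtain ⟨x, rfl⟩ := σ.surjective x
      obtain ⟨y, rfl⟩ := σ.surjective y
      -- Once the endpoints are pulled back through `σ`, the class of the target block is the image
      -- of the class of the source block.
      obtain rfl := (map_mk_inv_mul σ rfl).symm.trans hC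
      obtain ⟨i, rfl⟩ := (e _).surjective i
      obtain ⟨v, rfl⟩ := (F (x⁻¹ * y) _ rfl i).surjective v
      exact ⟨emb x y _ rfl i v, blockHom_emb ..⟩

/-- The map `blockHom` as a linear isomorphism. -/
def blockEquiv : (R.Arrow →₀ k) ≃ₗ[k] (R'.Arrow →₀ k) :=
  LinearEquiv.ofBijective (blockHom σ e F) (blockHom_bijective σ e F)

theorem blockEquiv_emb (x y : G) (C hC) (i : R.I C) (v) :
    blockEquiv σ e F (emb x y C hC i v) = emb (σ x) (σ y) (C.map σ.toMonoidHom)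
      (map_mk_inv_mul σ hC) (e C i) (F (x⁻¹ * y) C hC i v) :=
  blockHom_emb ..

end BlockEquiv

theorem mk_conj_eq {d : G} {C : ConjClasses G} (hd : ConjClasses.mk d = C) (g : G) :
    ConjClasses.mk (g⁻¹ * d * g) = C := by
  rw [← hd, ConjClasses.mk_eq_mk_iff_isConj, isConj_comm, isConj_iff]
  exact ⟨g⁻¹, by simp⟩

/-- The block at an arrow `x → y` depends on its endpoints only through `d = x⁻¹ y`, which left
translations do not change. So left translations and endpoints are respected automatically, and
right translations, which conjugate `d`, give the one condition `hF`. -/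
theorem exists_arrowIso_of_blocks [Fintype G] [DecidableEq G] [Fintype G'] [DecidableEq G']
    {t : R.CosetReps} {t' : R'.CosetReps} (σ : G ≃* G')
    (e : ∀ C, R.I C ≃ R'.I (C.map σ.toMonoidHom))
    (F : ∀ (d : G) (C : ConjClasses G) (_ : ConjClasses.mk d = C) (i : R.I C),
      (R.J C i →₀ k) ≃ₗ[k] (R'.J (C.map σ.toMonoidHom) (e C i) →₀ k))
    (hF : ∀ d C hd hd' (i : R.I C) g v,
      F (g⁻¹ * d * g) C (mk_conj_eq hd g) i (R.ρ C i (MulOpposite.op (t.zeta C d hd g)) v) =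
      R'.ρ _ (e C i) (MulOpposite.op (t'.zeta (C.map σ.toMonoidHom) (σ d) hd' (σ g)))
        (F d C hd i v)) :
    ArrowIso (mulR t) (mulR t') σ (blockEquiv σ e F) := by
  have hFd {d d' : G} {C : ConjClasses G} {hd hd'} {i : R.I C} {v} (h : d = d') :
      F d C hd i v = F d' C hd' i v := by
    subst h; rfl
  have hz {d d' : G'} {C : ConjClasses G'} {hd hd'} {g} (h : d = d') :
      t'.zeta C d hd g = t'.zeta C d' hd' g := by
    subst h; rfl
  constructor
  · intro g m
    induction m using emb_induction with
    | h0 => simp only [map_zero]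
    | ha x y hx hy => simp only [map_add, hx, hy]
    | h x y C hC i v =>
      rw [mulL_emb, blockEquiv_emb, blockEquiv_emb, mulL_emb]
      exact emb_congr (map_mul ..) (map_mul ..) (hFd (by group))
  · intro g m
    induction m using emb_induction with
    | h0 => simp only [map_zero]
    | ha x y hx hy => simp only [map_add, hx, hy]
    | h x y C hC i v =>
      rw [mulR_emb, blockEquiv_emb, blockEquiv_emb, mulR_emb]
      refine emb_congr (map_mul ..) (map_mul ..) ?_
      have h := hF (x⁻¹ * y) C hC
        (by rw [map_mul, map_inv]; exact map_mk_inv_mul σ hC) i g v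
      rw [hz (d' := (σ x)⁻¹ * σ y) (hd' := map_mk_inv_mul σ hC) (by simp)] at h
      rw [← h]
      exact hFd (by group)
  · intro g m
    induction m using emb_induction with
    | h0 => simp only [map_zero, LinearMap.zero_apply]
    | ha x y hx hy => simp only [map_add, LinearMap.add_apply, hx, hy]
    | h x y C hC i v =>
      rw [funAct_src, map_smul, blockEquiv_emb, funAct_src, GroupFun.eval_delta,
        GroupFun.eval_delta]
      simp only [EmbeddingLike.apply_eq_iff_eq]
  · intro g m
    induction m using emb_induction with
    | h0 => simp only [map_zero, LinearMap.zero_apply]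
    | ha x y hx hy => simp only [map_add, LinearMap.add_apply, hx, hy]
    | h x y C hC i v =>
      rw [funAct_tgt, map_smul, blockEquiv_emb, funAct_tgt, GroupFun.eval_delta,
        GroupFun.eval_delta]
      simp only [EmbeddingLike.apply_eq_iff_eq]

/-- The operator of a group element as a linear isomorphism. -/
def repEquiv {Γ V : Type*} [Group Γ] [AddCommGroup V] [Module k V] (ρ : Representation k Γ V)
    (g : Γ) : V ≃ₗ[k] V :=
  LinearEquiv.ofLinearMap (ρ g) (ρ g⁻¹)
    (by rw [← Module.End.mul_eq_comp, ← map_mul, mul_inv_cancel, map_one]; rfl)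
    (by rw [← Module.End.mul_eq_comp, ← map_mul, inv_mul_cancel, map_one]; rfl)

theorem repEquiv_apply {Γ V : Type*} [Group Γ] [AddCommGroup V] [Module k V]
    (ρ : Representation k Γ V) (g : Γ) (v : V) : repEquiv ρ g v = ρ g v := rfl

/-- Both `σ (c⁻¹ g)` and `g'` conjugate `u'` to `σ d`, so they differ by an element that centralizes
`u'`. -/
theorem mem_centralizer_transition {u d g c : G} {u' g' : G'} (σ : G ≃* G')
    (h₁ : g⁻¹ * u * g = d) (h₂ : g'⁻¹ * u' * g' = σ d) (h₃ : σ (c⁻¹ * u * c) = u') :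
    σ (c⁻¹ * g) * g'⁻¹ ∈ Subgroup.centralizer {u'} := by
  rw [Subgroup.mem_centralizer_singleton_iff]
  have h₄ : u' = g' * σ d * g'⁻¹ := by rw [← h₂]; group
  calc σ (c⁻¹ * g) * g'⁻¹ * u' = σ (c⁻¹ * g) * σ d * g'⁻¹ := by rw [h₄]; group
    _ = u' * (σ (c⁻¹ * g) * g'⁻¹) := by
      rw [← h₁, ← h₃, ← mul_assoc, ← map_mul, ← map_mul]
      congr 2
      group

/-- The block at `d` is the given intertwiner followed by the operator of `z d`, the discrepancy
between the coset representative of `d`, shifted by `c⁻¹` and transported by `σ`, and that of `σ d`.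
These corrections turn the cocycle `ζ` of one system into that of the other, for any choices of
representatives. -/
theorem IsIso.exists_arrowIso [Fintype G] [DecidableEq G] [Fintype G'] [DecidableEq G']
    (h : R.IsIso R') (t : R.CosetReps) (t' : R'.CosetReps) :
    ∃ σ f, ArrowIso (mulR t) (mulR t') σ f := by
  obtain ⟨σ, h⟩ := h
  choose c hc e E using h
  have hmap {d : G} {C : ConjClasses G} (hd : ConjClasses.mk d = C) :
      ConjClasses.mk (σ d) = C.map σ.toMonoidHom := by rw [← hd]; rfl
  let z (d : G) (C : ConjClasses G) (hd : ConjClasses.mk d = C) :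
      Subgroup.centralizer {R'.u (C.map σ.toMonoidHom)} :=
    ⟨σ ((c C)⁻¹ * t.rep d) * (t'.rep (σ d))⁻¹, mem_centralizer_transition σ (d := d)
      (by rw [← hd]; exact t.rep_spec d) (by rw [← hmap hd]; exact t'.rep_spec (σ d)) (hc C)⟩
  -- The twisted cocycle relation: after substitution the intermediate representatives cancel and
  -- both sides become `σ (c⁻¹ (rep d) g)` times the inverse of the representative of `σ (g⁻¹ d g)`.
  have hz (d C hd hd' g) : centralizerHom σ (c C) _ _ (hc C) (t.zeta C d hd g) *
      z (g⁻¹ * d * g) C (mk_conj_eq hd g) = z d C hd * t'.zeta _ (σ d) hd' (σ g) := by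
    refine Subtype.ext ?_
    change σ ((c C)⁻¹ * (t.rep d * g * (t.rep (g⁻¹ * d * g))⁻¹) * c C) *
      (σ ((c C)⁻¹ * t.rep (g⁻¹ * d * g)) * (t'.rep (σ (g⁻¹ * d * g)))⁻¹) =
      σ ((c C)⁻¹ * t.rep d) * (t'.rep (σ d))⁻¹ *
        (t'.rep (σ d) * σ g * (t'.rep ((σ g)⁻¹ * σ d * σ g))⁻¹)
    simp [mul_assoc]
  refine ⟨σ, _, exists_arrowIso_of_blocks σ e (fun d C hd i ↦ (E C i).some.toLinearEquiv ≪≫ₗ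
    repEquiv (R'.ρ _ (e C i)) (MulOpposite.op (z d C hd))) ?_⟩
  intro d C hd hd' i g v
  simp only [LinearEquiv.trans_apply, repEquiv_apply]
  have h₁ : (E C i).some.toLinearEquiv (R.ρ C i (MulOpposite.op (t.zeta C d hd g)) v) =
      R'.ρ _ (e C i) (MulOpposite.op (centralizerHom σ (c C) _ _ (hc C) (t.zeta C d hd g)))
        ((E C i).some.toLinearEquiv v) :=
    (E C i).some.toIntertwiningMap.isIntertwining _ _ _ v
  -- The representations are right actions, so composing operators reverses the group products; `hz`
  -- is stated in that reversed order.
  rw [h₁, ← Module.End.mul_apply, ← Module.End.mul_apply, ← map_mul, ← map_mul, ← MulOpposite.op_mul,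
    ← MulOpposite.op_mul, hz]

theorem exists_arrowIso_mulR_iff [Fintype G] [DecidableEq G] [Fintype G'] [DecidableEq G']
    (t : R.CosetReps) (t' : R'.CosetReps) :
    (∃ σ f, ArrowIso (mulR t) (mulR t') σ f) ↔ R.IsIso R' :=
  ⟨fun ⟨_, _, hf⟩ ↦ hf.isIso, fun h ↦ h.exists_arrowIso t t'⟩

end RSR

end
end QuiverHopf

/-! ### Assembly of the equivalences. -/

theorem theorem2 {k : Type*} [Field k]
    {G : Type*} [Group G] [Fintype G] [DecidableEq G]
    {G' : Type*} [Group G'] [Fintype G'] [DecidableEq G']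
    (hG : ¬ ringChar k ∣ Fintype.card G) (hG' : ¬ ringChar k ∣ Fintype.card G')
    (R : QuiverHopf.RSR k G) (R' : QuiverHopf.RSR k G') (t : R.CosetReps) (t' : R'.CosetReps) :
    List.TFAE [
      R.IsIso R',
      ∃ φ : MonoidAlgebra k G ≃ₐc[k] MonoidAlgebra k G',
        QuiverHopf.HopfBimodule.IsIso (QuiverHopf.RSR.coarrow t)
          ((QuiverHopf.RSR.coarrow t').pullPush φ),
      QuiverHopf.GradedIso (QuiverHopf.CotensorHopf.degree (QuiverHopf.RSR.coarrow t))
        (QuiverHopf.CotensorHopf.degree (QuiverHopf.RSR.coarrow t')),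
      QuiverHopf.GradedIso (QuiverHopf.TensorHopf.degree (QuiverHopf.RSR.coarrow t))
        (QuiverHopf.TensorHopf.degree (QuiverHopf.RSR.coarrow t')),
      QuiverHopf.GradedIso (QuiverHopf.OneTypeHopf.degree (QuiverHopf.RSR.coarrow t))
        (QuiverHopf.OneTypeHopf.degree (QuiverHopf.RSR.coarrow t'))] ∧
    (Finite R.Arrow → List.TFAE [
      R.IsIso R',
      QuiverHopf.GradedIso (QuiverHopf.TensorHopf.degree (QuiverHopf.RSR.arrow t))
        (QuiverHopf.TensorHopf.degree (QuiverHopf.RSR.arrow t')),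
      QuiverHopf.GradedIso (QuiverHopf.CotensorHopf.degree (QuiverHopf.RSR.arrow t))
        (QuiverHopf.CotensorHopf.degree (QuiverHopf.RSR.arrow t')),
      QuiverHopf.GradedIso (QuiverHopf.OneTypeHopf.degree (QuiverHopf.RSR.arrow t))
        (QuiverHopf.OneTypeHopf.degree (QuiverHopf.RSR.arrow t'))]) := by
  have hc : (QuiverHopf.RSR.coarrow t).EquivAlong (QuiverHopf.RSR.coarrow t') ↔ R.IsIso R' :=
    (QuiverHopf.RSR.coarrow_equivAlong_iff t t').trans
      (QuiverHopf.RSR.exists_arrowIso_mulR_iff t t')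
  constructor
  -- Every entry of the list becomes `R.IsIso R'`, which leaves equivalences of a proposition with
  -- itself.
  · rw [QuiverHopf.exists_isIso_pullPush_iff, QuiverHopf.CotensorHopf.gradedIso_iff,
      QuiverHopf.TensorHopf.gradedIso_iff, QuiverHopf.OneTypeHopf.gradedIso_iff, hc]
    simp
  · intro _
    have ha : (QuiverHopf.RSR.arrow t).EquivAlong (QuiverHopf.RSR.arrow t') ↔ R.IsIso R' :=
      (QuiverHopf.RSR.arrow_equivAlong_iff t t').trans
        ((QuiverHopf.RSR.exists_arrowIso_mulT_iff t t').trans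
          (QuiverHopf.RSR.exists_arrowIso_mulR_iff t t'))
    rw [QuiverHopf.CotensorHopf.gradedIso_iff, QuiverHopf.TensorHopf.gradedIso_iff,
      QuiverHopf.OneTypeHopf.gradedIso_iff, ha]
    simp
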